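/- **Setting.** Let $T>0$, let $\beta$ be continuous and positive on $[0,T]$, and let $d\mathbf z_t=-\frac12\beta(t)\mathbf z_t\,dt+\sqrt{\beta(t)}\,d\mathbf W_t$ be the variance-preserving diffusion on $\mathbb R^d$, so that $\mathbf z_t=\alpha_t\mathbf z_0+\sigma_t\boldsymbol\epsilon$ with $\boldsymbol\epsilon\sim\mathcal N(0,I)$ independent of $\mathbf z_0$, $\alpha_t=e^{-\frac12\int_0^t\beta}$ and $\sigma_t^2=1-\alpha_t^2$. Let $\omega\in C^1$ with $\omega(0)=0$. Let $p_0$ be a prior probability law on $\mathbb R^d$, and let $p_t$ be the density of $\mathbf z_t$ when $\mathbf z_0\sim p_0$. Assume that $\|\nabla\log p_t(\mathbf z)\|\le C(1+\|\mathbf z\|)^a$ uniformly in $t\in(0,T]$, and that the score is known exactly: $\epsilon(\mathbf z,t)=-\sigma_t\nabla\log p_t(\mathbf z)$. Let $\sigma_v,\rho>0$ and $\mathbf y\in\mathbb R^n$, and let $f:\mathbb R^m\to\mathbb R^n$ and $\mathcal D:\mathbb R^d\to\mathbb R^m$ be differentiable. Let $k\ge0$ be a bounded $C^1$ kernel whose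 derivative has at most polynomial growth and with $\inf_{\mathbf v}k(\mathbf v,\mathbf v)>0$ (e.g. a Gaussian RBF kernel). Let $\gamma\in\mathbb R$ (in particular any $\gamma\ge 0$). The particles are $(\mathbf x_0^{(l)},\mathbf z_0^{(l)})$, $l=1,\dots,N$. Put $\mathbf z_t^{(l)}=\alpha_t\mathbf z_0^{(l)}+\sigma_t\boldsymbol\epsilon^{(l)}$, where each $\boldsymbol\epsilon^{(l)}$ is standard Gaussian and their joint law is arbitrary (independent noises or one shared noise, for instance). Put $q_t^{(l)}=\mathcal N(\alpha_t\mathbf z_0^{(l)},\sigma_t^2I)$. The coupled variational density seen by particle $i$ is $$Q^{(i)}_t(\mathbf w^{(1)},\dots,\mathbf w^{(N)})=\frac1{Z_t}\,\mathcal R^{(i)}(\mathbf w)\prod_{l=1}^Nq^{(l)}_t(\mathbf w^{(l)}),\qquad \mathcal R^{(i)}(\mathbf w)=\Big(\sum_{j=1}^Nk(\mathbf w^{(i)},\mathbf w^{(j)})\Big)^{-\gamma},$$ with $Z_t$ the normalizing constant at the current particles. For a law $q$ of $\mathbf z_0$ let $q_t$ be the law of $\mathbf z_t$, let $\mathrm{KL}_t(q)=\mathrm{KL}(q_t\|p_t)$,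 and let $\mathrm{SM}(q)=\int_0^T\frac{\beta(t)}2\omega(t)\,\mathbb E_{q_t}\|\nabla\log q_t-\nabla\log p_t\|^2dt$ be the score-matching regularizer of the variational bound $$\mathbb E_q\Big[\tfrac1{2\sigma_v^2}\|\mathbf y-f(\mathbf x_0)\|^2\Big]+\mathbb E_q\Big[\tfrac1{2\rho^2}\|\mathbf x_0-\mathcal D(\mathbf z_0)\|^2\Big]+\mathrm{SM}(q)$$ (up to an entropy term). Put $$\lambda_t=\frac{4T\sigma_v^2\rho^2\alpha_t}{\sigma_t}\,\omega'(t),\qquad \mathbf r^{(i)}_t=\epsilon(\mathbf z_t^{(i)},t)-\boldsymbol\epsilon^{(i)}-\nabla_{\mathbf z_t^{(i)}}\,\gamma\sigma_t\log\sum_{j=1}^Nk(\mathbf z_t^{(i)},\mathbf z_t^{(j)}).$$ **Claim.** All integrals and expectations below converge, and $Q^{(i)}_t$ is a positive probability density for $t\in(0,T]$. 1. For every particle $\zeta\in\mathbb R^d$ (that is, $q=\delta_\zeta$), $\mathrm{KL}_t(\delta_\zeta)<\infty$ for $t\in(0,T]$ and $$\mathrm{SM}(\delta_\zeta)=\int_0^T\omega'(t)\,\mathrm{KL}_t(\delta_\zeta)\,dt-\omega(T)\,\mathrm{KL}_T(\delta_\zeta);$$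 the last term is the one that vanishes when the terminal KL is $0$. Moreover $$\nabla_\zeta\,4\sigma_v^2\rho^2\big[\mathrm{SM}(\delta_\zeta)+\omega(T)\,\mathrm{KL}_T(\delta_\zeta)\big]=\mathbb E_{t\sim\mathcal U[0,T],\,\boldsymbol\epsilon}\big[\lambda_t\big(\epsilon(\alpha_t\zeta+\sigma_t\boldsymbol\epsilon,t)-\boldsymbol\epsilon\big)\big].$$ 2. For each $i$ let $\mathrm{reg}(\mathbf z_0^{(1)},\dots,\mathbf z_0^{(N)})=\int_0^T\omega'(t)\,\mathbb E_{\boldsymbol\epsilon}\big[\log\big(Q_t^{(i)}(\mathbf z_t^{(1)},\dots,\mathbf z_t^{(N)})/\prod_lp_t(\mathbf z_t^{(l)})\big)\big]dt$. Then $$\mathrm{reg}=\sum_l\big[\mathrm{SM}(\delta_{\mathbf z_0^{(l)}})+\omega(T)\,\mathrm{KL}_T(\delta_{\mathbf z_0^{(l)}})\big]+\int_0^T\omega'(t)\,\mathbb E\big[\log(\mathcal R^{(i)}(\mathbf z_t)/Z_t)\big]dt,$$ also when the particles move while $Z_t$ is held fixed. 3. For each $i$ and $t\in(0,T]$, the gradient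 in $\mathbf z_0^{(i)}$ of $\mathbb E_{\boldsymbol\epsilon}[\log(Q_t^{(i)}/\prod_lp_t)(\mathbf z_t)]$, with the density $Q^{(i)}_t$ held fixed and only the samples $\mathbf z_t^{(i)}=\alpha_t\mathbf z^{(i)}_0+\sigma_t\boldsymbol\epsilon^{(i)}$ moving, is $\frac{\alpha_t}{\sigma_t}\mathbb E[\mathbf r_t^{(i)}]$. The integral of these gradients against $4\sigma_v^2\rho^2\,\omega'(t)\,dt$ over $[0,T]$ is $$G^{(i)}=\mathbb E_{t\sim\mathcal U[0,T],\,\boldsymbol\epsilon}\big[\lambda_t\,\mathbf r^{(i)}_t\big],$$ and $G^{(i)}$ is also the gradient in $\mathbf z_0^{(i)}$ of $4\sigma_v^2\rho^2\,\mathrm{reg}$ when the means of the marginals $q_t^{(l)}$ move with the particles and only $Z_t$ is held fixed. 4. Replace $q$ in the first two terms of the bound by the empirical measure of the $N$ particles and $\mathrm{SM}$ by $\mathrm{reg}$ ($Z_t$ held fixed). The gradient of $4\sigma_v^2\rho^2$ times this objective with respect to $\mathbf u^{(i)}=[\mathbf x_0^{(i)},\mathbf z_0^{(i)}]$, i.e.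 the update direction of particle $i$, is $$\frac1N\nabla_{\mathbf u^{(i)}}\Big[2\rho^2\|\mathbf y-f(\mathbf x_0^{(i)})\|^2+2\sigma_v^2\|\mathbf x_0^{(i)}-\mathcal D(\mathbf z_0^{(i)})\|^2\Big]+\big[\,0,\;G^{(i)}\,\big],\qquad i=1,\dots,N.$$ -/

import Mathlib

open MeasureTheory ProbabilityTheory

namespace RSD

noncomputable section

/-- `EuclideanSpace ℝ (Fin n)`, the space of vectors with the Euclidean norm. -/
abbrev Vec (n : ℕ) : Type := EuclideanSpace ℝ (Fin n)

/-! ### Variance-preserving forward diffusion -/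

/-- Signal level `α_t = exp (-(1/2) ∫_0^t β)` of `dz = -(1/2) β z dt + √β dW`. -/
def alpha (β : ℝ → ℝ) (t : ℝ) : ℝ := Real.exp (-(1 / 2) * ∫ s in (0 : ℝ)..t, β s)

/-- Noise level: `σ_t² = 1 - α_t²`. -/
def sigma (β : ℝ → ℝ) (t : ℝ) : ℝ := Real.sqrt (1 - alpha β t ^ 2)

/-- Density at `z` of the transition kernel `q(z_t | z_0) = N(α_t z_0, σ_t² I)`. -/
def transitionDensity {d : ℕ} (β : ℝ → ℝ) (t : ℝ) (z₀ z : Vec d) : ℝ :=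
  (2 * Real.pi * sigma β t ^ 2) ^ (-(d : ℝ) / 2) *
    Real.exp (-‖z - alpha β t • z₀‖ ^ 2 / (2 * sigma β t ^ 2))

/-- Law of `z_t = α_t z_0 + σ_t ε` with `z_0 ∼ μ` and an independent `ε ∼ N(0, I)`. -/
def forwardLaw {d : ℕ} (β : ℝ → ℝ) (t : ℝ) (μ : Measure (Vec d)) : Measure (Vec d) :=
  (μ.prod (stdGaussian (Vec d))).map fun p => alpha β t • p.1 + sigma β t • p.2

/-- Density of `z_t` for `z_0 ∼ μ`. -/
def forwardDensity {d : ℕ} (β : ℝ → ℝ) (t : ℝ) (μ : Measure (Vec d)) (z : Vec d) : ℝ :=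
  ∫ z₀, transitionDensity β t z₀ z ∂μ

/-- Score `∇_z log` of the density of `z_t`, for `z_0 ∼ μ`. -/
def score {d : ℕ} (β : ℝ → ℝ) (t : ℝ) (μ : Measure (Vec d)) (z : Vec d) : Vec d :=
  gradient (fun w => Real.log (forwardDensity β t μ w)) z

/-- `KL(q(z_t) ‖ p(z_t))` for `z_0 ∼ μ` under `q` and `z_0 ∼ p₀` under `p`, as a real number. -/
def klAt {d : ℕ} (β : ℝ → ℝ) (p₀ μ : Measure (Vec d)) (t : ℝ) : ℝ :=
  (InformationTheory.klDiv (forwardLaw β t μ) (forwardLaw β t p₀)).toReal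

/-- `E_{q(z_t)} ‖∇ log q(z_t) - ∇ log p(z_t)‖²`. -/
def fisherAt {d : ℕ} (β : ℝ → ℝ) (p₀ μ : Measure (Vec d)) (t : ℝ) : ℝ :=
  ∫ z, ‖score β t μ z - score β t p₀ z‖ ^ 2 ∂(forwardLaw β t μ)

/-- The weighted score-matching regularizer
`∫_0^T (β(t)/2) ω(t) E_{q(z_t)} ‖∇ log q(z_t) - ∇ log p(z_t)‖² dt`. -/
def scoreMatching {d : ℕ} (β ω : ℝ → ℝ) (T : ℝ) (p₀ μ : Measure (Vec d)) : ℝ :=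
  ∫ t in (0 : ℝ)..T, β t / 2 * ω t * fisherAt β p₀ μ t

/-! ### Interacting particles -/

/-- Particle configuration at time `t`: `z_t^{(l)} = α_t z_0^{(l)} + σ_t ε^{(l)}`. -/
def noisy {d N : ℕ} (β : ℝ → ℝ) (t : ℝ) (z ε : Fin N → Vec d) : Fin N → Vec d :=
  fun l => alpha β t • z l + sigma β t • ε l

/-- `∑_j k(z^{(i)}, z^{(j)})`. -/
def interaction {d N : ℕ} (k : Vec d → Vec d → ℝ) (i : Fin N) (z : Fin N → Vec d) : ℝ :=
  ∑ j, k (z i) (z j)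

/-- Coupling factor acting on particle `i`: the Gibbs weight `exp (-γ log ∑_j k(z^{(i)}, z^{(j)}))`
of its pairwise-kernel potential. -/
def coupling {d N : ℕ} (k : Vec d → Vec d → ℝ) (γ : ℝ) (i : Fin N) (z : Fin N → Vec d) : ℝ :=
  interaction k i z ^ (-γ)

/-- Coupling factor times the product of the per-particle marginals `N(α_t z_0^{(l)}, σ_t² I)`. -/
def repulsiveUnnormalized {d N : ℕ} (β : ℝ → ℝ) (k : Vec d → Vec d → ℝ) (γ : ℝ) (i : Fin N)
    (z₀ : Fin N → Vec d) (t : ℝ) (z : Fin N → Vec d) : ℝ :=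
  coupling k γ i z * ∏ l, transitionDensity β t (z₀ l) (z l)

/-- The normalizing constant `Z` of the coupled variational density at time `t`. -/
def normalizer {d N : ℕ} (β : ℝ → ℝ) (k : Vec d → Vec d → ℝ) (γ : ℝ) (i : Fin N)
    (z₀ : Fin N → Vec d) (t : ℝ) : ℝ :=
  ∫ w, repulsiveUnnormalized β k γ i z₀ t w

/-- The coupled variational density at time `t`, as seen by particle `i`:
`Z⁻¹ R(w^{(1)}, …, w^{(N)}) ∏_l q_t(w^{(l)})`, where the marginals are those of the particles `z₀`
and `Z` is the normalizing constant at the configuration `zc`. It is the probability density of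
the ensemble `z₀` when `zc = z₀`; the two arguments are separate so that `Z` can be kept constant
when `z₀` varies. -/
def repulsiveDensity {d N : ℕ} (β : ℝ → ℝ) (k : Vec d → Vec d → ℝ) (γ : ℝ) (i : Fin N)
    (zc z₀ : Fin N → Vec d) (t : ℝ) (w : Fin N → Vec d) : ℝ :=
  (normalizer β k γ i zc t)⁻¹ * repulsiveUnnormalized β k γ i z₀ t w

/-- `log (Q_t(z_t^{(1)}, …, z_t^{(N)}) / ∏_l p_t(z_t^{(l)}))` at noised particles. -/
def logRatio {d N : ℕ} (β : ℝ → ℝ) (p₀ : Measure (Vec d)) (Q : (Fin N → Vec d) → ℝ)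
    (t : ℝ) (z ε : Fin N → Vec d) : ℝ :=
  Real.log (Q (noisy β t z ε) / ∏ l, forwardDensity β t p₀ (noisy β t z ε l))

/-- The particle regularizer `∫_0^T ω'(t) E_ε [log (Q_t(z_t) / ∏_l p_t(z_t^{(l)}))] dt` with
`z_t = α_t z + σ_t ε`, as a function of the particles `z`. Here `Q z t` is the variational density
at time `t` that belongs to the particles `z`, and `π` is the joint law of the noises. -/
def reg {d N : ℕ} (β ω : ℝ → ℝ) (T : ℝ) (p₀ : Measure (Vec d)) (π : Measure (Fin N → Vec d))
    (Q : (Fin N → Vec d) → ℝ → (Fin N → Vec d) → ℝ) (z : Fin N → Vec d) : ℝ :=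
  ∫ t in (0 : ℝ)..T, deriv ω t * ∫ ε, logRatio β p₀ (Q z t) t z ε ∂π

/-- `λ_t = (4 T σ_v² ρ² α_t / σ_t) ω'(t)`. -/
def lam (β ω : ℝ → ℝ) (T σv ρ t : ℝ) : ℝ :=
  4 * T * σv ^ 2 * ρ ^ 2 * alpha β t / sigma β t * deriv ω t

/-- The uniform law on `[0, T]`. -/
def uniformTime (T : ℝ) : Measure ℝ := ProbabilityTheory.cond volume (Set.Icc 0 T)

/-- Repulsion force `∇_{z^{(i)}} (γ σ_t log ∑_j k(z^{(i)}, z^{(j)}))`, where `z^{(i)}` also varies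
in the summand `j = i`. -/
def repulsion {d N : ℕ} (β : ℝ → ℝ) (k : Vec d → Vec d → ℝ) (γ t : ℝ) (i : Fin N)
    (z : Fin N → Vec d) : Vec d :=
  gradient (fun ζ => γ * sigma β t * Real.log (interaction k i (Function.update z i ζ))) (z i)

/-- `ε(z_t^{(i)}, t) - ε^{(i)} - ∇_{z_t^{(i)}} γ σ_t log ∑_j k(z_t^{(i)}, z_t^{(j)})`. -/
def residual {d N : ℕ} (β : ℝ → ℝ) (k : Vec d → Vec d → ℝ) (γ : ℝ) (eps : Vec d → ℝ → Vec d)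
    (i : Fin N) (z : Fin N → Vec d) (t : ℝ) (ε : Fin N → Vec d) : Vec d :=
  eps (noisy β t z ε i) t - ε i - repulsion β k γ t i (noisy β t z ε)

/-- The regularizer part of the update of particle `i`: the expectation of `λ_t • residual` for
`t` uniform on `[0, T]` and, independently, noises `ε ∼ π`. -/
def regUpdate {d N : ℕ} (β ω : ℝ → ℝ) (T σv ρ : ℝ) (π : Measure (Fin N → Vec d))
    (k : Vec d → Vec d → ℝ) (γ : ℝ) (eps : Vec d → ℝ → Vec d) (i : Fin N)
    (z : Fin N → Vec d) : Vec d :=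
  ∫ p : ℝ × (Fin N → Vec d), lam β ω T σv ρ p.1 • residual β k γ eps i z p.1 p.2
    ∂((uniformTime T).prod π)

/-! ### The variational objective of the ensemble -/

/-- Empirical measure of the particles `(x_0^{(l)}, z_0^{(l)})`. -/
def ensemble {m d N : ℕ} (x : Fin N → Vec m) (z : Fin N → Vec d) : Measure (Vec m × Vec d) :=
  (N : ENNReal)⁻¹ • ∑ l, Measure.dirac (x l, z l)

/-- Measurement matching and decoder discrepancy terms
`E_q [‖y - f(x_0)‖² / (2 σ_v²)] + E_q [‖x_0 - D(z_0)‖² / (2 ρ²)]`. -/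
def misfit {m n d : ℕ} (σv ρ : ℝ) (y : Vec n) (f : Vec m → Vec n) (D : Vec d → Vec m)
    (q : Measure (Vec m × Vec d)) : ℝ :=
  (∫ u, 1 / (2 * σv ^ 2) * ‖y - f u.1‖ ^ 2 ∂q) + ∫ u, 1 / (2 * ρ ^ 2) * ‖u.1 - D u.2‖ ^ 2 ∂q

/-- The variational objective of the ensemble (misfit terms plus regularizer), for
a family `Q z t` of variational densities. -/
def objective {m n d N : ℕ} (β ω : ℝ → ℝ) (T σv ρ : ℝ) (y : Vec n) (f : Vec m → Vec n)
    (D : Vec d → Vec m) (p₀ : Measure (Vec d)) (π : Measure (Fin N → Vec d))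
    (Q : (Fin N → Vec d) → ℝ → (Fin N → Vec d) → ℝ) (x : Fin N → Vec m) (z : Fin N → Vec d) : ℝ :=
  misfit σv ρ y f D (ensemble x z) + reg β ω T p₀ π Q z

end

end RSD

namespace RSD
noncomputable section

/-! Everything about one diffused particle is reduced to a single function of two variables. Write κ
= α_t/σ_t, let ν be the prior recentred at the particle ζ, and put W(κ,x) = ∫ exp(-‖κv - x‖²/2)
dν(v) (`evidence`). At the sample z = α_t ζ + σ_t e the Gaussian constants of q_t and p_t cancel, so
log(q_t/p_t) = -‖e‖²/2 - log W(κ,e) and KL_t = -d/2 - E log W(κ_t,e). The expectation is over a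
fixed Gaussian e, and time enters only through κ. By Tweedie's formula g = ∇ₓ log W is the posterior
mean of κv - x. The prior score at z is g/σ_t and the particle's own score is -e/σ_t, so the Fisher
divergence is σ_t⁻² E‖e + g‖².

Dissipation of KL: with S the posterior mean of ‖κv - x‖², one has ∂_κ log W = -(S + ⟨x,g⟩)/κ and
div g = S - d - ‖g‖². Stein's lemma turns the second identity into E⟨x,g⟩ = E[S - d - ‖g‖²], and
completing the square gives E[S + ⟨x,g⟩] = E‖x + g‖² (`hasDerivAt_integral_log_evidence`). Since κ'
= -βκ/(2σ²), the time derivative of KL_t is -(β/2) times the Fisher divergence (`hasDerivAt_klAt`).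

The formula for SM is then integration by parts of ω·KL on (0,T]. Near zero, σ_t² ≥ ct and the
growth of the score bound the Fisher divergence by M/t, hence KL_t by A - M log t. As ω = O(t), the
boundary term vanishes and both integrals converge (`ScoreGrowth.scoreMatching_eq`).

Gradients are taken with the noise fixed. If the Gaussian q_t moves with its particle, its value at
its own sample is constant, and only -log p_t contributes, giving -α_t E[score]. If q_t is frozen
there is an extra term -(α_t/σ_t)ε, which has mean zero. This is why the frozen and the moving
marginals lead to the same G. The coupling has log R = -γ log ∑k, which is bounded since c ≤ ∑k ≤
NK, and its gradient grows polynomially; with Z_t held constant it adds only the repulsion term.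
Logarithms split the product over particles, so the joint law of the noises matters only in the
coupling term, and the other particles contribute constants to the gradient. The weight λ_t is of
order t^(-1/2) at zero, which is integrable. -/

/-! ### Gaussian densities and Stein's lemma -/

/-- Density of the isotropic Gaussian `N(m, s² I)`. -/
def gaussianDensity {d : ℕ} (m : Vec d) (s : ℝ) (x : Vec d) : ℝ :=
  (2 * Real.pi * s ^ 2) ^ (-(d : ℝ) / 2) * Real.exp (-‖x - m‖ ^ 2 / (2 * s ^ 2))

theorem gaussianDensity_pos {d : ℕ} (m : Vec d) {s : ℝ} (hs : 0 < s) (x : Vec d) :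
    0 < gaussianDensity m s x := by
  unfold gaussianDensity; positivity

theorem measurable_gaussianDensity (d : ℕ) :
    Measurable fun p : Vec d × ℝ × Vec d => gaussianDensity p.1 p.2.1 p.2.2 := by
  unfold gaussianDensity
  apply Measurable.mul
  · exact Measurable.pow_const (by fun_prop) _
  · fun_prop

theorem continuous_gaussianDensity {d : ℕ} (m : Vec d) (s : ℝ) :
    Continuous (gaussianDensity m s) := by
  unfold gaussianDensity; fun_prop

theorem gaussianDensity_sub {d : ℕ} (m : Vec d) (s : ℝ) (x : Vec d) :
    gaussianDensity m s x = gaussianDensity 0 s (x - m) := by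
  simp [gaussianDensity]

theorem integrable_gaussianDensity {d : ℕ} (m : Vec d) {s : ℝ} (hs : 0 < s) :
    Integrable (gaussianDensity m s) := by
  have h : Integrable (gaussianDensity (0 : Vec d) s) := by
    unfold gaussianDensity
    apply Integrable.const_mul
    have := (GaussianFourier.integrable_cexp_neg_mul_sq_norm_add (V := Vec d)
      (b := ((1 / (2 * s ^ 2) : ℝ) : ℂ)) (by rw [Complex.ofReal_re]; positivity) 0 0).norm
    refine this.congr (Filter.Eventually.of_forall fun x => ?_)
    simp only [Complex.norm_exp]
    congr 1
    simp [← Complex.ofReal_pow, ← Complex.ofReal_neg, ← Complex.ofReal_mul]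
    ring
  have h2 := h.comp_sub_right m
  exact h2.congr (Filter.Eventually.of_forall fun x => (gaussianDensity_sub m s x).symm)

/-- Translating by the mean leaves the Fourier integral of a centred Gaussian. The prefactor cancels
the factor (2πs²)^(d/2) produced by that integral, so the normalization of the density is not an
input here. -/
theorem charFun_gaussianDensity {d : ℕ} (m : Vec d) {s : ℝ} (hs : 0 < s) (t : Vec d) :
    charFun (volume.withDensity fun x => ENNReal.ofReal (gaussianDensity m s x)) t
      = Complex.exp (inner ℝ m t * Complex.I - s ^ 2 * ‖t‖ ^ 2 / 2) := by
  rw [charFun_apply, integral_withDensity_eq_integral_toReal_smul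
    (continuous_gaussianDensity m s).measurable.ennreal_ofReal (by simp)]
  simp_rw [ENNReal.toReal_ofReal (gaussianDensity_pos m hs _).le]
  rw [← integral_add_right_eq_self _ m]
  have hb : 0 < ((1 / (2 * s ^ 2) : ℝ) : ℂ).re := by rw [Complex.ofReal_re]; positivity
  have key := GaussianFourier.integral_cexp_neg_mul_sq_norm_add hb Complex.I t
  have : ∀ x : Vec d, gaussianDensity m s (x + m) • Complex.exp (inner ℝ (x + m) t * Complex.I)
      = (((2 * Real.pi * s ^ 2) ^ (-(d : ℝ) / 2) : ℝ) * Complex.exp (inner ℝ m t * Complex.I)) *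
        Complex.exp (-((1 / (2 * s ^ 2) : ℝ) : ℂ) * (‖x‖ : ℂ) ^ 2
          + Complex.I * (inner ℝ t x : ℝ)) := by
    intro x
    rw [gaussianDensity, add_sub_cancel_right, Complex.real_smul, Complex.ofReal_mul,
      Complex.ofReal_exp, mul_assoc (Complex.ofReal _), mul_assoc (Complex.ofReal _),
      ← Complex.exp_add, ← Complex.exp_add, inner_add_left, real_inner_comm t x]
    congr 2
    push_cast
    ring
  simp_rw [this]
  rw [integral_const_mul, key]
  have e1 : ((Real.pi : ℂ) / ((1 / (2 * s ^ 2) : ℝ) : ℂ)) ^ ((Module.finrank ℝ (Vec d) : ℂ) / 2)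
      = (((2 * Real.pi * s ^ 2) ^ ((d : ℝ) / 2) : ℝ) : ℂ) := by
    rw [Complex.ofReal_cpow (by positivity)]
    congr 1
    · push_cast; field_simp
    · simp
  rw [e1, mul_mul_mul_comm, ← Complex.ofReal_mul, ← Real.rpow_add (by positivity), ← Complex.exp_add]
  have : -(d : ℝ) / 2 + d / 2 = 0 := by ring
  rw [this, Real.rpow_zero, Complex.ofReal_one, one_mul]
  congr 1
  have : (s : ℂ) ≠ 0 := by exact_mod_cast hs.ne'
  rw [Complex.I_sq]
  push_cast
  field_simp
  ring

/-- Finite measures with equal characteristic functions coincide. That the density has integral one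
is deduced from this identity afterwards. -/
theorem stdGaussian_map_affine {d : ℕ} (m : Vec d) {s : ℝ} (hs : 0 < s) :
    (stdGaussian (Vec d)).map (fun e => m + s • e)
      = volume.withDensity fun x => ENNReal.ofReal (gaussianDensity m s x) := by
  have : IsFiniteMeasure (volume.withDensity fun x => ENNReal.ofReal (gaussianDensity m s x)) :=
    isFiniteMeasure_withDensity_ofReal (integrable_gaussianDensity m hs).2
  apply Measure.ext_of_charFun
  funext t
  rw [charFun_gaussianDensity m hs, charFun_apply, integral_map (by fun_prop) (by fun_prop)]
  have h := charFun_stdGaussian (E := Vec d) (s • t)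
  rw [charFun_apply] at h
  have : ∀ e : Vec d, Complex.exp (inner ℝ (m + s • e) t * Complex.I)
      = Complex.exp (inner ℝ m t * Complex.I) * Complex.exp (inner ℝ e (s • t) * Complex.I) := by
    intro e
    rw [← Complex.exp_add, inner_add_left, inner_smul_left, inner_smul_right]
    congr 1
    simp
    ring
  simp_rw [this]
  rw [integral_const_mul, h, ← Complex.exp_add, norm_smul, Real.norm_of_nonneg hs.le]
  congr 1
  push_cast
  ring

theorem stdGaussian_eq_withDensity (d : ℕ) :
    stdGaussian (Vec d)
      = volume.withDensity fun x => ENNReal.ofReal (gaussianDensity 0 1 x) := by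
  simpa using stdGaussian_map_affine (0 : Vec d) one_pos

theorem integral_gaussianDensity {d : ℕ} (m : Vec d) {s : ℝ} (hs : 0 < s) :
    ∫ x, gaussianDensity m s x = 1 := by
  have h1 : (volume.withDensity fun x => ENNReal.ofReal (gaussianDensity m s x)) Set.univ = 1 := by
    rw [← stdGaussian_map_affine m hs, Measure.map_apply (by fun_prop) MeasurableSet.univ]
    simp
  rw [withDensity_apply _ MeasurableSet.univ, Measure.restrict_univ] at h1
  rw [integral_eq_lintegral_of_nonneg_ae
    (Filter.Eventually.of_forall fun x => (gaussianDensity_pos m hs x).le)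
    (continuous_gaussianDensity m s).aestronglyMeasurable, h1]
  rfl

theorem integral_stdGaussian_eq {d : ℕ} {F : Type*} [NormedAddCommGroup F] [NormedSpace ℝ F]
    (g : Vec d → F) :
    ∫ x, g x ∂(stdGaussian (Vec d)) = ∫ x, gaussianDensity 0 1 x • g x := by
  rw [stdGaussian_eq_withDensity, integral_withDensity_eq_integral_toReal_smul
    (continuous_gaussianDensity 0 1).measurable.ennreal_ofReal (by simp)]
  simp_rw [ENNReal.toReal_ofReal (gaussianDensity_pos 0 one_pos _).le]

theorem integrable_stdGaussian_iff {d : ℕ} {F : Type*} [NormedAddCommGroup F] [NormedSpace ℝ F]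
    {g : Vec d → F} :
    Integrable g (stdGaussian (Vec d)) ↔ Integrable fun x => gaussianDensity 0 1 x • g x := by
  rw [stdGaussian_eq_withDensity, integrable_withDensity_iff_integrable_smul'
    (continuous_gaussianDensity 0 1).measurable.ennreal_ofReal (by simp)]
  simp_rw [ENNReal.toReal_ofReal (gaussianDensity_pos 0 one_pos _).le]

theorem integrable_one_add_norm_pow {d : ℕ} (n : ℕ) :
    Integrable (fun x : Vec d => (1 + ‖x‖) ^ n) (stdGaussian (Vec d)) := by
  rcases Nat.eq_zero_or_pos n with rfl | hn
  · simp
  have h1 : MemLp (fun x : Vec d => ‖x‖) n (stdGaussian (Vec d)) :=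
    (IsGaussian.memLp_id (stdGaussian (Vec d)) n (by simp)).norm
  have h0 : MemLp (fun _ : Vec d => (1 : ℝ)) n (stdGaussian (Vec d)) := memLp_const 1
  have h : MemLp (fun x : Vec d => 1 + ‖x‖) n (stdGaussian (Vec d)) := h0.add h1
  refine (h.integrable_norm_pow hn.ne').congr (Filter.Eventually.of_forall fun x => ?_)
  dsimp only
  rw [Real.norm_of_nonneg (by positivity)]

/-- Functions of polynomial growth are integrable for the standard Gaussian. -/
theorem integrable_stdGaussian_of_norm_le {d : ℕ} {F : Type*} [NormedAddCommGroup F]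
    {g : Vec d → F} (hg : AEStronglyMeasurable g (stdGaussian (Vec d))) {C : ℝ} {n : ℕ}
    (h : ∀ x, ‖g x‖ ≤ C * (1 + ‖x‖) ^ n) : Integrable g (stdGaussian (Vec d)) :=
  ((integrable_one_add_norm_pow n).const_mul C).mono' hg (Filter.Eventually.of_forall h)

theorem integral_gaussianDensity_pi {d N : ℕ} (m : Fin N → Vec d) {s : ℝ} (hs : 0 < s) :
    ∫ w : Fin N → Vec d, ∏ l, gaussianDensity (m l) s (w l) = 1 := by
  rw [integral_fintype_prod_volume_eq_prod (fun l => gaussianDensity (m l) s)]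
  simp [integral_gaussianDensity _ hs]

theorem hasFDerivAt_gaussianDensity {d : ℕ} (x : Vec d) :
    HasFDerivAt (gaussianDensity (0 : Vec d) 1)
      (-(gaussianDensity 0 1 x) • innerSL ℝ x) x := by
  have h1 : HasFDerivAt (fun y : Vec d => -‖y‖ ^ 2 / 2) (-(innerSL ℝ x)) x := by
    have h := ((hasStrictFDerivAt_norm_sq x).hasFDerivAt.neg).mul_const (2 : ℝ)⁻¹
    refine (h.congr_fderiv ?_).congr_of_eventuallyEq (Filter.Eventually.of_forall fun y => ?_)
    · ext y; simp
    · simp [div_eq_mul_inv]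
  have h2 := (h1.exp).const_mul ((2 * Real.pi * (1 : ℝ) ^ 2) ^ (-(d : ℝ) / 2))
  refine (h2.congr_fderiv ?_).congr_of_eventuallyEq (Filter.Eventually.of_forall fun y => ?_)
  · ext y; simp [gaussianDensity]; ring
  · simp [gaussianDensity]

/-- **Stein's lemma**: Gaussian integration by parts in the direction `v`. -/
theorem integral_inner_mul_stdGaussian {d : ℕ} (v : Vec d) {f f' : Vec d → ℝ}
    (hf : ∀ x, HasLineDerivAt ℝ f (f' x) x v)
    (hfi : Integrable f (stdGaussian (Vec d)))
    (hxf : Integrable (fun x => inner ℝ x v * f x) (stdGaussian (Vec d)))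
    (hf' : Integrable f' (stdGaussian (Vec d))) :
    ∫ x, inner ℝ x v * f x ∂(stdGaussian (Vec d)) = ∫ x, f' x ∂(stdGaussian (Vec d)) := by
  rw [integrable_stdGaussian_iff] at hfi hxf hf'
  rw [integral_stdGaussian_eq, integral_stdGaussian_eq]
  -- Integration by parts against the Gaussian density, whose derivative in the direction v is
  -- -⟨x,v⟩ times itself.
  have := integral_bilinear_hasLineDerivAt_right_eq_neg_left_of_integrable (μ := volume)
    (f := f) (f' := f') (g := gaussianDensity 0 1)
    (g' := fun x => (-(gaussianDensity 0 1 x) • innerSL ℝ x) v) (v := v)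
    (B := ContinuousLinearMap.mul ℝ ℝ)
    (by simpa [mul_comm] using hf')
    (by
      refine hxf.neg.congr (Filter.Eventually.of_forall fun x => ?_)
      simp; ring)
    (by simpa [mul_comm] using hfi)
    (fun x _ => hf x) (fun x _ => (hasFDerivAt_gaussianDensity x).hasLineDerivAt v)
  simp only [ContinuousLinearMap.mul_apply', FunLike.coe_smul, Pi.smul_apply, innerSL_apply_apply,
    smul_eq_mul] at this ⊢
  rw [← neg_inj, ← integral_neg]
  refine Eq.trans (integral_congr_ae (Filter.Eventually.of_forall fun x => ?_)) (this.trans ?_)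
  · dsimp only; ring
  · simp_rw [mul_comm]

/-! ### Gaussian evidence and posterior moments -/

/-- Unnormalized standard Gaussian weight. -/
def gaussWeight {d : ℕ} (u : Vec d) : ℝ := Real.exp (-(‖u‖ ^ 2 / 2))

/-- Evidence of the observation `x` of `κ v` in standard Gaussian noise, up to a constant. -/
def evidence {d : ℕ} (ν : Measure (Vec d)) (κ : ℝ) (x : Vec d) : ℝ :=
  ∫ v, gaussWeight (κ • v - x) ∂ν

/-- Posterior mean of the deviation `κ v - x`. -/
def postMean {d : ℕ} (ν : Measure (Vec d)) (κ : ℝ) (x : Vec d) : Vec d :=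
  (evidence ν κ x)⁻¹ • ∫ v, gaussWeight (κ • v - x) • (κ • v - x) ∂ν

/-- Posterior second moment of the deviation `κ v - x`. -/
def postSq {d : ℕ} (ν : Measure (Vec d)) (κ : ℝ) (x : Vec d) : ℝ :=
  (evidence ν κ x)⁻¹ * ∫ v, gaussWeight (κ • v - x) * ‖κ • v - x‖ ^ 2 ∂ν

section weight
variable {d : ℕ}

theorem gaussWeight_pos (u : Vec d) : 0 < gaussWeight u := Real.exp_pos _

theorem gaussWeight_le_one (u : Vec d) : gaussWeight u ≤ 1 := by
  rw [gaussWeight, Real.exp_le_one_iff, Left.neg_nonpos_iff]; positivity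

theorem contDiff_gaussWeight {n : WithTop ℕ∞} : ContDiff ℝ n (gaussWeight (d := d)) := by
  unfold gaussWeight
  exact (((contDiff_norm_sq ℝ).div_const 2).neg).exp

theorem continuous_gaussWeight : Continuous (gaussWeight (d := d)) :=
  (contDiff_gaussWeight (n := 0)).continuous

theorem hasFDerivAt_gaussWeight (u : Vec d) :
    HasFDerivAt gaussWeight (-(gaussWeight u) • innerSL ℝ u) u := by
  have h1 : HasFDerivAt (fun y : Vec d => -(‖y‖ ^ 2 / 2)) (-(innerSL ℝ u)) u := by
    have h := ((hasStrictFDerivAt_norm_sq u).hasFDerivAt.mul_const (2 : ℝ)⁻¹).neg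
    refine (h.congr_fderiv ?_).congr_of_eventuallyEq (Filter.Eventually.of_forall fun y => ?_)
    · ext y; simp
    · simp [div_eq_mul_inv]
  refine h1.exp.congr_fderiv ?_
  ext y; simp [gaussWeight]

/-- The maximum of y·exp(-y) is exp(-1) < 1/2, taken with y = ‖u‖²/2. Bounds of this kind make every
integral over the prior converge although the prior may have no moments. -/
theorem gaussWeight_mul_sq_le (u : Vec d) : gaussWeight u * ‖u‖ ^ 2 ≤ 1 := by
  have h := Real.mul_exp_neg_le_exp_neg_one (‖u‖ ^ 2 / 2)
  have h1 : Real.exp (-1) < 1 / 2 := by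
    have := Real.exp_neg_one_lt_d9; linarith
  unfold gaussWeight
  nlinarith

theorem gaussWeight_mul_norm_le (u : Vec d) : gaussWeight u * ‖u‖ ≤ 1 := by
  have h := gaussWeight_mul_sq_le u
  have h1 := gaussWeight_le_one u
  have h2 := (gaussWeight_pos u).le
  nlinarith [sq_nonneg (‖u‖ - 1), mul_nonneg h2 (sq_nonneg (‖u‖ - 1))]

variable (ν : Measure (Vec d)) [IsProbabilityMeasure ν]

theorem integrable_of_continuous_bounded {F : Type*} [NormedAddCommGroup F]
    {ψ : Vec d → F} (hψ : Continuous ψ) {C : ℝ} (hC : ∀ u, ‖ψ u‖ ≤ C) (κ : ℝ) (x : Vec d) :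
    Integrable (fun v => ψ (κ • v - x)) ν := by
  have h : Continuous fun v : Vec d => ψ (κ • v - x) := by fun_prop
  refine Integrable.of_bound ?_ C (Filter.Eventually.of_forall fun v => hC _)
  exact h.aestronglyMeasurable

/-- Bounded derivatives are dominated by a constant, which is integrable because ν is a probability
measure. It serves both the evidence and the numerator of the posterior mean. -/
theorem hasFDerivAt_integral_comp_sub {ψ : Vec d → ℝ} (hψ : ContDiff ℝ 1 ψ) {C C' : ℝ}
    (hC : ∀ u, ‖ψ u‖ ≤ C) (hC' : ∀ u, ‖fderiv ℝ ψ u‖ ≤ C') (κ : ℝ) (x : Vec d) :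
    HasFDerivAt (fun x => ∫ v, ψ (κ • v - x) ∂ν) (∫ v, -fderiv ℝ ψ (κ • v - x) ∂ν) x := by
  refine hasFDerivAt_integral_of_dominated_of_fderiv_le (F' := fun x v => -fderiv ℝ ψ (κ • v - x))
    (s := Set.univ) (bound := fun _ => C') Filter.univ_mem
    (Filter.Eventually.of_forall fun y =>
      (integrable_of_continuous_bounded ν hψ.continuous hC κ y).aestronglyMeasurable)
    (integrable_of_continuous_bounded ν hψ.continuous hC κ x)
    (integrable_of_continuous_bounded ν (hψ.continuous_fderiv one_ne_zero)
      hC' κ x).neg.aestronglyMeasurable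
    (Filter.Eventually.of_forall fun v y _ => by rw [norm_neg]; exact hC' _)
    (integrable_const _) (Filter.Eventually.of_forall fun v y _ => ?_)
  have h1 : HasFDerivAt (fun y => κ • v - y) (-ContinuousLinearMap.id ℝ (Vec d)) y :=
    (hasFDerivAt_id y).const_sub (κ • v)
  have h2 := ((hψ.differentiable one_ne_zero).differentiableAt (x := κ • v - y)).hasFDerivAt
  refine (h2.comp y h1).congr_fderiv ?_
  ext w; simp

theorem integrable_gaussWeight (κ : ℝ) (x : Vec d) :
    Integrable (fun v => gaussWeight (κ • v - x)) ν :=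
  integrable_of_continuous_bounded ν continuous_gaussWeight (C := 1)
    (fun u => by rw [Real.norm_of_nonneg (gaussWeight_pos u).le]; exact gaussWeight_le_one u) κ x

theorem integrable_gaussWeight_smul (κ : ℝ) (x : Vec d) :
    Integrable (fun v => gaussWeight (κ • v - x) • (κ • v - x)) ν :=
  integrable_of_continuous_bounded ν (ψ := fun u => gaussWeight u • u)
    (continuous_gaussWeight.smul continuous_id) (C := 1)
    (fun u => by
      rw [norm_smul, Real.norm_of_nonneg (gaussWeight_pos u).le]
      exact gaussWeight_mul_norm_le u) κ x

theorem integrable_gaussWeight_mul_sq (κ : ℝ) (x : Vec d) :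
    Integrable (fun v => gaussWeight (κ • v - x) * ‖κ • v - x‖ ^ 2) ν :=
  integrable_of_continuous_bounded ν (ψ := fun u => gaussWeight u * ‖u‖ ^ 2)
    (continuous_gaussWeight.mul (continuous_norm.pow 2)) (C := 1)
    (fun u => by
      rw [Real.norm_of_nonneg (mul_nonneg (gaussWeight_pos u).le (by positivity))]
      exact gaussWeight_mul_sq_le u) κ x

theorem evidence_pos (κ : ℝ) (x : Vec d) : 0 < evidence ν κ x := by
  unfold evidence
  rw [integral_pos_iff_support_of_nonneg (fun v => (gaussWeight_pos _).le)
    (integrable_gaussWeight ν κ x)]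
  have : Function.support (fun v : Vec d => gaussWeight (κ • v - x)) = Set.univ := by
    ext v; simp [(gaussWeight_pos _).ne']
  simp [this]

theorem evidence_le_one (κ : ℝ) (x : Vec d) : evidence ν κ x ≤ 1 := by
  have := integral_mono (integrable_gaussWeight ν κ x) (integrable_const 1)
    (fun v => gaussWeight_le_one (κ • v - x))
  simpa [evidence] using this

theorem measurable_evidence : Measurable fun p : ℝ × Vec d => evidence ν p.1 p.2 := by
  have : Continuous fun q : (ℝ × Vec d) × Vec d => gaussWeight (q.1.1 • q.2 - q.1.2) :=
    continuous_gaussWeight.comp (by fun_prop)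
  exact (this.stronglyMeasurable.integral_prod_right').measurable

theorem measurable_postMean : Measurable fun p : ℝ × Vec d => postMean ν p.1 p.2 := by
  have : Continuous fun q : (ℝ × Vec d) × Vec d =>
      gaussWeight (q.1.1 • q.2 - q.1.2) • (q.1.1 • q.2 - q.1.2) :=
    (continuous_gaussWeight.comp (by fun_prop)).smul (by fun_prop)
  exact (measurable_evidence ν).inv.smul
    (this.stronglyMeasurable.integral_prod_right').measurable

theorem measurable_postSq : Measurable fun p : ℝ × Vec d => postSq ν p.1 p.2 := by
  have : Continuous fun q : (ℝ × Vec d) × Vec d =>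
      gaussWeight (q.1.1 • q.2 - q.1.2) * ‖q.1.1 • q.2 - q.1.2‖ ^ 2 :=
    (continuous_gaussWeight.comp (by fun_prop)).mul (by fun_prop)
  exact (measurable_evidence ν).inv.mul
    (this.stronglyMeasurable.integral_prod_right').measurable

theorem hasGradientAt_evidence (κ : ℝ) (x : Vec d) :
    HasGradientAt (evidence ν κ) (evidence ν κ x • postMean ν κ x) x := by
  have hb : ∀ u : Vec d, ‖fderiv ℝ gaussWeight u‖ ≤ 1 := fun u => by
    rw [(hasFDerivAt_gaussWeight u).fderiv, norm_smul, norm_neg,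
      Real.norm_of_nonneg (gaussWeight_pos u).le, innerSL_apply_norm]
    exact gaussWeight_mul_norm_le u
  have h := hasFDerivAt_integral_comp_sub ν contDiff_gaussWeight (C := 1) (fun u => by
    rw [Real.norm_of_nonneg (gaussWeight_pos u).le]; exact gaussWeight_le_one u) hb κ x
  rw [hasGradientAt_iff_hasFDerivAt]
  refine h.congr_fderiv ?_
  have hi : Integrable (fun v => -fderiv ℝ gaussWeight (κ • v - x)) ν :=
    (integrable_of_continuous_bounded ν (contDiff_gaussWeight.continuous_fderiv one_ne_zero)
      hb κ x).neg
  ext w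
  rw [ContinuousLinearMap.integral_apply hi, InnerProductSpace.toDual_apply_apply, postMean,
    smul_inv_smul₀ (evidence_pos ν κ x).ne', real_inner_comm,
    ← integral_inner (integrable_gaussWeight_smul ν κ x)]
  refine integral_congr_ae (Filter.Eventually.of_forall fun v => ?_)
  simp only [(hasFDerivAt_gaussWeight (κ • v - x)).fderiv, FunLike.coe_neg, Pi.neg_apply,
    FunLike.coe_smul, Pi.smul_apply, innerSL_apply_apply, smul_eq_mul, neg_mul, neg_neg,
    inner_smul_right, real_inner_comm w]

/-- Tweedie's formula: differentiating the weight in x multiplies it by κv - x, and the logarithm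
divides by the evidence. -/
theorem hasGradientAt_log_evidence (κ : ℝ) (x : Vec d) :
    HasGradientAt (fun x => Real.log (evidence ν κ x)) (postMean ν κ x) x := by
  have h := (hasGradientAt_evidence ν κ x)
  rw [hasGradientAt_iff_hasFDerivAt] at h ⊢
  refine (h.log (evidence_pos ν κ x).ne').congr_fderiv ?_
  ext w
  simp [inv_mul_cancel_left₀ (evidence_pos ν κ x).ne']

theorem inner_postMean (κ : ℝ) (x w : Vec d) :
    inner ℝ (postMean ν κ x) w
      = (evidence ν κ x)⁻¹ * ∫ v, gaussWeight (κ • v - x) * inner ℝ (κ • v - x) w ∂ν := by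
  rw [postMean, inner_smul_left, real_inner_comm, ← integral_inner
    (integrable_gaussWeight_smul ν κ x)]
  simp [inner_smul_right, real_inner_comm]

theorem norm_fderiv_gaussWeight_inner (u w : Vec d) :
    ‖fderiv ℝ (fun u => gaussWeight u * inner ℝ u w) u‖ ≤ 2 * ‖w‖ ∧
    fderiv ℝ (fun u => gaussWeight u * inner ℝ u w) u w
      = gaussWeight u * ‖w‖ ^ 2 - gaussWeight u * inner ℝ u w ^ 2 := by
  have h2 : HasFDerivAt (fun u : Vec d => inner ℝ u w) (innerSL ℝ w) u := by
    refine ((innerSL ℝ w).hasFDerivAt (x := u)).congr_of_eventuallyEq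
      (Filter.Eventually.of_forall fun y => ?_)
    simp [real_inner_comm]
  have h : HasFDerivAt (fun u => gaussWeight u * inner ℝ u w) _ u :=
    (hasFDerivAt_gaussWeight u).mul h2
  rw [h.fderiv]
  constructor
  · refine (norm_add_le _ _).trans ?_
    rw [norm_smul, norm_smul, norm_smul, norm_neg, Real.norm_of_nonneg (gaussWeight_pos u).le,
      innerSL_apply_norm, innerSL_apply_norm]
    have h3 := gaussWeight_mul_sq_le u
    have h4 : ‖(inner ℝ u w : ℝ)‖ ≤ ‖u‖ * ‖w‖ := norm_inner_le_norm u w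
    have h5 := gaussWeight_le_one u
    have h6 := (gaussWeight_pos u).le
    have : ‖(inner ℝ u w : ℝ)‖ * (gaussWeight u * ‖u‖)
        ≤ (‖u‖ * ‖w‖) * (gaussWeight u * ‖u‖) := by gcongr
    nlinarith [norm_nonneg w]
  · simp
    ring

/-- Quotient rule for the posterior mean: the value is the posterior variance of the deviation along
w, minus one. Summed over an orthonormal basis it is the divergence needed in Stein's lemma. -/
theorem hasLineDerivAt_inner_postMean (κ : ℝ) (x w : Vec d) (hw : ‖w‖ = 1) :
    HasLineDerivAt ℝ (fun x => inner ℝ (postMean ν κ x) w)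
      ((evidence ν κ x)⁻¹ * (∫ v, gaussWeight (κ • v - x) * inner ℝ (κ • v - x) w ^ 2 ∂ν) - 1
        - inner ℝ (postMean ν κ x) w ^ 2) x w := by
  have hsm : ContDiff ℝ 1 fun u : Vec d => gaussWeight u * inner ℝ u w :=
    contDiff_gaussWeight.mul (contDiff_id.inner ℝ contDiff_const)
  have hC : ∀ u : Vec d, ‖gaussWeight u * inner ℝ u w‖ ≤ 1 := fun u => by
    rw [norm_mul, Real.norm_of_nonneg (gaussWeight_pos u).le]
    have h4 : ‖(inner ℝ u w : ℝ)‖ ≤ ‖u‖ * ‖w‖ := norm_inner_le_norm u w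
    rw [hw, mul_one] at h4
    exact (mul_le_mul_of_nonneg_left h4 (gaussWeight_pos u).le).trans (gaussWeight_mul_norm_le u)
  have hb := fun u : Vec d => (norm_fderiv_gaussWeight_inner u w).1
  have hN := hasFDerivAt_integral_comp_sub ν hsm hC hb κ x
  have hi : Integrable (fun v => -fderiv ℝ (fun u => gaussWeight u * inner ℝ u w) (κ • v - x)) ν :=
    (integrable_of_continuous_bounded ν (hsm.continuous_fderiv one_ne_zero) hb κ x).neg
  have hW := (hasGradientAt_evidence ν κ x).hasFDerivAt
  have hW0 := (evidence_pos ν κ x).ne'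
  have hq := ((hasDerivAt_inv hW0).comp_hasFDerivAt x hW).mul hN
  have hq2 : HasFDerivAt (fun x => inner ℝ (postMean ν κ x) w) _ x :=
    hq.congr_of_eventuallyEq (Filter.Eventually.of_forall fun y => inner_postMean ν κ y w)
  refine HasDerivAt.congr_deriv (hq2.hasLineDerivAt w) ?_
  have hsq : Integrable (fun v => gaussWeight (κ • v - x) * inner ℝ (κ • v - x) w ^ 2) ν := by
    refine integrable_of_continuous_bounded ν (ψ := fun u => gaussWeight u * inner ℝ u w ^ 2)
      (continuous_gaussWeight.mul (by fun_prop)) (C := 1) (fun u => ?_) κ x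
    have h4 : |(inner ℝ u w : ℝ)| ≤ ‖u‖ * ‖w‖ := abs_real_inner_le_norm u w
    rw [hw, mul_one] at h4
    rw [Real.norm_of_nonneg (mul_nonneg (gaussWeight_pos u).le (by positivity)), ← sq_abs]
    refine (mul_le_mul_of_nonneg_left ?_ (gaussWeight_pos u).le).trans (gaussWeight_mul_sq_le u)
    gcongr
  have key : (∫ v, -fderiv ℝ (fun u => gaussWeight u * inner ℝ u w) (κ • v - x) ∂ν) w
      = (∫ v, gaussWeight (κ • v - x) * inner ℝ (κ • v - x) w ^ 2 ∂ν) - evidence ν κ x := by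
    rw [ContinuousLinearMap.integral_apply hi, evidence,
      ← integral_sub hsq (integrable_gaussWeight ν κ x)]
    refine integral_congr_ae (Filter.Eventually.of_forall fun v => ?_)
    simp only [FunLike.coe_neg, Pi.neg_apply, (norm_fderiv_gaussWeight_inner (κ • v - x) w).2, hw]
    ring
  simp only [FunLike.coe_add, FunLike.coe_smul, Pi.add_apply, Pi.smul_apply, smul_eq_mul, key]
  have e := inner_postMean ν κ x w
  have e' : ∫ v, gaussWeight (κ • v - x) * inner ℝ (κ • v - x) w ∂ν
      = evidence ν κ x * inner ℝ (postMean ν κ x) w := by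
    rw [e]; field_simp
  rw [e']
  simp
  field_simp
  ring

theorem postSq_nonneg (κ : ℝ) (x : Vec d) : 0 ≤ postSq ν κ x :=
  mul_nonneg (inv_nonneg.2 (evidence_pos ν κ x).le)
    (integral_nonneg fun v => mul_nonneg (gaussWeight_pos _).le (by positivity))

/-- With q = ‖κv - x‖²/2 and A = -log W, the weight divided by W is exp(-(q - A)), so y·exp(-y) ≤ 1
at y = q - A gives q·weight ≤ A·weight + W pointwise. Integration then bounds the second moment by
the log-evidence alone. -/
theorem postSq_le (κ : ℝ) (x : Vec d) : postSq ν κ x ≤ 2 * -Real.log (evidence ν κ x) + 2 := by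
  set A := -Real.log (evidence ν κ x) with hA
  have hW := evidence_pos ν κ x
  have hpt : ∀ v : Vec d, gaussWeight (κ • v - x) * ‖κ • v - x‖ ^ 2
      ≤ 2 * A * gaussWeight (κ • v - x) + 2 * evidence ν κ x := fun v => by
    set q := ‖κ • v - x‖ ^ 2 / 2 with hq
    have h1 := Real.mul_exp_neg_le_exp_neg_one (q - A)
    have h2 : Real.exp (-1) ≤ 1 := Real.exp_le_one_iff.2 (by norm_num)
    have h3 : Real.exp (-(q - A)) = gaussWeight (κ • v - x) * (evidence ν κ x)⁻¹ := by
      rw [neg_sub, sub_eq_neg_add, Real.exp_add, hA, Real.exp_neg (Real.log _), Real.exp_log hW]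
      rfl
    rw [h3] at h1
    have h4 : (q - A) * gaussWeight (κ • v - x) ≤ evidence ν κ x := by
      have := (h1.trans h2)
      rw [← mul_assoc, mul_inv_le_iff₀ hW] at this
      linarith
    have : ‖κ • v - x‖ ^ 2 = 2 * q := by rw [hq]; ring
    rw [this]; linarith
  have := integral_mono (integrable_gaussWeight_mul_sq ν κ x)
    (((integrable_gaussWeight ν κ x).const_mul (2 * A)).add (integrable_const _)) hpt
  simp only [Pi.add_apply] at this
  rw [integral_add ((integrable_gaussWeight ν κ x).const_mul (2 * A)) (integrable_const _),
    integral_const_mul] at this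
  change _ ≤ 2 * A * evidence ν κ x + _ at this
  simp only [integral_const, probReal_univ, one_smul] at this
  rw [postSq, inv_mul_le_iff₀ hW]
  linarith

theorem norm_postMean_le (κ : ℝ) (x : Vec d) : ‖postMean ν κ x‖ ≤ 1 + postSq ν κ x := by
  have hW := evidence_pos ν κ x
  rw [postMean, norm_smul, norm_inv, Real.norm_of_nonneg hW.le, inv_mul_le_iff₀ hW, mul_add,
    postSq, mul_inv_cancel_left₀ hW.ne', mul_one]
  refine (norm_integral_le_integral_norm _).trans ?_
  rw [evidence, ← integral_add (integrable_gaussWeight ν κ x) (integrable_gaussWeight_mul_sq ν κ x)]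
  refine integral_mono (integrable_gaussWeight_smul ν κ x).norm
    ((integrable_gaussWeight ν κ x).add (integrable_gaussWeight_mul_sq ν κ x)) fun v => ?_
  simp only [norm_smul, Real.norm_of_nonneg (gaussWeight_pos _).le]
  have := (gaussWeight_pos (κ • v - x)).le
  nlinarith [mul_nonneg this (sq_nonneg (‖κ • v - x‖ - 1)),
    mul_nonneg this (sq_nonneg (‖κ • v - x‖))]

/-- The log-evidence has at most quadratic growth. -/
theorem neg_log_evidence_le :
    ∃ C, 0 ≤ C ∧ ∀ (κ : ℝ) (x : Vec d),
      -Real.log (evidence ν κ x) ≤ C * (1 + |κ|) ^ 2 * (1 + ‖x‖) ^ 2 := by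
  -- A ball carrying at least half of the prior mass; on it the weight has an explicit lower bound.
  obtain ⟨R, hR0, hR⟩ : ∃ R : ℝ, 0 ≤ R ∧ 1 / 2 ≤ ν.real (Metric.closedBall 0 R) := by
    have h1 : Filter.Tendsto (fun n : ℕ => ν (Metric.closedBall (0 : Vec d) n)) Filter.atTop
        (nhds (ν (⋃ n : ℕ, Metric.closedBall (0 : Vec d) n))) :=
      tendsto_measure_iUnion_atTop fun m n h => Metric.closedBall_subset_closedBall (by simpa)
    rw [Metric.iUnion_closedBall_nat, measure_univ] at h1
    have h2 := h1.eventually_const_le (u := (1 / 2 : ENNReal)) (by simp)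
    obtain ⟨n, hn⟩ := h2.exists
    refine ⟨n, by positivity, ?_⟩
    have := ENNReal.toReal_mono (measure_ne_top _ _) hn
    simpa [Measure.real] using this
  -- The first summand absorbs (R|κ| + ‖x‖)²/2, and the final 1 absorbs log 2 coming from the mass
  -- one half.
  refine ⟨(R + 1) ^ 2 / 2 + 1, by positivity, fun κ x => ?_⟩
  have hlow : 1 / 2 * Real.exp (-((R * |κ| + ‖x‖) ^ 2 / 2)) ≤ evidence ν κ x := by
    have h1 : ∫ v in Metric.closedBall (0 : Vec d) R, gaussWeight (κ • v - x) ∂ν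
        ≤ evidence ν κ x :=
      setIntegral_le_integral (integrable_gaussWeight ν κ x)
        (Filter.Eventually.of_forall fun v => (gaussWeight_pos _).le)
    refine le_trans ?_ h1
    have h2 : ∫ v in Metric.closedBall (0 : Vec d) R,
        Real.exp (-((R * |κ| + ‖x‖) ^ 2 / 2)) ∂ν
        ≤ ∫ v in Metric.closedBall (0 : Vec d) R, gaussWeight (κ • v - x) ∂ν := by
      refine setIntegral_mono_on (integrable_const _).integrableOn
        (integrable_gaussWeight ν κ x).integrableOn Metric.isClosed_closedBall.measurableSet
        fun v hv => ?_
      rw [gaussWeight, Real.exp_le_exp, neg_le_neg_iff]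
      have : ‖κ • v - x‖ ≤ R * |κ| + ‖x‖ := by
        refine (norm_sub_le _ _).trans ?_
        rw [norm_smul, Real.norm_eq_abs, mul_comm]
        have : ‖v‖ ≤ R := by simpa using hv
        gcongr
      gcongr
    refine le_trans ?_ h2
    rw [setIntegral_const, smul_eq_mul]
    gcongr
  have h3 := Real.log_le_log (by positivity) hlow
  rw [Real.log_mul (by norm_num) (Real.exp_pos _).ne', Real.log_exp, one_div, Real.log_inv] at h3
  have h4 : Real.log 2 ≤ 1 := by linarith [Real.log_two_lt_d9]
  have h5 : R * |κ| + ‖x‖ ≤ (R + 1) * (1 + |κ|) * (1 + ‖x‖) := by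
    have := abs_nonneg κ
    have := norm_nonneg x
    have h : 0 ≤ |κ| * ‖x‖ := by positivity
    nlinarith [mul_nonneg hR0 this, mul_nonneg hR0 h, mul_nonneg hR0 (abs_nonneg κ)]
  have h6 : (R * |κ| + ‖x‖) ^ 2 ≤ ((R + 1) * (1 + |κ|) * (1 + ‖x‖)) ^ 2 := by gcongr
  have h7 : 1 ≤ (1 + |κ|) ^ 2 * (1 + ‖x‖) ^ 2 := by
    have e1 : (1 : ℝ) ≤ (1 + |κ|) ^ 2 := one_le_pow₀ (by linarith [abs_nonneg κ])
    have e2 : (1 : ℝ) ≤ (1 + ‖x‖) ^ 2 := one_le_pow₀ (by linarith [norm_nonneg x])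
    nlinarith
  nlinarith

end weight

/-! ### Mean log-evidence as a function of the signal-to-noise amplitude -/

theorem integrable_norm_sq_stdGaussian {d : ℕ} :
    Integrable (fun x : Vec d => ‖x‖ ^ 2) (stdGaussian (Vec d)) := by
  refine integrable_stdGaussian_of_norm_le (by fun_prop) (C := 1) (n := 2) (fun x => ?_)
  rw [norm_pow, norm_norm, one_mul]
  gcongr
  linarith

section core
variable {d : ℕ} (ν : Measure (Vec d)) [IsProbabilityMeasure ν]

/-- Common growth bound for the log-evidence and the posterior moments. -/
theorem posterior_growth :
    ∃ C, 0 ≤ C ∧ ∀ (κ : ℝ) (x : Vec d),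
      |Real.log (evidence ν κ x)| ≤ C * (1 + |κ|) ^ 2 * (1 + ‖x‖) ^ 2 ∧
      postSq ν κ x ≤ C * (1 + |κ|) ^ 2 * (1 + ‖x‖) ^ 2 ∧
      ‖postMean ν κ x‖ ≤ C * (1 + |κ|) ^ 2 * (1 + ‖x‖) ^ 2 := by
  obtain ⟨C, hC0, hC⟩ := neg_log_evidence_le ν
  -- With A = -log W, the posterior second moment is at most 2A + 2 and the norm of the posterior
  -- mean at most 2A + 3; the additive constants are absorbed because the growth factor is at least
  -- one.
  refine ⟨2 * C + 3, by positivity, fun κ x => ?_⟩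
  have h1 := hC κ x
  have h2 := postSq_le ν κ x
  have h3 := norm_postMean_le ν κ x
  have h4 : 1 ≤ (1 + |κ|) ^ 2 * (1 + ‖x‖) ^ 2 := by
    have e1 : (1 : ℝ) ≤ (1 + |κ|) ^ 2 := one_le_pow₀ (by linarith [abs_nonneg κ])
    have e2 : (1 : ℝ) ≤ (1 + ‖x‖) ^ 2 := one_le_pow₀ (by linarith [norm_nonneg x])
    nlinarith
  have h5 : Real.log (evidence ν κ x) ≤ 0 :=
    Real.log_nonpos (evidence_pos ν κ x).le (evidence_le_one ν κ x)
  rw [mul_assoc] at h1 ⊢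
  have h6 : 0 ≤ C * ((1 + |κ|) ^ 2 * (1 + ‖x‖) ^ 2) := by positivity
  refine ⟨?_, ?_, ?_⟩
  · rw [abs_of_nonpos h5]; nlinarith
  · nlinarith
  · nlinarith

theorem integrable_log_evidence (κ : ℝ) :
    Integrable (fun x => Real.log (evidence ν κ x)) (stdGaussian (Vec d)) := by
  obtain ⟨C, -, hC⟩ := posterior_growth ν
  exact integrable_stdGaussian_of_norm_le
    ((measurable_evidence ν).comp measurable_prodMk_left).log.aestronglyMeasurable
    (fun x => (hC κ x).1)

theorem integrable_postSq (κ : ℝ) :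
    Integrable (fun x => postSq ν κ x) (stdGaussian (Vec d)) := by
  obtain ⟨C, -, hC⟩ := posterior_growth ν
  refine integrable_stdGaussian_of_norm_le
    ((measurable_postSq ν).comp measurable_prodMk_left).aestronglyMeasurable
    (C := C * (1 + |κ|) ^ 2) (n := 2) (fun x => ?_)
  rw [Real.norm_of_nonneg (postSq_nonneg ν κ x)]
  exact (hC κ x).2.1

theorem aestronglyMeasurable_postMean (κ : ℝ) (μ : Measure (Vec d)) :
    AEStronglyMeasurable (fun x => postMean ν κ x) μ :=
  ((measurable_postMean ν).comp measurable_prodMk_left).aestronglyMeasurable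

theorem integrable_postMean (κ : ℝ) :
    Integrable (fun x => postMean ν κ x) (stdGaussian (Vec d)) := by
  obtain ⟨C, -, hC⟩ := posterior_growth ν
  exact integrable_stdGaussian_of_norm_le (aestronglyMeasurable_postMean ν κ _)
    (fun x => (hC κ x).2.2)

theorem integrable_norm_postMean_sq (κ : ℝ) :
    Integrable (fun x => ‖postMean ν κ x‖ ^ 2) (stdGaussian (Vec d)) := by
  obtain ⟨C, hC0, hC⟩ := posterior_growth ν
  refine integrable_stdGaussian_of_norm_le ((aestronglyMeasurable_postMean ν κ _).norm.pow 2)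
    (C := (C * (1 + |κ|) ^ 2) ^ 2) (n := 4) (fun x => ?_)
  rw [norm_pow, norm_norm]
  calc _ ≤ (C * (1 + |κ|) ^ 2 * (1 + ‖x‖) ^ 2) ^ 2 := by gcongr; exact (hC κ x).2.2
    _ = _ := by ring

theorem integrable_inner_postMean (κ : ℝ) :
    Integrable (fun x => inner ℝ x (postMean ν κ x)) (stdGaussian (Vec d)) := by
  obtain ⟨C, hC0, hC⟩ := posterior_growth ν
  refine integrable_stdGaussian_of_norm_le
    (aestronglyMeasurable_id.inner (aestronglyMeasurable_postMean ν κ _))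
    (C := C * (1 + |κ|) ^ 2) (n := 3) (fun x => ?_)
  calc _ ≤ ‖x‖ * ‖postMean ν κ x‖ := norm_inner_le_norm _ _
    _ ≤ (1 + ‖x‖) * (C * (1 + |κ|) ^ 2 * (1 + ‖x‖) ^ 2) := by
      gcongr
      · linarith
      · exact (hC κ x).2.2
    _ = _ := by ring

theorem hasLineDerivAt_inner_left (x v : Vec d) :
    HasLineDerivAt ℝ (fun x : Vec d => inner ℝ x v) (‖v‖ ^ 2) x v := by
  have h2 : HasFDerivAt (fun u : Vec d => inner ℝ u v) (innerSL ℝ v) x := by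
    refine ((innerSL ℝ v).hasFDerivAt (x := x)).congr_of_eventuallyEq
      (Filter.Eventually.of_forall fun y => ?_)
    simp [real_inner_comm]
  refine HasDerivAt.congr_deriv (h2.hasLineDerivAt v) ?_
  simp

/-- Stein's lemma applied to each coordinate function gives one per dimension. -/
theorem integral_norm_sq_stdGaussian (d : ℕ) :
    ∫ x, ‖x‖ ^ 2 ∂(stdGaussian (Vec d)) = d := by
  let b := EuclideanSpace.basisFun (Fin d) ℝ
  have hi : ∀ i, Integrable (fun x : Vec d => inner ℝ x (b i)) (stdGaussian (Vec d)) := fun i =>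
    integrable_stdGaussian_of_norm_le (by fun_prop) (C := 1) (n := 1) (fun x => by
      refine (norm_inner_le_norm _ _).trans ?_
      rw [b.norm_eq_one]; linarith)
  have hi2 : ∀ i, Integrable (fun x : Vec d => inner ℝ x (b i) * inner ℝ x (b i))
      (stdGaussian (Vec d)) := fun i =>
    integrable_stdGaussian_of_norm_le (by fun_prop) (C := 1) (n := 2) (fun x => by
      have := norm_inner_le_norm (𝕜 := ℝ) x (b i)
      rw [b.norm_eq_one] at this
      rw [norm_mul, ← pow_two, one_mul]
      gcongr
      linarith)
  have h : ∀ x : Vec d, ‖x‖ ^ 2 = ∑ i, inner ℝ x (b i) * inner ℝ x (b i) := fun x => by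
    rw [← real_inner_self_eq_norm_sq, ← b.sum_inner_mul_inner x x]
    simp_rw [real_inner_comm x]
  simp_rw [h]
  rw [integral_finsetSum _ fun i _ => hi2 i]
  have : ∀ i, ∫ x, inner ℝ x (b i) * inner ℝ x (b i) ∂(stdGaussian (Vec d)) = 1 := fun i => by
    rw [integral_inner_mul_stdGaussian (b i) (fun x => hasLineDerivAt_inner_left x (b i)) (hi i)
      (hi2 i) (integrable_const _)]
    simp [b.norm_eq_one]
  simp [this]

/-- Stein's lemma for the posterior mean. -/
theorem integral_inner_postMean (κ : ℝ) :
    ∫ x, inner ℝ x (postMean ν κ x) ∂(stdGaussian (Vec d))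
      = ∫ x, (postSq ν κ x - d - ‖postMean ν κ x‖ ^ 2) ∂(stdGaussian (Vec d)) := by
  let b := EuclideanSpace.basisFun (Fin d) ℝ
  obtain ⟨C, hC0, hC⟩ := posterior_growth ν
  -- Posterior second moment along the i-th basis vector; these sum to `postSq`, and each is
  -- dominated by it.
  let q : Fin d → Vec d → ℝ := fun i x =>
    (evidence ν κ x)⁻¹ * ∫ v, gaussWeight (κ • v - x) * inner ℝ (κ • v - x) (b i) ^ 2 ∂ν
  have hint : ∀ i x, Integrable
      (fun v => gaussWeight (κ • v - x) * inner ℝ (κ • v - x) (b i) ^ 2) ν := fun i x => by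
    refine ((integrable_gaussWeight_mul_sq ν κ x)).mono' ?_
      (Filter.Eventually.of_forall fun v => ?_)
    · exact ((continuous_gaussWeight.comp (by fun_prop)).mul (by fun_prop)).aestronglyMeasurable
    · have := abs_real_inner_le_norm (κ • v - x) (b i)
      rw [b.norm_eq_one, mul_one] at this
      rw [Real.norm_of_nonneg (mul_nonneg (gaussWeight_pos _).le (by positivity)), ← sq_abs]
      refine mul_le_mul_of_nonneg_left ?_ (gaussWeight_pos _).le
      gcongr
  have hqs : ∀ x, ∑ i, q i x = postSq ν κ x := fun x => by
    simp only [q, ← Finset.mul_sum, postSq]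
    rw [← integral_finsetSum _ fun i _ => hint i x]
    congr 2
    funext v
    rw [← Finset.mul_sum, ← real_inner_self_eq_norm_sq (κ • v - x), ← b.sum_inner_mul_inner]
    congr 1
    refine Finset.sum_congr rfl fun i _ => ?_
    rw [real_inner_comm (b i)]; ring
  have hq0 : ∀ i x, 0 ≤ q i x := fun i x =>
    mul_nonneg (inv_nonneg.2 (evidence_pos ν κ x).le)
      (integral_nonneg fun v => mul_nonneg (gaussWeight_pos _).le (by positivity))
  have hqm : ∀ i, AEStronglyMeasurable (q i) (stdGaussian (Vec d)) := fun i => by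
    have : Continuous fun p : Vec d × Vec d =>
        gaussWeight (κ • p.2 - p.1) * inner ℝ (κ • p.2 - p.1) (b i) ^ 2 :=
      (continuous_gaussWeight.comp (by fun_prop)).mul (by fun_prop)
    exact (((measurable_evidence ν).comp measurable_prodMk_left).inv.mul
      (this.stronglyMeasurable.integral_prod_right').measurable).aestronglyMeasurable
  have hqi : ∀ i, Integrable (q i) (stdGaussian (Vec d)) := fun i => by
    refine (integrable_postSq ν κ).mono' (hqm i) (Filter.Eventually.of_forall fun x => ?_)
    rw [Real.norm_of_nonneg (hq0 i x), ← hqs]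
    exact Finset.single_le_sum (fun j _ => hq0 j x) (Finset.mem_univ i)
  have hg : ∀ i x, ‖(inner ℝ (postMean ν κ x) (b i) : ℝ)‖ ≤ ‖postMean ν κ x‖ := fun i x => by
    have := norm_inner_le_norm (𝕜 := ℝ) (postMean ν κ x) (b i)
    rwa [b.norm_eq_one, mul_one] at this
  have hgm : ∀ i, AEStronglyMeasurable (fun x => (inner ℝ (postMean ν κ x) (b i) : ℝ))
      (stdGaussian (Vec d)) := fun i =>
    (aestronglyMeasurable_postMean ν κ _).inner aestronglyMeasurable_const
  have hgi : ∀ i, Integrable (fun x => (inner ℝ (postMean ν κ x) (b i) : ℝ))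
      (stdGaussian (Vec d)) := fun i =>
    (integrable_postMean ν κ).mono (hgm i) (Filter.Eventually.of_forall (hg i))
  have hgi2 : ∀ i, Integrable (fun x => (inner ℝ (postMean ν κ x) (b i) : ℝ) ^ 2)
      (stdGaussian (Vec d)) := fun i =>
    (integrable_norm_postMean_sq ν κ).mono' ((hgm i).pow 2)
      (Filter.Eventually.of_forall fun x => by
        rw [norm_pow]; gcongr; exact hg i x)
  have hxg : ∀ i, Integrable (fun x => inner ℝ x (b i) * inner ℝ (postMean ν κ x) (b i))
      (stdGaussian (Vec d)) := fun i => by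
    refine integrable_stdGaussian_of_norm_le
      ((aestronglyMeasurable_id.inner aestronglyMeasurable_const).mul (hgm i))
      (C := C * (1 + |κ|) ^ 2) (n := 3) (fun x => ?_)
    have h1 := norm_inner_le_norm (𝕜 := ℝ) x (b i)
    rw [b.norm_eq_one, mul_one] at h1
    rw [norm_mul]
    calc _ ≤ (1 + ‖x‖) * (C * (1 + |κ|) ^ 2 * (1 + ‖x‖) ^ 2) := by
          gcongr
          · linarith
          · exact (hg i x).trans (hC κ x).2.2
      _ = _ := by ring
  have hD : ∀ i, Integrable (fun x => q i x - 1 - inner ℝ (postMean ν κ x) (b i) ^ 2)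
      (stdGaussian (Vec d)) := fun i => ((hqi i).sub (integrable_const _)).sub (hgi2 i)
  have h : ∀ x : Vec d, inner ℝ x (postMean ν κ x)
      = ∑ i, inner ℝ x (b i) * inner ℝ (postMean ν κ x) (b i) := fun x => by
    rw [← b.sum_inner_mul_inner]
    simp_rw [real_inner_comm _ (postMean ν κ x)]
  simp_rw [h]
  rw [integral_finsetSum _ fun i _ => hxg i]
  have hs : ∀ i, ∫ x, inner ℝ x (b i) * inner ℝ (postMean ν κ x) (b i) ∂(stdGaussian (Vec d))
      = ∫ x, (q i x - 1 - inner ℝ (postMean ν κ x) (b i) ^ 2) ∂(stdGaussian (Vec d)) := fun i =>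
    integral_inner_mul_stdGaussian (b i)
      (fun x => hasLineDerivAt_inner_postMean ν κ x (b i) (b.norm_eq_one i)) (hgi i) (hxg i) (hD i)
  simp_rw [hs]
  rw [← integral_finsetSum _ fun i _ => hD i]
  congr 1
  funext x
  rw [Finset.sum_sub_distrib, Finset.sum_sub_distrib, hqs, ← real_inner_self_eq_norm_sq,
    ← b.sum_inner_mul_inner]
  simp only [Finset.sum_const, Finset.card_univ, Fintype.card_fin, nsmul_eq_mul, mul_one]
  congr 1
  refine Finset.sum_congr rfl fun i _ => ?_
  rw [real_inner_comm (b i)]; ring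

/-- The κ-derivative of the weight involves ⟨κv - x, v⟩, where v alone is uncontrolled. Writing κ⟨κv
- x, v⟩ = ‖κv - x‖² + ⟨κv - x, x⟩ leaves only moments of the deviation, which the weight bounds;
this costs a factor κ⁻¹, hence κ > 0. -/
theorem hasDerivAt_log_evidence {κ : ℝ} (hκ : 0 < κ) (x : Vec d) :
    HasDerivAt (fun κ => Real.log (evidence ν κ x))
      (-(κ⁻¹ * (postSq ν κ x + inner ℝ x (postMean ν κ x)))) κ := by
  let F' : ℝ → Vec d → ℝ := fun κ v =>
    -(κ⁻¹ * (gaussWeight (κ • v - x) * ‖κ • v - x‖ ^ 2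
      + gaussWeight (κ • v - x) * inner ℝ (κ • v - x) x))
  have hcont : ∀ κ, Continuous (F' κ) := fun κ => by
    have : Continuous fun v : Vec d => gaussWeight (κ • v - x) :=
      continuous_gaussWeight.comp (by fun_prop)
    exact (continuous_const.mul ((this.mul (by fun_prop)).add (this.mul (by fun_prop)))).neg
  have h := (hasDerivAt_integral_of_dominated_loc_of_deriv_le (μ := ν) (x₀ := κ)
    -- Staying above κ/2 keeps the factor κ⁻¹ bounded in the domination.
    (s := Set.Ioi (κ / 2)) (F := fun κ v => gaussWeight (κ • v - x)) (F' := F')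
    (bound := fun _ => (κ / 2)⁻¹ * (1 + ‖x‖)) (Ioi_mem_nhds (by linarith))
    (Filter.Eventually.of_forall fun κ => (integrable_gaussWeight ν κ x).aestronglyMeasurable)
    (integrable_gaussWeight ν κ x) (hcont κ).aestronglyMeasurable
    (Filter.Eventually.of_forall fun v t ht => ?_) (integrable_const _)
    (Filter.Eventually.of_forall fun v t ht => ?_)).2
  · refine (h.log (evidence_pos ν κ x).ne').congr_deriv ?_
    have e1 := integral_add (integrable_gaussWeight_mul_sq ν κ x) (f := fun v =>
      gaussWeight (κ • v - x) * ‖κ • v - x‖ ^ 2) (g := fun v =>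
      gaussWeight (κ • v - x) * inner ℝ (κ • v - x) x) (μ := ν) (by
        refine ((integrable_gaussWeight_smul ν κ x).inner_const (𝕜 := ℝ) x).congr
          (Filter.Eventually.of_forall fun v => ?_)
        simp only [real_inner_smul_left])
    simp only [F']
    rw [integral_neg, integral_const_mul, e1, real_inner_comm, inner_postMean, postSq]
    change _ / evidence ν κ x = _
    field_simp
  · have hκ2 : 0 < κ / 2 := by linarith
    have ht0 : κ / 2 < t := ht
    simp only [F']
    rw [norm_neg, norm_mul, norm_inv, Real.norm_of_nonneg (hκ2.trans ht0).le]
    have h1 := gaussWeight_mul_sq_le (t • v - x)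
    have h2 := gaussWeight_mul_norm_le (t • v - x)
    have h3 := gaussWeight_pos (t • v - x)
    gcongr
    refine (norm_add_le _ _).trans ?_
    rw [norm_mul, norm_mul, Real.norm_of_nonneg h3.le, norm_pow, norm_norm]
    have h4 := norm_inner_le_norm (𝕜 := ℝ) (t • v - x) x
    have h5 := mul_le_mul_of_nonneg_left h4 h3.le
    have h6 := mul_le_mul_of_nonneg_right h2 (norm_nonneg x)
    linarith
  · have ht0 : 0 < t := by
      have : κ / 2 < t := ht
      linarith
    have h1 : HasDerivAt (fun t : ℝ => t • v - x) v t := by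
      simpa using ((hasDerivAt_id t).smul_const v).sub_const x
    refine ((hasFDerivAt_gaussWeight (t • v - x)).comp_hasDerivAt t h1).congr_deriv ?_
    have h2 : ‖t • v - x‖ ^ 2 + inner ℝ (t • v - x) x = t * inner ℝ (t • v - x) v := by
      rw [← real_inner_self_eq_norm_sq, ← inner_add_right, sub_add_cancel, real_inner_smul_right]
    simp only [F', ← mul_add, h2, FunLike.coe_smul, Pi.smul_apply, innerSL_apply_apply,
      smul_eq_mul]
    field_simp

/-- Derivative of the mean log-evidence in the signal-to-noise amplitude. -/
theorem hasDerivAt_integral_log_evidence {κ : ℝ} (hκ : 0 < κ) :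
    HasDerivAt (fun κ => ∫ x, Real.log (evidence ν κ x) ∂(stdGaussian (Vec d)))
      (-(κ⁻¹ * ∫ x, ‖x + postMean ν κ x‖ ^ 2 ∂(stdGaussian (Vec d)))) κ := by
  obtain ⟨C, hC0, hC⟩ := posterior_growth ν
  have hκ2 : 0 < κ / 2 := by linarith
  have h := (hasDerivAt_integral_of_dominated_loc_of_deriv_le (μ := stdGaussian (Vec d)) (x₀ := κ)
    (s := Set.Ioo (κ / 2) (2 * κ)) (F := fun κ x => Real.log (evidence ν κ x))
    (F' := fun κ x => -(κ⁻¹ * (postSq ν κ x + inner ℝ x (postMean ν κ x))))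
    -- On (κ/2, 2κ) the growth constant is at most C(1 + 2κ)²; the factor 2 counts the two summands,
    -- and the inner product with x raises the degree to three.
    (bound := fun x => (κ / 2)⁻¹ * (2 * (C * (1 + 2 * κ) ^ 2)) * (1 + ‖x‖) ^ 3)
    (Ioo_mem_nhds (by linarith) (by linarith))
    (Filter.Eventually.of_forall fun κ => (integrable_log_evidence ν κ).aestronglyMeasurable)
    (integrable_log_evidence ν κ)
    ((((integrable_postSq ν κ).add (integrable_inner_postMean ν κ)).const_mul
      κ⁻¹).neg.aestronglyMeasurable)
    (Filter.Eventually.of_forall fun v t ht => ?_)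
    ((integrable_one_add_norm_pow 3).const_mul _)
    (Filter.Eventually.of_forall fun x t ht =>
      hasDerivAt_log_evidence ν (hκ2.trans ht.1) x)).2
  · refine h.congr_deriv ?_
    rw [integral_neg, integral_const_mul]
    congr 2
    -- Completing the square: E‖x + g‖² = d + 2E⟨x,g⟩ + E‖g‖², and Stein's identity replaces one
    -- copy of E⟨x,g⟩ by E[S] - d - E‖g‖².
    have e1 : ∀ x : Vec d, ‖x + postMean ν κ x‖ ^ 2
        = ‖x‖ ^ 2 + 2 * inner ℝ x (postMean ν κ x) + ‖postMean ν κ x‖ ^ 2 := fun x =>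
      norm_add_sq_real _ _
    have i1 := integrable_norm_sq_stdGaussian (d := d)
    have i2 := integrable_inner_postMean ν κ
    have i3 := integrable_norm_postMean_sq ν κ
    have i4 := integrable_postSq ν κ
    have e2 := integral_inner_postMean ν κ
    have i5 : Integrable (fun x => postSq ν κ x - d) (stdGaussian (Vec d)) :=
      i4.sub (integrable_const _)
    rw [integral_sub i5 i3, integral_sub i4 (integrable_const _)] at e2
    simp_rw [e1]
    have i6 : Integrable (fun x => ‖x‖ ^ 2 + 2 * inner ℝ x (postMean ν κ x))
        (stdGaussian (Vec d)) := i1.add (i2.const_mul 2)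
    rw [integral_add i4 i2, integral_add i6 i3,
      integral_add i1 (i2.const_mul 2), integral_norm_sq_stdGaussian, integral_const_mul]
    simp only [integral_const, probReal_univ, one_smul] at e2
    linarith
  · have ht0 : 0 < t := hκ2.trans ht.1
    rw [norm_neg, norm_mul, norm_inv, Real.norm_of_nonneg ht0.le, mul_assoc]
    gcongr
    · exact ht.1.le
    refine (norm_add_le _ _).trans ?_
    have h1 := hC t v
    have h2 : C * (1 + |t|) ^ 2 ≤ C * (1 + 2 * κ) ^ 2 := by
      rw [abs_of_pos ht0]; gcongr; exact ht.2.le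
    have h3 : (1 + ‖v‖) ^ 2 ≤ (1 + ‖v‖) ^ 3 :=
      pow_le_pow_right₀ (by linarith [norm_nonneg v]) (by norm_num)
    have h4 : ‖postSq ν t v‖ ≤ C * (1 + 2 * κ) ^ 2 * (1 + ‖v‖) ^ 3 := by
      rw [Real.norm_of_nonneg (postSq_nonneg ν t v)]
      exact h1.2.1.trans (by gcongr)
    have h5 : ‖(inner ℝ v (postMean ν t v) : ℝ)‖ ≤ C * (1 + 2 * κ) ^ 2 * (1 + ‖v‖) ^ 3 := by
      calc _ ≤ ‖v‖ * ‖postMean ν t v‖ := norm_inner_le_norm _ _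
        _ ≤ (1 + ‖v‖) * (C * (1 + 2 * κ) ^ 2 * (1 + ‖v‖) ^ 2) := by
          gcongr
          · linarith
          · exact h1.2.2.trans (by gcongr)
        _ = _ := by ring
    linarith

end core

/-! ### Diffused densities, scores and divergences in terms of the evidence -/

/-- Signal-to-noise amplitude `α_t / σ_t`. -/
def snr (β : ℝ → ℝ) (t : ℝ) : ℝ := alpha β t / sigma β t

section forward
variable {d : ℕ} {β : ℝ → ℝ} {t : ℝ}

theorem alpha_pos (β : ℝ → ℝ) (t : ℝ) : 0 < alpha β t := Real.exp_pos _

theorem snr_pos (hs : 0 < sigma β t) : 0 < snr β t := div_pos (alpha_pos β t) hs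

theorem transitionDensity_eq_gaussWeight (hs : 0 < sigma β t) (z₀ z : Vec d) :
    transitionDensity β t z₀ z = (2 * Real.pi * sigma β t ^ 2) ^ (-(d : ℝ) / 2) *
      gaussWeight (snr β t • z₀ - (sigma β t)⁻¹ • z) := by
  have : snr β t • z₀ - (sigma β t)⁻¹ • z = -((sigma β t)⁻¹ • (z - alpha β t • z₀)) := by
    rw [smul_sub, smul_smul, snr, div_eq_inv_mul]; abel
  rw [transitionDensity, gaussWeight, this, norm_neg, norm_smul, norm_inv,
    Real.norm_of_nonneg hs.le, mul_pow]
  congr 2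
  field_simp

theorem transitionDensity_pos (hs : 0 < sigma β t) (z₀ z : Vec d) :
    0 < transitionDensity β t z₀ z := gaussianDensity_pos _ hs _

theorem log_transitionDensity (hs : 0 < sigma β t) (z₀ z : Vec d) :
    Real.log (transitionDensity β t z₀ z)
      = Real.log ((2 * Real.pi * sigma β t ^ 2) ^ (-(d : ℝ) / 2))
        - ‖z - alpha β t • z₀‖ ^ 2 / (2 * sigma β t ^ 2) := by
  rw [transitionDensity, Real.log_mul (by positivity) (Real.exp_pos _).ne', Real.log_exp]
  ring

theorem inv_sigma_smul_noisy (hs : 0 < sigma β t) (ζ e : Vec d) :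
    (sigma β t)⁻¹ • (alpha β t • ζ + sigma β t • e) = snr β t • ζ + e := by
  rw [smul_add, smul_smul, inv_smul_smul₀ hs.ne', snr, div_eq_inv_mul]

theorem forwardDensity_eq (hs : 0 < sigma β t) (μ : Measure (Vec d)) (z : Vec d) :
    forwardDensity β t μ z = (2 * Real.pi * sigma β t ^ 2) ^ (-(d : ℝ) / 2) *
      evidence μ (snr β t) ((sigma β t)⁻¹ • z) := by
  unfold forwardDensity evidence
  simp_rw [transitionDensity_eq_gaussWeight hs]
  rw [integral_const_mul]

/-- Law of `z₀ - ζ`. -/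
def recentered (μ : Measure (Vec d)) (ζ : Vec d) : Measure (Vec d) := μ.map fun z => z - ζ

/-- Recentring the prior at the particle moves the evaluation point from the scaled sample to the
noise e, so that later expectations run over a fixed Gaussian. -/
theorem evidence_recentered (μ : Measure (Vec d)) (ζ : Vec d) (κ : ℝ) (e : Vec d) :
    evidence (recentered μ ζ) κ e = evidence μ κ (κ • ζ + e) := by
  have : Continuous fun v : Vec d => gaussWeight (κ • v - e) :=
    continuous_gaussWeight.comp (by fun_prop)
  rw [evidence, recentered, integral_map (by fun_prop) this.aestronglyMeasurable]
  simp only [smul_sub, sub_sub, evidence]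

theorem klAt_nonneg (μ : Measure (Vec d)) (ζ : Vec d) : 0 ≤ klAt β μ (Measure.dirac ζ) t := ENNReal.toReal_nonneg

theorem postMean_recentered (μ : Measure (Vec d)) (ζ : Vec d) (κ : ℝ) (e : Vec d) :
    postMean (recentered μ ζ) κ e = postMean μ κ (κ • ζ + e) := by
  have : Continuous fun v : Vec d => gaussWeight (κ • v - e) • (κ • v - e) :=
    (continuous_gaussWeight.comp (by fun_prop)).smul (by fun_prop)
  rw [postMean, evidence_recentered, recentered, integral_map (by fun_prop)
    this.aestronglyMeasurable]
  simp only [smul_sub, sub_sub, postMean]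

variable (μ : Measure (Vec d)) [IsProbabilityMeasure μ]

theorem forwardDensity_pos (hs : 0 < sigma β t) (z : Vec d) : 0 < forwardDensity β t μ z := by
  rw [forwardDensity_eq hs]
  have := evidence_pos μ (snr β t) ((sigma β t)⁻¹ • z)
  positivity

theorem log_forwardDensity (hs : 0 < sigma β t) (z : Vec d) :
    Real.log (forwardDensity β t μ z)
      = Real.log ((2 * Real.pi * sigma β t ^ 2) ^ (-(d : ℝ) / 2))
        + Real.log (evidence μ (snr β t) ((sigma β t)⁻¹ • z)) := by
  rw [forwardDensity_eq hs, Real.log_mul (by positivity) (evidence_pos _ _ _).ne']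

theorem measurable_forwardDensity (hs : 0 < sigma β t) : Measurable (forwardDensity β t μ) := by
  rw [funext (forwardDensity_eq hs μ)]
  exact ((measurable_evidence μ).comp (by fun_prop : Measurable fun z : Vec d =>
    (snr β t, (sigma β t)⁻¹ • z))).const_mul _

theorem integrable_transitionDensity (hs : 0 < sigma β t) (z : Vec d) :
    Integrable (fun z₀ => transitionDensity β t z₀ z) μ := by
  simp_rw [transitionDensity_eq_gaussWeight hs]
  exact (integrable_gaussWeight μ _ _).const_mul _

/-- Conditionally on the starting point the law is an affine image of the standard Gaussian; Tonelli
exchanges the two integrations. -/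
theorem forwardLaw_eq_withDensity (hs : 0 < sigma β t) :
    forwardLaw β t μ = volume.withDensity fun z => ENNReal.ofReal (forwardDensity β t μ z) := by
  ext A hA
  have hm : Measurable fun p : Vec d × Vec d => transitionDensity β t p.1 p.2 :=
    (measurable_gaussianDensity d).comp (by fun_prop : Measurable fun p : Vec d × Vec d =>
      (alpha β t • p.1, sigma β t, p.2))
  rw [forwardLaw, Measure.map_apply (by fun_prop) hA,
    Measure.prod_apply ((by fun_prop : Measurable fun p : Vec d × Vec d =>
      alpha β t • p.1 + sigma β t • p.2) hA), withDensity_apply _ hA]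
  have h1 : ∀ z₀ : Vec d, stdGaussian (Vec d) (Prod.mk z₀ ⁻¹'
      ((fun p : Vec d × Vec d => alpha β t • p.1 + sigma β t • p.2) ⁻¹' A))
      = ∫⁻ z in A, ENNReal.ofReal (transitionDensity β t z₀ z) := fun z₀ => by
    have := congrArg (fun m => m A) (stdGaussian_map_affine (alpha β t • z₀) hs)
    simp only at this
    rw [Measure.map_apply (by fun_prop) hA, withDensity_apply _ hA] at this
    exact this
  simp_rw [h1]
  rw [lintegral_lintegral_swap hm.ennreal_ofReal.aemeasurable]
  refine lintegral_congr fun z => ?_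
  rw [forwardDensity, ofReal_integral_eq_lintegral_ofReal (integrable_transitionDensity μ hs z)
    (Filter.Eventually.of_forall fun z₀ => (transitionDensity_pos hs z₀ z).le)]

theorem forwardLaw_dirac (ζ : Vec d) :
    forwardLaw β t (Measure.dirac ζ)
      = (stdGaussian (Vec d)).map fun e => alpha β t • ζ + sigma β t • e := by
  rw [forwardLaw, Measure.dirac_prod, Measure.map_map (by fun_prop) (by fun_prop)]
  rfl

theorem forwardDensity_dirac (ζ z : Vec d) :
    forwardDensity β t (Measure.dirac ζ) z = transitionDensity β t ζ z := by
  simp [forwardDensity]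

theorem hasGradientAt_log_forwardDensity (hs : 0 < sigma β t) (z : Vec d) :
    HasGradientAt (fun w => Real.log (forwardDensity β t μ w))
      ((sigma β t)⁻¹ • postMean μ (snr β t) ((sigma β t)⁻¹ • z)) z := by
  have h := (hasGradientAt_log_evidence μ (snr β t) ((sigma β t)⁻¹ • z)).hasFDerivAt
  have h1 : HasFDerivAt (fun w : Vec d => (sigma β t)⁻¹ • w)
      ((sigma β t)⁻¹ • ContinuousLinearMap.id ℝ (Vec d)) z :=
    (hasFDerivAt_id (𝕜 := ℝ) z).fun_const_smul (sigma β t)⁻¹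
  have h2 := (h.comp z h1).const_add (Real.log ((2 * Real.pi * sigma β t ^ 2) ^ (-(d : ℝ) / 2)))
  rw [hasGradientAt_iff_hasFDerivAt]
  refine (h2.congr_fderiv ?_).congr_of_eventuallyEq
    (Filter.Eventually.of_forall fun w => log_forwardDensity μ hs w)
  ext w
  simp

theorem score_eq (hs : 0 < sigma β t) (z : Vec d) :
    score β t μ z = (sigma β t)⁻¹ • postMean μ (snr β t) ((sigma β t)⁻¹ • z) :=
  (hasGradientAt_log_forwardDensity μ hs z).gradient

theorem hasGradientAt_score (hs : 0 < sigma β t) (z : Vec d) :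
    HasGradientAt (fun w => Real.log (forwardDensity β t μ w)) (score β t μ z) z := by
  rw [score_eq μ hs]; exact hasGradientAt_log_forwardDensity μ hs z

theorem postMean_dirac (κ : ℝ) (ζ x : Vec d) :
    postMean (Measure.dirac ζ) κ x = κ • ζ - x := by
  rw [postMean, evidence, integral_dirac, integral_dirac, inv_smul_smul₀ (gaussWeight_pos _).ne']

theorem score_dirac (hs : 0 < sigma β t) (ζ e : Vec d) :
    score β t (Measure.dirac ζ) (alpha β t • ζ + sigma β t • e) = -((sigma β t)⁻¹ • e) := by
  rw [score_eq _ hs, postMean_dirac, inv_sigma_smul_noisy hs]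
  simp

instance (ζ : Vec d) : IsProbabilityMeasure (recentered μ ζ) :=
  Measure.isProbabilityMeasure_map (by fun_prop)

theorem score_noisy (hs : 0 < sigma β t) (ζ e : Vec d) :
    score β t μ (alpha β t • ζ + sigma β t • e)
      = (sigma β t)⁻¹ • postMean (recentered μ ζ) (snr β t) e := by
  rw [score_eq μ hs, inv_sigma_smul_noisy hs, postMean_recentered]

theorem score_sub_score (hs : 0 < sigma β t) (ζ e : Vec d) :
    ‖score β t (Measure.dirac ζ) (alpha β t • ζ + sigma β t • e)
        - score β t μ (alpha β t • ζ + sigma β t • e)‖ ^ 2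
      = (sigma β t ^ 2)⁻¹ * ‖e + postMean (recentered μ ζ) (snr β t) e‖ ^ 2 := by
  rw [score_dirac hs, score_noisy μ hs, ← neg_add', norm_neg, ← smul_add, norm_smul, mul_pow,
    norm_inv, Real.norm_of_nonneg hs.le, inv_pow]

theorem measurable_score (hs : 0 < sigma β t) : Measurable (score β t μ) := by
  rw [funext (score_eq μ hs)]
  exact ((measurable_postMean μ).comp (by fun_prop : Measurable fun z : Vec d =>
    (snr β t, (sigma β t)⁻¹ • z))).const_smul (sigma β t)⁻¹

theorem integrable_norm_add_postMean_sq (κ : ℝ) :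
    Integrable (fun x => ‖x + postMean μ κ x‖ ^ 2) (stdGaussian (Vec d)) := by
  simp_rw [norm_add_sq_real]
  exact (integrable_norm_sq_stdGaussian.add ((integrable_inner_postMean μ κ).const_mul 2)).add
    (integrable_norm_postMean_sq μ κ)

theorem integrable_score_sub_score (hs : 0 < sigma β t) (ζ : Vec d) :
    Integrable (fun w => ‖score β t (Measure.dirac ζ) w - score β t μ w‖ ^ 2)
      (forwardLaw β t (Measure.dirac ζ)) := by
  have hm : Measurable fun w => ‖score β t (Measure.dirac ζ) w - score β t μ w‖ ^ 2 :=
    ((measurable_score _ hs).sub (measurable_score _ hs)).norm.pow_const 2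
  rw [forwardLaw_dirac, integrable_map_measure hm.aestronglyMeasurable (by fun_prop)]
  refine ((integrable_norm_add_postMean_sq (recentered μ ζ) (snr β t)).const_mul
    (sigma β t ^ 2)⁻¹).congr (Filter.Eventually.of_forall fun e => ?_)
  exact (score_sub_score μ hs ζ e).symm

theorem fisherAt_eq (hs : 0 < sigma β t) (ζ : Vec d) :
    fisherAt β μ (Measure.dirac ζ) t = (sigma β t ^ 2)⁻¹ *
      ∫ e, ‖e + postMean (recentered μ ζ) (snr β t) e‖ ^ 2 ∂(stdGaussian (Vec d)) := by
  have hm : Measurable fun w => ‖score β t (Measure.dirac ζ) w - score β t μ w‖ ^ 2 :=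
    ((measurable_score _ hs).sub (measurable_score _ hs)).norm.pow_const 2
  rw [fisherAt, forwardLaw_dirac, integral_map (by fun_prop) hm.aestronglyMeasurable]
  simp_rw [score_sub_score μ hs ζ]
  rw [integral_const_mul]

/-- Log-density ratio of the transition kernel from `z₀` to the marginal of `μ`. -/
theorem log_transitionDensity_sub (hs : 0 < sigma β t) (ζ e : Vec d) :
    Real.log (transitionDensity β t ζ (alpha β t • ζ + sigma β t • e))
      - Real.log (forwardDensity β t μ (alpha β t • ζ + sigma β t • e))
      = -(‖e‖ ^ 2 / 2) - Real.log (evidence (recentered μ ζ) (snr β t) e) := by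
  rw [log_transitionDensity hs, log_forwardDensity μ hs, inv_sigma_smul_noisy hs,
    evidence_recentered, add_sub_cancel_left, norm_smul, Real.norm_of_nonneg hs.le]
  field_simp
  ring

theorem integrable_log_transitionDensity_sub (hs : 0 < sigma β t) (ζ : Vec d) :
    Integrable (fun e => Real.log (transitionDensity β t ζ (alpha β t • ζ + sigma β t • e))
      - Real.log (forwardDensity β t μ (alpha β t • ζ + sigma β t • e)))
      (stdGaussian (Vec d)) := by
  simp_rw [log_transitionDensity_sub μ hs]
  exact ((integrable_norm_sq_stdGaussian.div_const 2).neg).sub (integrable_log_evidence _ _)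

theorem measurable_transitionDensity (ζ : Vec d) : Measurable (transitionDensity β t ζ) :=
  (continuous_gaussianDensity (alpha β t • ζ) (sigma β t)).measurable

theorem measurable_ofReal_div (hs : 0 < sigma β t) (ζ : Vec d) :
    Measurable fun z => ENNReal.ofReal (transitionDensity β t ζ z / forwardDensity β t μ z) :=
  ((measurable_transitionDensity ζ).div (measurable_forwardDensity μ hs)).ennreal_ofReal

theorem measurable_log_sub_log (hs : 0 < sigma β t) (ζ : Vec d) :
    Measurable fun z => Real.log (transitionDensity β t ζ z)
      - Real.log (forwardDensity β t μ z) :=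
  (measurable_transitionDensity ζ).log.sub (measurable_forwardDensity μ hs).log

/-- Both laws have positive Lebesgue densities, so the quotient is a density of one law relative to
the other. This yields absolute continuity and identifies the log-likelihood ratio inside the KL
divergence. -/
theorem forwardLaw_dirac_eq_withDensity (hs : 0 < sigma β t) (ζ : Vec d) :
    forwardLaw β t (Measure.dirac ζ) = (forwardLaw β t μ).withDensity fun z =>
      ENNReal.ofReal (transitionDensity β t ζ z / forwardDensity β t μ z) := by
  have hp := measurable_forwardDensity μ hs
  rw [forwardLaw_eq_withDensity μ hs, ← withDensity_mul _ hp.ennreal_ofReal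
    (measurable_ofReal_div μ hs ζ), forwardLaw_eq_withDensity _ hs]
  congr 1
  funext z
  rw [Pi.mul_apply, ← ENNReal.ofReal_mul (forwardDensity_pos μ hs z).le, forwardDensity_dirac,
    mul_div_cancel₀ _ (forwardDensity_pos μ hs z).ne']

theorem isProbabilityMeasure_forwardLaw : IsProbabilityMeasure (forwardLaw β t μ) :=
  Measure.isProbabilityMeasure_map (by fun_prop)

theorem llr_forwardLaw (hs : 0 < sigma β t) (ζ : Vec d) :
    llr (forwardLaw β t (Measure.dirac ζ)) (forwardLaw β t μ)
      =ᵐ[forwardLaw β t (Measure.dirac ζ)] fun z =>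
        Real.log (transitionDensity β t ζ z) - Real.log (forwardDensity β t μ z) := by
  have := isProbabilityMeasure_forwardLaw (β := β) (t := t) μ
  have hac : forwardLaw β t (Measure.dirac ζ) ≪ forwardLaw β t μ := by
    rw [forwardLaw_dirac_eq_withDensity μ hs]; exact withDensity_absolutelyContinuous _ _
  have h := Measure.rnDeriv_withDensity (forwardLaw β t μ)
    (measurable_ofReal_div μ hs ζ)
  rw [← forwardLaw_dirac_eq_withDensity μ hs] at h
  filter_upwards [hac.ae_le h] with z hz
  have h1 := transitionDensity_pos hs ζ z
  have h2 := forwardDensity_pos μ hs z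
  rw [llr, hz, ENNReal.toReal_ofReal (by positivity), Real.log_div h1.ne' h2.ne']

theorem klDiv_ne_top (hs : 0 < sigma β t) (ζ : Vec d) :
    InformationTheory.klDiv (forwardLaw β t (Measure.dirac ζ)) (forwardLaw β t μ) ≠ ⊤ := by
  refine InformationTheory.klDiv_ne_top ?_ ?_
  · rw [forwardLaw_dirac_eq_withDensity μ hs]; exact withDensity_absolutelyContinuous _ _
  · rw [integrable_congr (llr_forwardLaw μ hs ζ), forwardLaw_dirac, integrable_map_measure
      (measurable_log_sub_log μ hs ζ).aestronglyMeasurable (by fun_prop)]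
    exact integrable_log_transitionDensity_sub μ hs ζ

/-- The KL divergence as a Gaussian expectation of the log-density ratio. -/
theorem klAt_eq_integral (hs : 0 < sigma β t) (ζ : Vec d) :
    klAt β μ (Measure.dirac ζ) t =
      ∫ e, (Real.log (transitionDensity β t ζ (alpha β t • ζ + sigma β t • e))
        - Real.log (forwardDensity β t μ (alpha β t • ζ + sigma β t • e)))
        ∂(stdGaussian (Vec d)) := by
  have := isProbabilityMeasure_forwardLaw (β := β) (t := t) μ
  have := isProbabilityMeasure_forwardLaw (β := β) (t := t) (Measure.dirac ζ)
  rw [klAt, InformationTheory.toReal_klDiv_of_measure_eq _ (by simp),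
    integral_congr_ae (llr_forwardLaw μ hs ζ)]
  · nth_rewrite 1 [forwardLaw_dirac]
    rw [integral_map (by fun_prop)
      (measurable_log_sub_log μ hs ζ).aestronglyMeasurable]
  · rw [forwardLaw_dirac_eq_withDensity μ hs]; exact withDensity_absolutelyContinuous _ _

/-- The normalizing factors cancel in the log-ratio and E‖e‖² = d, so time survives only in the
signal-to-noise amplitude. -/
theorem klAt_eq (hs : 0 < sigma β t) (ζ : Vec d) :
    klAt β μ (Measure.dirac ζ) t = -((d : ℝ) / 2)
      - ∫ e, Real.log (evidence (recentered μ ζ) (snr β t) e) ∂(stdGaussian (Vec d)) := by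
  rw [klAt_eq_integral μ hs]
  simp_rw [log_transitionDensity_sub μ hs]
  have hi : Integrable (fun e : Vec d => -(‖e‖ ^ 2 / 2)) (stdGaussian (Vec d)) :=
    (integrable_norm_sq_stdGaussian.div_const 2).neg
  rw [integral_sub hi (integrable_log_evidence _ _),
    integral_neg, integral_div, integral_norm_sq_stdGaussian]

end forward

/-! ### Noise schedules: bounds and derivatives -/

/-- A positive continuous noise schedule on `[0, T]`. -/
structure IsSchedule (β : ℝ → ℝ) (T : ℝ) : Prop where
  pos : 0 < T
  continuousOn : ContinuousOn β (Set.Icc 0 T)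
  beta_pos : ∀ t ∈ Set.Icc 0 T, 0 < β t

theorem sigma_le_one (β : ℝ → ℝ) (t : ℝ) : sigma β t ≤ 1 := by
  exact Real.sqrt_le_one.2 (by nlinarith [sq_nonneg (alpha β t)])

theorem sigma_sq {β : ℝ → ℝ} {t : ℝ} (hs : 0 < sigma β t) :
    sigma β t ^ 2 = 1 - alpha β t ^ 2 := by
  rw [sigma, Real.sq_sqrt]
  exact (Real.sqrt_pos.1 hs).le

theorem alpha_sq (β : ℝ → ℝ) (t : ℝ) : alpha β t ^ 2 = Real.exp (-∫ s in (0 : ℝ)..t, β s) := by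
  rw [alpha, ← Real.exp_nat_mul]
  congr 1
  push_cast
  ring

namespace IsSchedule
variable {β : ℝ → ℝ} {T : ℝ} (h : IsSchedule β T)
include h

theorem intervalIntegrable {t : ℝ} (ht : t ∈ Set.Icc 0 T) : IntervalIntegrable β volume 0 t := by
  refine ContinuousOn.intervalIntegrable (h.continuousOn.mono ?_)
  rw [Set.uIcc_of_le ht.1]
  exact Set.Icc_subset_Icc_right ht.2

theorem exists_bounds : ∃ b B, 0 < b ∧ ∀ t ∈ Set.Icc 0 T, b ≤ β t ∧ β t ≤ B := by
  have hne : (Set.Icc 0 T).Nonempty := ⟨0, le_refl 0, h.pos.le⟩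
  obtain ⟨t₀, ht₀, h0⟩ := isCompact_Icc.exists_isMinOn hne h.continuousOn
  obtain ⟨t₁, ht₁, h1⟩ := isCompact_Icc.exists_isMaxOn hne h.continuousOn
  exact ⟨β t₀, β t₁, h.beta_pos t₀ ht₀, fun t ht => ⟨h0 ht, h1 ht⟩⟩

theorem integral_nonneg {t : ℝ} (ht : t ∈ Set.Icc 0 T) : 0 ≤ ∫ s in (0 : ℝ)..t, β s :=
  intervalIntegral.integral_nonneg ht.1 fun s hs =>
    (h.beta_pos s ⟨hs.1, hs.2.trans ht.2⟩).le

theorem alpha_le_one {t : ℝ} (ht : t ∈ Set.Icc 0 T) : alpha β t ≤ 1 := by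
  rw [alpha, Real.exp_le_one_iff]
  have := h.integral_nonneg ht
  linarith

/-- With I = ∫₀ᵗβ, the inequality I + 1 ≤ exp I gives 1 - exp(-I) ≥ I·exp(-I), and the bounds of β
give bt ≤ I ≤ BT. This linear lower bound controls every singularity at time zero. -/
theorem exists_le_sigma_sq :
    ∃ c, 0 < c ∧ ∀ t ∈ Set.Icc 0 T, c * t ≤ 1 - alpha β t ^ 2 := by
  obtain ⟨b, B, hb, hB⟩ := h.exists_bounds
  have hB0 : 0 < B := (hb.trans_le (hB 0 ⟨le_refl 0, h.pos.le⟩).1).trans_le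
    (hB 0 ⟨le_refl 0, h.pos.le⟩).2
  refine ⟨b * Real.exp (-(B * T)), by positivity, fun t ht => ?_⟩
  rw [alpha_sq]
  set I := ∫ s in (0 : ℝ)..t, β s
  have h1 : b * t ≤ I := by
    have := intervalIntegral.integral_mono_on (a := 0) (b := t) (f := fun _ => b) ht.1
      (by simp) (h.intervalIntegrable ht) (fun s hs => (hB s ⟨hs.1, hs.2.trans ht.2⟩).1)
    simpa [mul_comm] using this
  have h2 : I ≤ B * T := by
    have := intervalIntegral.integral_mono_on (a := 0) (b := t) (g := fun _ => B) ht.1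
      (h.intervalIntegrable ht) (by simp) (fun s hs => (hB s ⟨hs.1, hs.2.trans ht.2⟩).2)
    have h3 : I ≤ t * B := by simpa using this
    nlinarith [ht.2]
  have h4 : I + 1 ≤ Real.exp I := Real.add_one_le_exp I
  have h5 : Real.exp (-(B * T)) ≤ Real.exp (-I) := Real.exp_le_exp.2 (by linarith)
  have h6 : Real.exp (-I) * Real.exp I = 1 := by rw [← Real.exp_add]; simp
  have h7 : I * Real.exp (-I) ≤ 1 - Real.exp (-I) := by
    nlinarith [Real.exp_pos (-I)]
  have hI : 0 ≤ I := h.integral_nonneg ht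
  calc b * Real.exp (-(B * T)) * t = (b * t) * Real.exp (-(B * T)) := by ring
    _ ≤ I * Real.exp (-I) := by gcongr
    _ ≤ _ := h7

theorem sigma_pos {t : ℝ} (ht : t ∈ Set.Ioc 0 T) : 0 < sigma β t := by
  obtain ⟨c, hc, hct⟩ := h.exists_le_sigma_sq
  exact Real.sqrt_pos.2 ((mul_pos hc ht.1).trans_le (hct t ⟨ht.1.le, ht.2⟩))

theorem exists_mul_le_sigma_sq : ∃ c, 0 < c ∧ ∀ t ∈ Set.Ioc 0 T, c * t ≤ sigma β t ^ 2 := by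
  obtain ⟨c, hc, hct⟩ := h.exists_le_sigma_sq
  exact ⟨c, hc, fun t ht => by rw [sigma_sq (h.sigma_pos ht)]; exact hct t ⟨ht.1.le, ht.2⟩⟩

theorem continuousOn_alpha : ContinuousOn (alpha β) (Set.Icc 0 T) := by
  have h1 := intervalIntegral.continuousOn_primitive_interval (a := 0) (b := T) (f := β)
    (μ := volume) (by
      rw [Set.uIcc_of_le h.pos.le]
      exact h.continuousOn.integrableOn_Icc)
  rw [Set.uIcc_of_le h.pos.le] at h1
  exact (continuousOn_const.mul h1).rexp

theorem continuousOn_sigma : ContinuousOn (sigma β) (Set.Icc 0 T) :=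
  (continuousOn_const.sub (h.continuousOn_alpha.pow 2)).sqrt

theorem continuousOn_snr : ContinuousOn (snr β) (Set.Ioc 0 T) :=
  (h.continuousOn_alpha.mono Set.Ioc_subset_Icc_self).div
    (h.continuousOn_sigma.mono Set.Ioc_subset_Icc_self) fun _ ht => (h.sigma_pos ht).ne'

theorem hasDerivAt_alpha {t : ℝ} (ht : t ∈ Set.Ioo 0 T) :
    HasDerivAt (alpha β) (-(1 / 2) * β t * alpha β t) t := by
  have hnhds : Set.Icc 0 T ∈ nhds t := Icc_mem_nhds ht.1 ht.2
  have h1 : HasDerivAt (fun u => ∫ s in (0 : ℝ)..u, β s) (β t) t :=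
    intervalIntegral.integral_hasDerivAt_right (h.intervalIntegrable ⟨ht.1.le, ht.2.le⟩)
      (ContinuousOn.stronglyMeasurableAtFilter isOpen_Ioo
        (h.continuousOn.mono Set.Ioo_subset_Icc_self) t ht)
      (h.continuousOn.continuousAt hnhds)
  refine (h1.const_mul (-(1 / 2))).exp.congr_deriv ?_
  rw [alpha]; ring

theorem hasDerivAt_snr {t : ℝ} (ht : t ∈ Set.Ioo 0 T) :
    HasDerivAt (snr β) (-(β t / (2 * sigma β t ^ 2) * snr β t)) t := by
  have hs := h.sigma_pos ⟨ht.1, ht.2.le⟩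
  have ha := h.hasDerivAt_alpha ht
  have h1 : HasDerivAt (sigma β) _ t :=
    ((ha.pow 2).const_sub 1).sqrt (Real.sqrt_pos.1 hs).ne'
  refine (ha.div h1 hs.ne').congr_deriv ?_
  simp only [Pi.pow_apply]
  change _ = -(β t / (2 * sigma β t ^ 2) * (alpha β t / sigma β t))
  rw [show Real.sqrt (1 - alpha β t ^ 2) = sigma β t from rfl]
  have h2 := sigma_sq hs
  have h3 : (sigma β t) ^ 2 + alpha β t ^ 2 = 1 := by rw [h2]; ring
  field_simp
  push_cast
  -- After clearing denominators the two sides differ by a multiple of σ² + α² - 1.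
  linear_combination (-2 * alpha β t * β t) * h3

theorem aemeasurable_alpha : AEMeasurable (alpha β) (volume.restrict (Set.Ioc 0 T)) :=
  (h.continuousOn_alpha.mono Set.Ioc_subset_Icc_self).aemeasurable measurableSet_Ioc

theorem aemeasurable_sigma : AEMeasurable (sigma β) (volume.restrict (Set.Ioc 0 T)) :=
  (h.continuousOn_sigma.mono Set.Ioc_subset_Icc_self).aemeasurable measurableSet_Ioc

theorem aemeasurable_snr : AEMeasurable (snr β) (volume.restrict (Set.Ioc 0 T)) :=
  h.continuousOn_snr.aemeasurable measurableSet_Ioc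

/-- The signal-to-noise amplitude is integrable at time zero. -/
theorem intervalIntegrable_snr : IntervalIntegrable (snr β) volume 0 T := by
  obtain ⟨c, hc, hct⟩ := h.exists_mul_le_sigma_sq
  rw [intervalIntegrable_iff_integrableOn_Ioc_of_le h.pos.le]
  -- Since α ≤ 1 and σ² ≥ ct, the amplitude is at most (ct)^(-1/2).
  have h1 : IntervalIntegrable (fun t : ℝ => (Real.sqrt c)⁻¹ * t ^ (-(1 / 2) : ℝ)) volume 0 T :=
    (intervalIntegral.intervalIntegrable_rpow' (by norm_num)).const_mul _
  rw [intervalIntegrable_iff_integrableOn_Ioc_of_le h.pos.le] at h1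
  refine h1.mono' h.aemeasurable_snr.aestronglyMeasurable ?_
  filter_upwards [ae_restrict_mem measurableSet_Ioc] with t ht
  have hs := h.sigma_pos ht
  rw [Real.norm_of_nonneg (snr_pos hs).le, snr, Real.rpow_neg ht.1.le, ← Real.sqrt_eq_rpow,
    ← mul_inv, ← Real.sqrt_mul hc.le, div_eq_mul_inv]
  have h2 : Real.sqrt (c * t) ≤ sigma β t := by
    rw [Real.sqrt_le_left hs.le]; exact hct t ht
  have h3 : 0 < Real.sqrt (c * t) := Real.sqrt_pos.2 (mul_pos hc ht.1)
  calc _ ≤ 1 * (sigma β t)⁻¹ := by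
        gcongr; exact h.alpha_le_one ⟨ht.1.le, ht.2⟩
    _ ≤ _ := by rw [one_mul]; gcongr

theorem norm_noisy_le {d : ℕ} {t : ℝ} (ht : t ∈ Set.Ioc 0 T) (ζ e : Vec d) :
    1 + ‖alpha β t • ζ + sigma β t • e‖ ≤ (1 + ‖ζ‖) * (1 + ‖e‖) := by
  have h1 := norm_add_le (alpha β t • ζ) (sigma β t • e)
  rw [norm_smul, norm_smul, Real.norm_of_nonneg (alpha_pos β t).le,
    Real.norm_of_nonneg (h.sigma_pos ht).le] at h1
  have h2 := mul_le_mul_of_nonneg_right (h.alpha_le_one ⟨ht.1.le, ht.2⟩) (norm_nonneg ζ)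
  have h3 := mul_le_mul_of_nonneg_right (sigma_le_one β t) (norm_nonneg e)
  nlinarith [mul_nonneg (norm_nonneg ζ) (norm_nonneg e)]

end IsSchedule

/-! ### Growth of the prior score and of the Fisher divergence -/

/-- The score of the diffused prior has polynomial growth, uniformly in time. -/
def ScoreGrowth {d : ℕ} (β : ℝ → ℝ) (T : ℝ) (p₀ : Measure (Vec d)) (C : ℝ) (a : ℕ) : Prop :=
  ∀ t ∈ Set.Ioc 0 T, ∀ z, ‖score β t p₀ z‖ ≤ C * (1 + ‖z‖) ^ a

section growth
variable {d : ℕ} {β : ℝ → ℝ} {T : ℝ} (h : IsSchedule β T) {p₀ : Measure (Vec d)} {C : ℝ} {a : ℕ}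
  (hp : ScoreGrowth β T p₀ C a)
include h hp

theorem ScoreGrowth.nonneg : 0 ≤ C := by
  have := (norm_nonneg _).trans (hp T ⟨h.pos, le_refl T⟩ 0)
  simpa using this

theorem ScoreGrowth.noisy_le {t : ℝ} (ht : t ∈ Set.Ioc 0 T) (ζ e : Vec d) :
    ‖score β t p₀ (alpha β t • ζ + sigma β t • e)‖ ≤ C * (1 + ‖ζ‖) ^ a * (1 + ‖e‖) ^ a := by
  refine (hp t ht _).trans ?_
  rw [mul_assoc, ← mul_pow]
  have h0 := hp.nonneg h
  gcongr
  exact h.norm_noisy_le ht ζ e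

variable [IsProbabilityMeasure p₀]

/-- The posterior mean is σ_t times the score, and σ_t ≤ 1. Unlike `posterior_growth`, the bound
stays uniform as t tends to zero, when the amplitude is unbounded. -/
theorem ScoreGrowth.postMean_le {t : ℝ} (ht : t ∈ Set.Ioc 0 T) (ζ e : Vec d) :
    ‖postMean (recentered p₀ ζ) (snr β t) e‖ ≤ C * (1 + ‖ζ‖) ^ a * (1 + ‖e‖) ^ a := by
  have hs := h.sigma_pos ht
  have h1 := hp.noisy_le h ht ζ e
  have h2 : postMean (recentered p₀ ζ) (snr β t) e
      = sigma β t • score β t p₀ (alpha β t • ζ + sigma β t • e) := by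
    rw [score_noisy p₀ hs, smul_inv_smul₀ hs.ne']
  rw [h2, norm_smul, Real.norm_of_nonneg hs.le]
  calc _ ≤ 1 * ‖score β t p₀ (alpha β t • ζ + sigma β t • e)‖ := by
        gcongr; exact sigma_le_one β t
    _ ≤ _ := by rw [one_mul]; exact h1

/-- The mean of ‖e + g‖² is bounded uniformly in time by a Gaussian moment; the factor 1/t comes
only from σ_t⁻². -/
theorem ScoreGrowth.exists_fisherAt_le (ζ : Vec d) :
    ∃ M, 0 ≤ M ∧ ∀ t ∈ Set.Ioc 0 T, fisherAt β p₀ (Measure.dirac ζ) t ≤ M / t := by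
  obtain ⟨c, hc, hct⟩ := h.exists_mul_le_sigma_sq
  have hC := hp.nonneg h
  set D := 1 + C * (1 + ‖ζ‖) ^ a with hD
  set M := ∫ e : Vec d, D ^ 2 * (1 + ‖e‖) ^ (2 * (a + 1)) ∂(stdGaussian (Vec d)) with hM
  have hM0 : 0 ≤ M := integral_nonneg fun e => by positivity
  refine ⟨M / c, by positivity, fun t ht => ?_⟩
  have hs := h.sigma_pos ht
  have hle : ∫ e, ‖e + postMean (recentered p₀ ζ) (snr β t) e‖ ^ 2 ∂(stdGaussian (Vec d)) ≤ M := by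
    refine integral_mono (integrable_norm_add_postMean_sq _ _)
      ((integrable_one_add_norm_pow _).const_mul _) fun e => ?_
    have h1 := hp.postMean_le h ht ζ e
    have h2 : ‖e + postMean (recentered p₀ ζ) (snr β t) e‖ ≤ D * (1 + ‖e‖) ^ (a + 1) := by
      refine (norm_add_le _ _).trans ?_
      have h3 : (1 + ‖e‖) ^ a ≤ (1 + ‖e‖) ^ (a + 1) :=
        pow_le_pow_right₀ (by linarith [norm_nonneg e]) (by norm_num)
      have h4 : ‖e‖ ≤ (1 + ‖e‖) ^ (a + 1) := by
        have : 1 + ‖e‖ ≤ (1 + ‖e‖) ^ (a + 1) :=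
          le_self_pow₀ (by linarith [norm_nonneg e]) (by norm_num)
        linarith
      have h5 : C * (1 + ‖ζ‖) ^ a * (1 + ‖e‖) ^ a ≤ C * (1 + ‖ζ‖) ^ a * (1 + ‖e‖) ^ (a + 1) := by
        gcongr
      rw [hD]; linarith
    calc _ ≤ (D * (1 + ‖e‖) ^ (a + 1)) ^ 2 := by
          gcongr
      _ = _ := by ring
  rw [fisherAt_eq p₀ hs, div_div]
  have := hct t ht
  have hct0 := mul_pos hc ht.1
  rw [div_eq_inv_mul]
  gcongr

end growth

/-! ### KL dissipation and integration by parts in time -/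

/-- A `C¹` function vanishing at zero is bounded by a multiple of `t` on `[0, T]`, together with
a bound of its derivative. -/
theorem exists_abs_le_mul {ω : ℝ → ℝ} (hω : ContDiff ℝ 1 ω) (hω0 : ω 0 = 0) (T : ℝ) :
    ∃ B, 0 ≤ B ∧ ∀ t ∈ Set.Icc 0 T, |ω t| ≤ B * t ∧ |deriv ω t| ≤ B := by
  obtain ⟨B, hB⟩ := (isCompact_Icc (a := (0 : ℝ)) (b := T)).exists_bound_of_continuousOn
    (hω.continuous_deriv le_rfl).continuousOn
  refine ⟨max B 0, le_max_right _ _, fun t ht => ⟨?_, (hB t ht).trans (le_max_left _ _)⟩⟩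
  have h1 := (convex_Icc (0 : ℝ) T).norm_image_sub_le_of_norm_deriv_le (f := ω)
    (fun x _ => (hω.differentiable one_ne_zero).differentiableAt)
    (fun x hx => (hB x hx).trans (le_max_left B 0)) (Set.left_mem_Icc.2 (ht.1.trans ht.2)) ht
  rw [hω0, sub_zero, sub_zero, Real.norm_eq_abs, Real.norm_of_nonneg ht.1] at h1
  exact h1

section time
variable {d : ℕ} {β : ℝ → ℝ} {T : ℝ} (h : IsSchedule β T) {p₀ : Measure (Vec d)}
  [IsProbabilityMeasure p₀]
include h

/-- Dissipation of the KL divergence along the diffusion. -/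
theorem hasDerivAt_klAt (ζ : Vec d) {t : ℝ} (ht : t ∈ Set.Ioo 0 T) :
    HasDerivAt (klAt β p₀ (Measure.dirac ζ))
      (-(β t / 2 * fisherAt β p₀ (Measure.dirac ζ) t)) t := by
  have hs := h.sigma_pos ⟨ht.1, ht.2.le⟩
  have hκ := snr_pos hs
  have h1 := ((hasDerivAt_integral_log_evidence (recentered p₀ ζ) hκ).comp t
    (h.hasDerivAt_snr ht)).const_sub (-((d : ℝ) / 2))
  refine (h1.congr_deriv ?_).congr_of_eventuallyEq ?_
  · rw [fisherAt_eq p₀ hs]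
    field_simp
  · filter_upwards [Ioo_mem_nhds ht.1 ht.2] with u hu
    exact klAt_eq p₀ (h.sigma_pos ⟨hu.1, hu.2.le⟩) ζ

/-- The mean log-evidence is differentiable at every κ > 0, so continuity reaches the endpoint T,
where β is controlled from the left only. -/
theorem continuousOn_klAt (ζ : Vec d) :
    ContinuousOn (klAt β p₀ (Measure.dirac ζ)) (Set.Ioc 0 T) := by
  have h1 : ContinuousOn (fun κ => ∫ e, Real.log (evidence (recentered p₀ ζ) κ e)
      ∂(stdGaussian (Vec d))) (Set.Ioi 0) := fun κ hκ =>
    (hasDerivAt_integral_log_evidence (recentered p₀ ζ) hκ).continuousAt.continuousWithinAt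
  exact (continuousOn_const.sub (h1.comp h.continuousOn_snr fun t ht =>
    snr_pos (h.sigma_pos ht))).congr fun t ht => klAt_eq p₀ (h.sigma_pos ht) ζ

theorem aestronglyMeasurable_fisherAt (ζ : Vec d) :
    AEStronglyMeasurable (fisherAt β p₀ (Measure.dirac ζ)) (volume.restrict (Set.Ioc 0 T)) := by
  have hm : Measurable fun κ : ℝ => ∫ e, ‖e + postMean (recentered p₀ ζ) κ e‖ ^ 2
      ∂(stdGaussian (Vec d)) := by
    have : Measurable fun p : ℝ × Vec d => ‖p.2 + postMean (recentered p₀ ζ) p.1 p.2‖ ^ 2 :=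
      (measurable_snd.add (measurable_postMean _)).norm.pow_const 2
    exact this.stronglyMeasurable.integral_prod_right'.measurable
  refine ((((h.aemeasurable_sigma.pow_const 2).inv).mul
    (hm.comp_aemeasurable h.aemeasurable_snr)).aestronglyMeasurable).congr ?_
  filter_upwards [ae_restrict_mem measurableSet_Ioc] with t ht
  exact (fisherAt_eq p₀ (h.sigma_pos ht) ζ).symm

variable {C : ℝ} {a : ℕ} (hp : ScoreGrowth β T p₀ C a)
include hp

/-- The KL divergence blows up at most logarithmically at time zero. -/
theorem ScoreGrowth.exists_klAt_le (ζ : Vec d) :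
    ∃ A M, 0 ≤ M ∧ ∀ t ∈ Set.Ioc 0 T,
      klAt β p₀ (Measure.dirac ζ) t ≤ A - M * Real.log t := by
  obtain ⟨M, hM0, hM⟩ := hp.exists_fisherAt_le h ζ
  obtain ⟨b, B, hb, hB⟩ := h.exists_bounds
  have hB0 : 0 < B := (hb.trans_le (hB 0 ⟨le_refl 0, h.pos.le⟩).1).trans_le
    (hB 0 ⟨le_refl 0, h.pos.le⟩).2
  -- The derivative of KL_t is at least -(B/2)M/t, so adding (B/2)M log t makes the sum
  -- nondecreasing; comparison with its value at T gives the bound.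
  have hmono : MonotoneOn (fun t => klAt β p₀ (Measure.dirac ζ) t + B / 2 * M * Real.log t)
      (Set.Ioc 0 T) := by
    have hd : ∀ t ∈ Set.Ioo 0 T, HasDerivAt
        (fun t => klAt β p₀ (Measure.dirac ζ) t + B / 2 * M * Real.log t)
        (-(β t / 2 * fisherAt β p₀ (Measure.dirac ζ) t) + B / 2 * M * t⁻¹) t := fun t ht =>
      (hasDerivAt_klAt h ζ ht).add ((Real.hasDerivAt_log ht.1.ne').const_mul _)
    refine monotoneOn_of_deriv_nonneg (convex_Ioc 0 T) ?_ ?_ ?_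
    · refine (continuousOn_klAt h ζ).add (continuousOn_const.mul ?_)
      exact Real.continuousOn_log.mono fun t ht => ht.1.ne'
    · rw [interior_Ioc]
      exact fun t ht => (hd t ht).differentiableAt.differentiableWithinAt
    · rw [interior_Ioc]
      intro t ht
      rw [(hd t ht).deriv]
      have h1 := hM t ⟨ht.1, ht.2.le⟩
      have h2 := (hB t ⟨ht.1.le, ht.2.le⟩).2
      have h3 : 0 < β t := h.beta_pos t ⟨ht.1.le, ht.2.le⟩
      have h4 : β t / 2 * fisherAt β p₀ (Measure.dirac ζ) t ≤ B / 2 * (M / t) := by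
        have h5 : 0 ≤ M / t := div_nonneg hM0 ht.1.le
        calc _ ≤ β t / 2 * (M / t) := by gcongr
          _ ≤ _ := by gcongr
      rw [mul_assoc, ← div_eq_mul_inv]
      linarith
  refine ⟨klAt β p₀ (Measure.dirac ζ) T + B / 2 * M * Real.log T, B / 2 * M, by positivity,
    fun t ht => ?_⟩
  have := hmono ht ⟨h.pos, le_refl T⟩ ht.2
  simp only at this
  linarith

variable {ω : ℝ → ℝ} (hω : ContDiff ℝ 1 ω) (hω0 : ω 0 = 0)
include hω

theorem ScoreGrowth.intervalIntegrable_deriv_mul_klAt (ζ : Vec d) :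
    IntervalIntegrable (fun t => deriv ω t * klAt β p₀ (Measure.dirac ζ) t) volume 0 T := by
  obtain ⟨A, M, hM, hA⟩ := hp.exists_klAt_le h ζ
  refine IntervalIntegrable.continuousOn_mul ?_ (hω.continuous_deriv le_rfl).continuousOn
  have h1 : IntervalIntegrable (fun t => A - M * Real.log t) volume 0 T :=
    (intervalIntegrable_const).sub (intervalIntegral.intervalIntegrable_log'.const_mul M)
  rw [intervalIntegrable_iff_integrableOn_Ioc_of_le h.pos.le] at h1 ⊢
  refine h1.mono' ((continuousOn_klAt h ζ).aestronglyMeasurable measurableSet_Ioc) ?_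
  filter_upwards [ae_restrict_mem measurableSet_Ioc] with t ht
  rw [Real.norm_of_nonneg (klAt_nonneg _ _)]
  exact hA t ht

include hω0

/-- The bound |ω(t)| ≤ Wt compensates the M/t of the Fisher divergence, so the integrand is bounded.
-/
theorem ScoreGrowth.intervalIntegrable_fisherAt (ζ : Vec d) :
    IntervalIntegrable (fun t => β t / 2 * ω t * fisherAt β p₀ (Measure.dirac ζ) t)
      volume 0 T := by
  obtain ⟨M, hM0, hM⟩ := hp.exists_fisherAt_le h ζ
  obtain ⟨b, B, hb, hB⟩ := h.exists_bounds
  obtain ⟨W, hW0, hW⟩ := exists_abs_le_mul hω hω0 T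
  rw [intervalIntegrable_iff_integrableOn_Ioc_of_le h.pos.le]
  have hm : AEStronglyMeasurable (fun t => β t / 2 * ω t * fisherAt β p₀ (Measure.dirac ζ) t)
      (volume.restrict (Set.Ioc 0 T)) := by
    refine AEStronglyMeasurable.mul (AEStronglyMeasurable.mul ?_ ?_)
      (aestronglyMeasurable_fisherAt h ζ)
    · exact (((h.continuousOn.mono Set.Ioc_subset_Icc_self).div_const 2).aestronglyMeasurable
        measurableSet_Ioc)
    · exact hω.continuous.aestronglyMeasurable
  refine Integrable.mono' (g := fun _ => B / 2 * W * M) (integrable_const _) hm ?_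
  filter_upwards [ae_restrict_mem measurableSet_Ioc] with t ht
  have ht' : t ∈ Set.Icc 0 T := ⟨ht.1.le, ht.2⟩
  have hF0 : 0 ≤ fisherAt β p₀ (Measure.dirac ζ) t := integral_nonneg fun _ => by positivity
  have hb0 := h.beta_pos t ht'
  have hB0 := hb0.trans_le (hB t ht').2
  rw [norm_mul, norm_mul, Real.norm_of_nonneg hF0, Real.norm_of_nonneg (by positivity),
    Real.norm_eq_abs]
  have h1 := (hB t ht').2
  have h2 := (hW t ht').1
  have h3 := hM t ht
  have ht0 := ht.1
  calc _ ≤ B / 2 * (W * t) * (M / t) := by gcongr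
    _ = _ := by field_simp

theorem ScoreGrowth.tendsto_mul_klAt (ζ : Vec d) :
    Filter.Tendsto (fun t => ω t * klAt β p₀ (Measure.dirac ζ) t) (nhdsWithin 0 (Set.Ioi 0))
      (nhds 0) := by
  obtain ⟨A, M, hM, hA⟩ := hp.exists_klAt_le h ζ
  obtain ⟨W, hW0, hW⟩ := exists_abs_le_mul hω hω0 T
  have h1 : Filter.Tendsto (fun t : ℝ => W * (A * t - M * (Real.log t * t)))
      (nhdsWithin 0 (Set.Ioi 0)) (nhds 0) := by
    have ht : Filter.Tendsto (fun t : ℝ => t) (nhdsWithin 0 (Set.Ioi 0)) (nhds 0) :=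
      tendsto_nhdsWithin_of_tendsto_nhds Filter.tendsto_id
    have hl := tendsto_log_mul_rpow_nhdsGT_zero one_pos
    simp only [Real.rpow_one] at hl
    have := ((ht.const_mul A).sub (hl.const_mul M)).const_mul W
    simpa using this
  -- The product is at most Wt(A - M log t), and t log t tends to zero.
  refine squeeze_zero_norm' ?_ h1
  filter_upwards [Ioc_mem_nhdsGT h.pos] with t ht
  rw [norm_mul, Real.norm_of_nonneg (klAt_nonneg _ _), Real.norm_eq_abs]
  have ht0 := ht.1
  have h2 := (hW t ⟨ht.1.le, ht.2⟩).1
  calc _ ≤ (W * t) * (A - M * Real.log t) := by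
        gcongr
        · exact klAt_nonneg _ _
        · exact hA t ht
    _ = _ := by ring

/-- The score-matching regularizer as a weighted time integral of the KL divergence. -/
theorem ScoreGrowth.scoreMatching_eq (ζ : Vec d) :
    scoreMatching β ω T p₀ (Measure.dirac ζ) =
      (∫ t in (0 : ℝ)..T, deriv ω t * klAt β p₀ (Measure.dirac ζ) t)
        - ω T * klAt β p₀ (Measure.dirac ζ) T := by
  have i1 := hp.intervalIntegrable_deriv_mul_klAt h hω ζ
  have i2 := hp.intervalIntegrable_fisherAt h hω hω0 ζ
  have hT : Filter.Tendsto (fun t => ω t * klAt β p₀ (Measure.dirac ζ) t)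
      (nhdsWithin T (Set.Iio T)) (nhds (ω T * klAt β p₀ (Measure.dirac ζ) T)) := by
    have hc := (hω.continuous.continuousOn.mul (continuousOn_klAt h (p₀ := p₀) ζ)) T
      ⟨h.pos, le_refl T⟩
    refine hc.mono_left ?_
    rw [← nhdsWithin_Ioo_eq_nhdsLT h.pos]
    exact nhdsWithin_mono _ Set.Ioo_subset_Ioc_self
  -- The fundamental theorem with one-sided limits at both ends, since the dissipation identity is
  -- available only in the open interval.
  have key := intervalIntegral.integral_eq_sub_of_hasDerivAt_of_tendsto h.pos
    (f := fun t => ω t * klAt β p₀ (Measure.dirac ζ) t)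
    (f' := fun t => deriv ω t * klAt β p₀ (Measure.dirac ζ) t
      - β t / 2 * ω t * fisherAt β p₀ (Measure.dirac ζ) t)
    (fun t ht => by
      refine ((hω.differentiable one_ne_zero).differentiableAt.hasDerivAt.mul
        (hasDerivAt_klAt h ζ ht)).congr_deriv ?_
      ring)
    (i1.sub i2) (hp.tendsto_mul_klAt h hω hω0 ζ) hT
  rw [intervalIntegral.integral_sub i1 i2] at key
  rw [scoreMatching]
  linarith

end time

/-! ### Gradient of the uncoupled regularizer -/

/-- Differentiation of a gradient under the integral sign. -/
theorem hasGradientAt_integral_of_dominated {d : ℕ} {Ω : Type*} [MeasurableSpace Ω]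
    {μ : Measure Ω} {F : Vec d → Ω → ℝ} {F' : Vec d → Ω → Vec d} {x₀ : Vec d} {bound : Ω → ℝ}
    (hF : ∀ x, AEStronglyMeasurable (F x) μ) (hF0 : Integrable (F x₀) μ)
    (hF' : AEStronglyMeasurable (F' x₀) μ)
    (hb : ∀ᵐ ω ∂μ, ∀ x ∈ Metric.ball x₀ 1, ‖F' x ω‖ ≤ bound ω) (hbi : Integrable bound μ)
    (hd : ∀ᵐ ω ∂μ, ∀ x ∈ Metric.ball x₀ 1, HasGradientAt (fun x => F x ω) (F' x ω) x) :
    HasGradientAt (fun x => ∫ ω, F x ω ∂μ) (∫ ω, F' x₀ ω ∂μ) x₀ := by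
  have hint : Integrable (F' x₀) μ := hbi.mono' hF' (hb.mono fun ω h =>
    h x₀ (Metric.mem_ball_self one_pos))
  have hdual : Continuous fun v : Vec d => InnerProductSpace.toDual ℝ (Vec d) v :=
    (InnerProductSpace.toDual ℝ (Vec d)).continuous
  have h := hasFDerivAt_integral_of_dominated_of_fderiv_le (𝕜 := ℝ) (μ := μ) (F := F)
    (F' := fun x ω => InnerProductSpace.toDual ℝ (Vec d) (F' x ω)) (x₀ := x₀)
    (Metric.ball_mem_nhds x₀ one_pos) (Filter.Eventually.of_forall hF) hF0
    (hdual.comp_aestronglyMeasurable hF')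
    (hb.mono fun ω h x hx => by rw [LinearIsometryEquiv.norm_map]; exact h x hx) hbi
    (hd.mono fun ω h x hx => (h x hx).hasFDerivAt)
  rw [hasGradientAt_iff_hasFDerivAt]
  refine h.congr_fderiv ?_
  have hi : Integrable (fun ω => InnerProductSpace.toDual ℝ (Vec d) (F' x₀ ω)) μ :=
    hint.norm.mono' (hdual.comp_aestronglyMeasurable hF')
      (Filter.Eventually.of_forall fun ω => by rw [LinearIsometryEquiv.norm_map])
  ext w
  rw [ContinuousLinearMap.integral_apply hi, InnerProductSpace.toDual_apply_apply,
    real_inner_comm, ← integral_inner hint]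
  simp_rw [InnerProductSpace.toDual_apply_apply, real_inner_comm w]

section uniform

theorem uniformTime_eq {T : ℝ} :
    uniformTime T = (ENNReal.ofReal T)⁻¹ • volume.restrict (Set.Ioc 0 T) := by
  rw [uniformTime, ProbabilityTheory.cond, Real.volume_Icc, sub_zero, restrict_Ioc_eq_restrict_Icc]

theorem integral_uniformTime_prod {T : ℝ} (hT : 0 < T) {Ω E : Type*} [MeasurableSpace Ω]
    [NormedAddCommGroup E] [NormedSpace ℝ E] (π : Measure Ω) [SFinite π] (H : ℝ × Ω → E) :
    ∫ p, H p ∂((uniformTime T).prod π)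
      = T⁻¹ • ∫ p, H p ∂((volume.restrict (Set.Ioc 0 T)).prod π) := by
  rw [uniformTime_eq, Measure.prod_smul_left, integral_smul_measure, ENNReal.toReal_inv,
    ENNReal.toReal_ofReal hT.le]

theorem integrable_uniformTime_prod {T : ℝ} (hT : 0 < T) {Ω E : Type*} [MeasurableSpace Ω]
    [NormedAddCommGroup E] {π : Measure Ω} [SFinite π] {H : ℝ × Ω → E}
    (hH : Integrable H ((volume.restrict (Set.Ioc 0 T)).prod π)) :
    Integrable H ((uniformTime T).prod π) := by
  rw [uniformTime_eq, Measure.prod_smul_left]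
  exact hH.smul_measure (by simpa using hT)

end uniform

theorem lam_eq (β ω : ℝ → ℝ) (T σv ρ t : ℝ) :
    lam β ω T σv ρ t = 4 * T * σv ^ 2 * ρ ^ 2 * snr β t * deriv ω t := by
  rw [lam, snr]; ring

/-- Mean score of a noised particle, as a function of time. -/
theorem aestronglyMeasurable_integral_score {d : ℕ} {β : ℝ → ℝ} {T : ℝ} (h : IsSchedule β T)
    {p₀ : Measure (Vec d)} [IsProbabilityMeasure p₀] (ζ : Vec d) :
    AEStronglyMeasurable (fun t => ∫ e, -(alpha β t • score β t p₀
      (alpha β t • ζ + sigma β t • e)) ∂(stdGaussian (Vec d)))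
      (volume.restrict (Set.Ioc 0 T)) := by
  have hm : Measurable fun κ : ℝ => ∫ e, -(κ • postMean (recentered p₀ ζ) κ e)
      ∂(stdGaussian (Vec d)) := by
    have : Measurable fun p : ℝ × Vec d => -(p.1 • postMean (recentered p₀ ζ) p.1 p.2) :=
      (measurable_fst.smul (measurable_postMean _)).neg
    exact this.stronglyMeasurable.integral_prod_right'.measurable
  refine ((hm.comp_aemeasurable h.aemeasurable_snr).aestronglyMeasurable).congr ?_
  filter_upwards [ae_restrict_mem measurableSet_Ioc] with t ht
  refine integral_congr_ae (Filter.Eventually.of_forall fun e => ?_)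
  simp only [score_noisy p₀ (h.sigma_pos ht), smul_smul, snr, div_eq_mul_inv]

section single
variable {d : ℕ} {β : ℝ → ℝ} {T : ℝ} (h : IsSchedule β T) {p₀ : Measure (Vec d)}
  [IsProbabilityMeasure p₀] {C : ℝ} {a : ℕ} (hp : ScoreGrowth β T p₀ C a)
include h hp

theorem ScoreGrowth.integrable_score_noisy {t : ℝ} (ht : t ∈ Set.Ioc 0 T) (ζ : Vec d) :
    Integrable (fun e => score β t p₀ (alpha β t • ζ + sigma β t • e)) (stdGaussian (Vec d)) :=
  integrable_stdGaussian_of_norm_le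
    ((measurable_score p₀ (h.sigma_pos ht)).comp (by fun_prop)).aestronglyMeasurable
    (fun e => hp.noisy_le h ht ζ e)

/-- With the noise fixed, the transition density at its own sample does not depend on the particle;
only the negative log-density of the prior moves. -/
theorem ScoreGrowth.hasGradientAt_klAt {t : ℝ} (ht : t ∈ Set.Ioc 0 T) (ζ : Vec d) :
    HasGradientAt (fun ξ => klAt β p₀ (Measure.dirac ξ) t)
      (∫ e, -(alpha β t • score β t p₀ (alpha β t • ζ + sigma β t • e))
        ∂(stdGaussian (Vec d))) ζ := by
  have hs := h.sigma_pos ht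
  have hC := hp.nonneg h
  rw [funext (klAt_eq_integral p₀ hs)]
  refine hasGradientAt_integral_of_dominated
    (F' := fun ξ e => -(alpha β t • score β t p₀ (alpha β t • ξ + sigma β t • e)))
    (bound := fun e => C * (1 + (1 + ‖ζ‖)) ^ a * (1 + ‖e‖) ^ a)
    (fun ξ => (integrable_log_transitionDensity_sub p₀ hs ξ).aestronglyMeasurable)
    (integrable_log_transitionDensity_sub p₀ hs ζ)
    (((hp.integrable_score_noisy h ht ζ).smul (alpha β t)).neg.aestronglyMeasurable)
    (Filter.Eventually.of_forall fun e ξ hξ => ?_)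
    ((integrable_one_add_norm_pow a).const_mul _)
    (Filter.Eventually.of_forall fun e ξ _ => ?_)
  · rw [norm_neg, norm_smul, Real.norm_of_nonneg (alpha_pos β t).le]
    have h1 := hp.noisy_le h ht ξ e
    have h2 : ‖ξ‖ ≤ 1 + ‖ζ‖ := by
      have := norm_sub_norm_le ξ ζ
      have := mem_ball_iff_norm.1 hξ
      linarith
    calc _ ≤ 1 * (C * (1 + ‖ξ‖) ^ a * (1 + ‖e‖) ^ a) := by
          gcongr; exact h.alpha_le_one ⟨ht.1.le, ht.2⟩
      _ ≤ _ := by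
          rw [one_mul]
          gcongr
  · have h1 := (hasGradientAt_score p₀ hs (alpha β t • ξ + sigma β t • e)).hasFDerivAt
    have h2 : HasFDerivAt (fun ξ : Vec d => alpha β t • ξ + sigma β t • e)
        (alpha β t • ContinuousLinearMap.id ℝ (Vec d)) ξ :=
      ((hasFDerivAt_id (𝕜 := ℝ) ξ).fun_const_smul (alpha β t)).add_const _
    have h3 := (h1.comp ξ h2).const_sub
      (Real.log ((2 * Real.pi * sigma β t ^ 2) ^ (-(d : ℝ) / 2)) - ‖e‖ ^ 2 / 2)
    rw [hasGradientAt_iff_hasFDerivAt]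
    refine (h3.congr_fderiv ?_).congr_of_eventuallyEq (Filter.Eventually.of_forall fun y => ?_)
    · ext w
      simp
    · simp only [Function.comp_apply]
      rw [log_transitionDensity hs, add_sub_cancel_left, norm_smul, Real.norm_of_nonneg hs.le]
      congr 2
      field_simp

variable {ω : ℝ → ℝ} (hω : ContDiff ℝ 1 ω)
include hω

theorem ScoreGrowth.hasGradientAt_integral_klAt (ζ : Vec d) :
    HasGradientAt (fun ξ => ∫ t in (0 : ℝ)..T, deriv ω t * klAt β p₀ (Measure.dirac ξ) t)
      (∫ t in Set.Ioc 0 T, deriv ω t • ∫ e, -(alpha β t • score β t p₀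
        (alpha β t • ζ + sigma β t • e)) ∂(stdGaussian (Vec d))) ζ := by
  have hC := hp.nonneg h
  obtain ⟨B, hB⟩ := (isCompact_Icc (a := (0 : ℝ)) (b := T)).exists_bound_of_continuousOn
    (hω.continuous_deriv le_rfl).continuousOn
  simp_rw [intervalIntegral.integral_of_le h.pos.le]
  have hi := fun ξ => (intervalIntegrable_iff_integrableOn_Ioc_of_le h.pos.le).1
    (hp.intervalIntegrable_deriv_mul_klAt h hω ξ)
  refine hasGradientAt_integral_of_dominated
    (F' := fun ξ t => deriv ω t • ∫ e, -(alpha β t • score β t p₀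
        (alpha β t • ξ + sigma β t • e)) ∂(stdGaussian (Vec d)))
    -- Uniform in t, because the score growth is; `1 + (1 + ‖ζ‖)` covers all particles in the unit
    -- ball around ζ.
    (bound := fun _ => B * ∫ e : Vec d, C * (1 + (1 + ‖ζ‖)) ^ a * (1 + ‖e‖) ^ a
      ∂(stdGaussian (Vec d)))
    (fun ξ => (hi ξ).aestronglyMeasurable) (hi ζ)
    ((hω.continuous_deriv le_rfl).aestronglyMeasurable.smul
      (aestronglyMeasurable_integral_score h ζ)) ?_ (integrable_const _) ?_
  · filter_upwards [ae_restrict_mem measurableSet_Ioc] with t ht ξ hξ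
    rw [norm_smul]
    have h0 := (norm_nonneg _).trans (hB t ⟨ht.1.le, ht.2⟩)
    refine mul_le_mul (hB t ⟨ht.1.le, ht.2⟩) ?_ (norm_nonneg _) h0
    refine norm_integral_le_of_norm_le ((integrable_one_add_norm_pow a).const_mul _)
      (Filter.Eventually.of_forall fun e => ?_)
    rw [norm_neg, norm_smul, Real.norm_of_nonneg (alpha_pos β t).le]
    have h1 := hp.noisy_le h ht ξ e
    have h2 : ‖ξ‖ ≤ 1 + ‖ζ‖ := by
      have := norm_sub_norm_le ξ ζ
      have := mem_ball_iff_norm.1 hξ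
      linarith
    calc _ ≤ 1 * (C * (1 + ‖ξ‖) ^ a * (1 + ‖e‖) ^ a) := by
          gcongr; exact h.alpha_le_one ⟨ht.1.le, ht.2⟩
      _ ≤ _ := by
          rw [one_mul]
          gcongr
  · filter_upwards [ae_restrict_mem measurableSet_Ioc] with t ht ξ hξ
    have h1 := (hp.hasGradientAt_klAt h ht ξ).hasFDerivAt.const_mul (deriv ω t)
    rw [hasGradientAt_iff_hasFDerivAt]
    refine h1.congr_fderiv ?_
    simp

variable {eps : Vec d → ℝ → Vec d}
  (heps : ∀ t ∈ Set.Ioc 0 T, ∀ z, eps z t = -(sigma β t • score β t p₀ z))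
include heps

/-- The weight is a bounded function times the integrable signal-to-noise amplitude, and the
remaining factor has polynomial growth in the noise, uniformly in time; the bound is a product of
integrable functions. -/
theorem ScoreGrowth.integrable_denoise (σv ρ : ℝ) (ζ : Vec d) :
    Integrable (fun p : ℝ × Vec d => lam β ω T σv ρ p.1 •
      (eps (alpha β p.1 • ζ + sigma β p.1 • p.2) p.1 - p.2))
      ((volume.restrict (Set.Ioc 0 T)).prod (stdGaussian (Vec d))) := by
  have hC := hp.nonneg h
  obtain ⟨B, hB⟩ := (isCompact_Icc (a := (0 : ℝ)) (b := T)).exists_bound_of_continuousOn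
    (hω.continuous_deriv le_rfl).continuousOn
  set D := 1 + C * (1 + ‖ζ‖) ^ a with hD
  have hκ := (intervalIntegrable_iff_integrableOn_Ioc_of_le h.pos.le).1 h.intervalIntegrable_snr
  have hbi := ((hκ.const_mul (|4 * T * σv ^ 2 * ρ ^ 2| * B))).mul_prod
    (((integrable_one_add_norm_pow (d := d) (a + 1)).const_mul D))
  have hmem : ∀ᵐ p ∂((volume.restrict (Set.Ioc 0 T)).prod (stdGaussian (Vec d))),
      p.1 ∈ Set.Ioc 0 T :=
    Measure.quasiMeasurePreserving_fst.ae (ae_restrict_mem measurableSet_Ioc)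
  -- The predictor is prescribed only on (0,T], with no assumed measurability in time; on that set
  -- it is replaced by the jointly measurable posterior mean.
  have heq : ∀ p : ℝ × Vec d, p.1 ∈ Set.Ioc 0 T →
      lam β ω T σv ρ p.1 • (eps (alpha β p.1 • ζ + sigma β p.1 • p.2) p.1 - p.2)
      = (4 * T * σv ^ 2 * ρ ^ 2 * snr β p.1 * deriv ω p.1) •
        (-(postMean (recentered p₀ ζ) (snr β p.1) p.2) - p.2) := fun p hpm => by
    rw [lam_eq, heps _ hpm, score_noisy p₀ (h.sigma_pos hpm),
      smul_inv_smul₀ (h.sigma_pos hpm).ne']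
  have hκm : AEMeasurable (fun p : ℝ × Vec d => snr β p.1)
      ((volume.restrict (Set.Ioc 0 T)).prod (stdGaussian (Vec d))) := h.aemeasurable_snr.comp_fst
  have hgm : AEMeasurable (fun p : ℝ × Vec d => postMean (recentered p₀ ζ) (snr β p.1) p.2)
      ((volume.restrict (Set.Ioc 0 T)).prod (stdGaussian (Vec d))) := by
    have := (measurable_postMean (recentered p₀ ζ)).comp_aemeasurable
      (hκm.prodMk measurable_snd.aemeasurable)
    exact this
  have hm : AEStronglyMeasurable (fun p : ℝ × Vec d =>
      (4 * T * σv ^ 2 * ρ ^ 2 * snr β p.1 * deriv ω p.1) •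
        (-(postMean (recentered p₀ ζ) (snr β p.1) p.2) - p.2))
      ((volume.restrict (Set.Ioc 0 T)).prod (stdGaussian (Vec d))) := by
    have h1 : AEMeasurable (fun p : ℝ × Vec d =>
        -(postMean (recentered p₀ ζ) (snr β p.1) p.2) - p.2)
        ((volume.restrict (Set.Ioc 0 T)).prod (stdGaussian (Vec d))) :=
      hgm.fun_neg.fun_sub measurable_snd.aemeasurable
    have h2 : AEMeasurable (fun p : ℝ × Vec d => deriv ω p.1)
        ((volume.restrict (Set.Ioc 0 T)).prod (stdGaussian (Vec d))) :=
      ((hω.continuous_deriv le_rfl).measurable.comp measurable_fst).aemeasurable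
    exact (((hκm.const_mul _).mul h2).smul h1).aestronglyMeasurable
  refine hbi.mono' (hm.congr ?_) ?_
  · filter_upwards [hmem] with p hpm
    exact (heq p hpm).symm
  · filter_upwards [hmem] with p hpm
    rw [heq p hpm, norm_smul, norm_mul, norm_mul,
      Real.norm_of_nonneg (snr_pos (h.sigma_pos hpm)).le, Real.norm_eq_abs (4 * T * σv ^ 2 * ρ ^ 2)]
    have h1 := hp.postMean_le h hpm ζ p.2
    have h2 := hB p.1 ⟨hpm.1.le, hpm.2⟩
    have h3 := (snr_pos (h.sigma_pos hpm)).le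
    have hB0 : 0 ≤ B := (norm_nonneg _).trans h2
    have h4 : ‖-(postMean (recentered p₀ ζ) (snr β p.1) p.2) - p.2‖
        ≤ D * (1 + ‖p.2‖) ^ (a + 1) := by
      refine (norm_sub_le _ _).trans ?_
      rw [norm_neg]
      have h3 : (1 + ‖p.2‖) ^ a ≤ (1 + ‖p.2‖) ^ (a + 1) :=
        pow_le_pow_right₀ (by linarith [norm_nonneg p.2]) (by norm_num)
      have h4 : ‖p.2‖ ≤ (1 + ‖p.2‖) ^ (a + 1) := by
        have : 1 + ‖p.2‖ ≤ (1 + ‖p.2‖) ^ (a + 1) :=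
          le_self_pow₀ (by linarith [norm_nonneg p.2]) (by norm_num)
        linarith
      have h5 : C * (1 + ‖ζ‖) ^ a * (1 + ‖p.2‖) ^ a
          ≤ C * (1 + ‖ζ‖) ^ a * (1 + ‖p.2‖) ^ (a + 1) := by gcongr
      rw [hD]; linarith
    calc _ ≤ |4 * T * σv ^ 2 * ρ ^ 2| * snr β p.1 * B * (D * (1 + ‖p.2‖) ^ (a + 1)) := by gcongr
      _ = _ := by ring

/-- The noise term integrates to zero. The factor T of the weight cancels the uniform density, and
its 1/σ_t cancels the σ_t of the predictor. -/
theorem ScoreGrowth.integral_denoise (σv ρ : ℝ) (ζ : Vec d) :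
    ∫ p : ℝ × Vec d, lam β ω T σv ρ p.1 •
        (eps (alpha β p.1 • ζ + sigma β p.1 • p.2) p.1 - p.2)
        ∂((uniformTime T).prod (stdGaussian (Vec d)))
      = (4 * σv ^ 2 * ρ ^ 2) • ∫ t in Set.Ioc 0 T, deriv ω t • ∫ e, -(alpha β t • score β t p₀
        (alpha β t • ζ + sigma β t • e)) ∂(stdGaussian (Vec d)) := by
  rw [integral_uniformTime_prod h.pos, integral_prod _ (hp.integrable_denoise h hω heps σv ρ ζ),
    ← integral_smul, ← integral_smul]
  refine setIntegral_congr_fun measurableSet_Ioc fun t ht => ?_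
  have hs := h.sigma_pos ht
  have hi := hp.integrable_score_noisy h ht ζ
  simp only [heps t ht]
  have hi2 : Integrable (fun e => -(sigma β t • score β t p₀ (alpha β t • ζ + sigma β t • e)))
      (stdGaussian (Vec d)) := (hi.smul (sigma β t)).neg
  rw [integral_smul, integral_sub hi2 IsGaussian.integrable_fun_id, integral_id_stdGaussian,
    integral_neg, integral_neg, integral_smul, integral_smul, sub_zero, smul_neg, smul_neg, smul_neg,
    smul_neg, smul_smul, smul_smul, smul_smul, smul_smul]
  congr 2
  rw [lam]
  have := h.pos
  field_simp

end single

/-! ### Kernels, coupling factor and normalizing constant -/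

/-- A nonnegative bounded `C¹` kernel, bounded below on the diagonal, with derivative of
polynomial growth. -/
structure IsKernel {d : ℕ} (k : Vec d → Vec d → ℝ) (c K C : ℝ) (a : ℕ) : Prop where
  contDiff : ContDiff ℝ 1 fun p : Vec d × Vec d => k p.1 p.2
  nonneg : ∀ v w, 0 ≤ k v w
  le : ∀ v w, k v w ≤ K
  pos : 0 < c
  diag : ∀ v, c ≤ k v v
  grad : ∀ p : Vec d × Vec d,
    ‖fderiv ℝ (fun p : Vec d × Vec d => k p.1 p.2) p‖ ≤ C * (1 + ‖p‖) ^ a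

/-- Logarithm of the interaction of particle `i` with the ensemble. -/
def potential {d N : ℕ} (k : Vec d → Vec d → ℝ) (i : Fin N) (w : Fin N → Vec d) : ℝ :=
  Real.log (interaction k i w)

/-- Gradient of the potential in the position of particle `i`. -/
def potentialGrad {d N : ℕ} (k : Vec d → Vec d → ℝ) (i : Fin N) (w : Fin N → Vec d) : Vec d :=
  (InnerProductSpace.toDual ℝ (Vec d)).symm
    ((fderiv ℝ (potential k i) w).comp (ContinuousLinearMap.single ℝ (fun _ : Fin N => Vec d) i))

theorem integrable_prod_transitionDensity {d N : ℕ} {β : ℝ → ℝ} {t : ℝ} (hs : 0 < sigma β t)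
    (z₀ : Fin N → Vec d) :
    Integrable fun w : Fin N → Vec d => ∏ l, transitionDensity β t (z₀ l) (w l) :=
  Integrable.fintype_prod (f := fun l => transitionDensity β t (z₀ l))
    fun _ => integrable_gaussianDensity _ hs

namespace IsKernel
variable {d N : ℕ} {k : Vec d → Vec d → ℝ} {c K C : ℝ} {a : ℕ} (hk : IsKernel k c K C a)
include hk

theorem le_interaction (i : Fin N) (w : Fin N → Vec d) : c ≤ interaction k i w :=
  (hk.diag (w i)).trans (Finset.single_le_sum (f := fun j => k (w i) (w j))
    (fun _ _ => hk.nonneg _ _) (Finset.mem_univ i))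

theorem interaction_pos (i : Fin N) (w : Fin N → Vec d) : 0 < interaction k i w :=
  hk.pos.trans_le (hk.le_interaction i w)

theorem interaction_le (i : Fin N) (w : Fin N → Vec d) : interaction k i w ≤ N * K := by
  have := Finset.sum_le_card_nsmul Finset.univ (fun j => k (w i) (w j)) K fun _ _ => hk.le _ _
  simpa [interaction] using this

theorem const_nonneg : 0 ≤ C := by
  have := (norm_nonneg _).trans (hk.grad 0)
  simpa using this

theorem contDiff_interaction (i : Fin N) : ContDiff ℝ 1 (interaction (N := N) k i) := by
  unfold interaction
  refine ContDiff.sum fun j _ => ?_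
  exact hk.contDiff.comp (f := fun w : Fin N → Vec d => (w i, w j)) (by fun_prop)

theorem contDiff_potential (i : Fin N) : ContDiff ℝ 1 (potential (N := N) k i) :=
  (hk.contDiff_interaction i).log fun w => (hk.interaction_pos i w).ne'

theorem norm_fderiv_interaction_le (i : Fin N) (w : Fin N → Vec d) :
    ‖fderiv ℝ (interaction k i) w‖ ≤ N * (C * (1 + ‖w‖) ^ a) := by
  have hj : ∀ j, HasFDerivAt (fun w : Fin N → Vec d => k (w i) (w j))
      ((fderiv ℝ (fun p : Vec d × Vec d => k p.1 p.2) (w i, w j)).comp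
        ((ContinuousLinearMap.proj i).prod (ContinuousLinearMap.proj j))) w := fun j => by
    have h1 := ((hk.contDiff.differentiable one_ne_zero).differentiableAt
      (x := (w i, w j))).hasFDerivAt
    have h2 : HasFDerivAt (fun w : Fin N → Vec d => (w i, w j))
        ((ContinuousLinearMap.proj (R := ℝ) (φ := fun _ : Fin N => Vec d) i).prod
          (ContinuousLinearMap.proj j)) w :=
      (hasFDerivAt_apply i w).prodMk (hasFDerivAt_apply j w)
    exact h1.comp w h2
  have hsum : HasFDerivAt (interaction k i) _ w := HasFDerivAt.fun_sum fun j _ => hj j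
  rw [hsum.fderiv]
  have hb : ∀ j ∈ Finset.univ, ‖(fderiv ℝ (fun p : Vec d × Vec d => k p.1 p.2) (w i, w j)).comp
      ((ContinuousLinearMap.proj (R := ℝ) (φ := fun _ : Fin N => Vec d) i).prod
        (ContinuousLinearMap.proj j))‖ ≤ C * (1 + ‖w‖) ^ a := fun j _ => by
    refine (ContinuousLinearMap.opNorm_comp_le _ _).trans ?_
    have h1 : ‖(ContinuousLinearMap.proj (R := ℝ) (φ := fun _ : Fin N => Vec d) i).prod
        (ContinuousLinearMap.proj j)‖ ≤ 1 := by
      refine ContinuousLinearMap.opNorm_le_bound _ zero_le_one fun v => ?_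
      rw [one_mul]
      exact max_le (norm_le_pi_norm v i) (norm_le_pi_norm v j)
    have h2 : ‖(w i, w j)‖ ≤ ‖w‖ := max_le (norm_le_pi_norm w i) (norm_le_pi_norm w j)
    have h3 := hk.grad (w i, w j)
    have h4 := hk.const_nonneg
    calc _ ≤ C * (1 + ‖(w i, w j)‖) ^ a * 1 := by gcongr
      _ ≤ _ := by rw [mul_one]; gcongr
  refine (norm_sum_le_of_le _ hb).trans ?_
  simp

theorem norm_potentialGrad_le (i : Fin N) (w : Fin N → Vec d) :
    ‖potentialGrad k i w‖ ≤ N * C / c * (1 + ‖w‖) ^ a := by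
  have h1 : HasFDerivAt (potential k i) _ w :=
    (((hk.contDiff_interaction i).differentiable one_ne_zero).differentiableAt
      (x := w)).hasFDerivAt.log (hk.interaction_pos i w).ne'
  rw [potentialGrad, LinearIsometryEquiv.norm_map, h1.fderiv]
  refine (ContinuousLinearMap.opNorm_comp_le _ _).trans ?_
  have h2 : ‖ContinuousLinearMap.single ℝ (fun _ : Fin N => Vec d) i‖ ≤ 1 := by
    refine ContinuousLinearMap.opNorm_le_bound _ zero_le_one fun v => ?_
    rw [one_mul, ContinuousLinearMap.single_apply, Pi.norm_single]
  have h3 := hk.norm_fderiv_interaction_le i w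
  have h4 := hk.le_interaction i w
  have h5 := hk.pos
  have h6 := hk.const_nonneg
  rw [norm_smul, norm_inv, Real.norm_of_nonneg (hk.interaction_pos i w).le]
  calc _ ≤ c⁻¹ * (N * (C * (1 + ‖w‖) ^ a)) * 1 := by gcongr
    _ = _ := by ring

theorem continuous_potentialGrad (i : Fin N) : Continuous (potentialGrad (N := N) k i) := by
  unfold potentialGrad
  have h1 := (hk.contDiff_potential i).continuous_fderiv one_ne_zero
  exact (InnerProductSpace.toDual ℝ (Vec d)).symm.continuous.comp (h1.clm_comp continuous_const)

theorem hasGradientAt_potential_update (i : Fin N) (w : Fin N → Vec d) (y : Vec d) :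
    HasGradientAt (fun y => potential k i (Function.update w i y))
      (potentialGrad k i (Function.update w i y)) y := by
  have h1 := (((hk.contDiff_potential i).differentiable one_ne_zero).differentiableAt
    (x := Function.update w i y)).hasFDerivAt
  have h2 : HasFDerivAt (fun y => Function.update w i y)
      (ContinuousLinearMap.single ℝ (fun _ : Fin N => Vec d) i) y := by
    refine (hasFDerivAt_update w y).congr_fderiv ?_
    ext v j
    by_cases hj : j = i
    · subst hj; simp
    · simp [hj]
  rw [hasGradientAt_iff_hasFDerivAt, potentialGrad, LinearIsometryEquiv.apply_symm_apply]
  exact h1.comp y h2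

theorem repulsion_eq (β : ℝ → ℝ) (γ t : ℝ) (i : Fin N) (w : Fin N → Vec d) :
    repulsion β k γ t i w = (γ * sigma β t) • potentialGrad k i w := by
  have h := hk.hasGradientAt_potential_update i w (w i)
  rw [Function.update_eq_self] at h
  have h1 := h.hasFDerivAt.const_mul (γ * sigma β t)
  refine HasGradientAt.gradient ?_
  rw [hasGradientAt_iff_hasFDerivAt]
  refine h1.congr_fderiv ?_
  simp

theorem log_coupling (γ : ℝ) (i : Fin N) (w : Fin N → Vec d) :
    Real.log (coupling k γ i w) = -γ * potential k i w := by
  rw [coupling, Real.log_rpow (hk.interaction_pos i w), potential]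

theorem coupling_pos (γ : ℝ) (i : Fin N) (w : Fin N → Vec d) : 0 < coupling k γ i w :=
  Real.rpow_pos_of_pos (hk.interaction_pos i w) _

theorem continuous_coupling (γ : ℝ) (i : Fin N) : Continuous (coupling (N := N) k γ i) :=
  (hk.contDiff_interaction i).continuous.rpow_const fun w => Or.inl (hk.interaction_pos i w).ne'

/-- The coupling factor is bounded above and away from zero. -/
theorem exists_abs_log_coupling_le (γ : ℝ) (i : Fin N) :
    ∃ L, 0 ≤ L ∧ ∀ w, |Real.log (coupling k γ i w)| ≤ L := by
  refine ⟨|γ| * (|Real.log c| + |Real.log (N * K)|), by positivity, fun w => ?_⟩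
  rw [hk.log_coupling, abs_mul, abs_neg]
  gcongr
  have h1 := Real.log_le_log hk.pos (hk.le_interaction i w)
  have h2 := Real.log_le_log (hk.interaction_pos i w) (hk.interaction_le i w)
  rw [potential, abs_le]
  constructor
  · linarith [neg_abs_le (Real.log c), abs_nonneg (Real.log (N * K))]
  · linarith [le_abs_self (Real.log (N * K)), abs_nonneg (Real.log c)]

section normalizer
variable {β : ℝ → ℝ} {t : ℝ} (hs : 0 < sigma β t) (γ : ℝ) (i : Fin N) (z₀ : Fin N → Vec d)
include hs

theorem integrable_repulsiveUnnormalized :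
    Integrable (repulsiveUnnormalized β k γ i z₀ t) := by
  obtain ⟨L, hL0, hL⟩ := hk.exists_abs_log_coupling_le γ i
  refine (integrable_prod_transitionDensity hs z₀).bdd_mul
    (hk.continuous_coupling γ i).aestronglyMeasurable (c := Real.exp L)
    (Filter.Eventually.of_forall fun w => ?_)
  rw [Real.norm_of_nonneg (hk.coupling_pos γ i w).le, ← Real.log_le_iff_le_exp (hk.coupling_pos γ i w)]
  exact (abs_le.1 (hL w)).2

theorem repulsiveUnnormalized_pos (w : Fin N → Vec d) :
    0 < repulsiveUnnormalized β k γ i z₀ t w :=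
  mul_pos (hk.coupling_pos γ i w) (Finset.prod_pos fun _ _ => transitionDensity_pos hs _ _)

theorem normalizer_mem {L : ℝ} (hL : ∀ w, |Real.log (coupling k γ i w)| ≤ L) :
    normalizer β k γ i z₀ t ∈ Set.Icc (Real.exp (-L)) (Real.exp L) := by
  have h1 : ∫ w : Fin N → Vec d, ∏ l, transitionDensity β t (z₀ l) (w l) = 1 :=
    integral_gaussianDensity_pi (fun l => alpha β t • z₀ l) hs
  have hi := integrable_prod_transitionDensity hs z₀
  have hq : ∀ w : Fin N → Vec d, 0 ≤ ∏ l, transitionDensity β t (z₀ l) (w l) := fun w =>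
    Finset.prod_nonneg fun l _ => (transitionDensity_pos hs _ _).le
  have hR := fun w => hk.coupling_pos γ i w
  constructor
  · have := integral_mono (hi.const_mul (Real.exp (-L)))
      (hk.integrable_repulsiveUnnormalized hs γ i z₀) fun w => mul_le_mul_of_nonneg_right
        ((Real.le_log_iff_exp_le (hR w)).1 (abs_le.1 (hL w)).1) (hq w)
    rwa [integral_const_mul, h1, mul_one] at this
  · have := integral_mono (hk.integrable_repulsiveUnnormalized hs γ i z₀)
      (hi.const_mul (Real.exp L)) fun w => mul_le_mul_of_nonneg_right
        ((Real.log_le_iff_le_exp (hR w)).1 (abs_le.1 (hL w)).2) (hq w)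
    rwa [integral_const_mul, h1, mul_one] at this

theorem normalizer_pos : 0 < normalizer β k γ i z₀ t := by
  obtain ⟨L, -, hL⟩ := hk.exists_abs_log_coupling_le γ i
  exact (Real.exp_pos _).trans_le (hk.normalizer_mem hs γ i z₀ hL).1

theorem repulsiveDensity_pos (zc w : Fin N → Vec d) : 0 < repulsiveDensity β k γ i zc z₀ t w :=
  mul_pos (inv_pos.2 (hk.normalizer_pos hs γ i zc)) (hk.repulsiveUnnormalized_pos hs γ i z₀ w)

theorem integral_repulsiveDensity : ∫ w, repulsiveDensity β k γ i z₀ z₀ t w = 1 := by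
  unfold repulsiveDensity
  rw [integral_const_mul]
  exact inv_mul_cancel₀ (hk.normalizer_pos hs γ i z₀).ne'

end normalizer

theorem aemeasurable_normalizer {β : ℝ → ℝ} {T : ℝ} (h : IsSchedule β T) (γ : ℝ) (i : Fin N)
    (z₀ : Fin N → Vec d) :
    AEMeasurable (fun t => normalizer β k γ i z₀ t) (volume.restrict (Set.Ioc 0 T)) := by
  have hm : Measurable fun q : ℝ × ℝ => ∫ w : Fin N → Vec d,
      coupling k γ i w * ∏ l, gaussianDensity (q.1 • z₀ l) q.2 (w l) := by
    have : Measurable fun p : (ℝ × ℝ) × (Fin N → Vec d) =>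
        coupling k γ i p.2 * ∏ l, gaussianDensity (p.1.1 • z₀ l) p.1.2 (p.2 l) := by
      refine ((hk.continuous_coupling γ i).measurable.comp measurable_snd).mul
        (Finset.measurable_fun_prod _ fun l _ => ?_)
      have hl : Measurable fun p : (ℝ × ℝ) × (Fin N → Vec d) =>
          (p.1.1 • z₀ l, p.1.2, p.2 l) := by fun_prop
      have := (measurable_gaussianDensity d).comp hl
      exact this
    exact this.stronglyMeasurable.integral_prod_right'.measurable
  have := hm.comp_aemeasurable (h.aemeasurable_alpha.prodMk h.aemeasurable_sigma)
  exact this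

end IsKernel

/-! ### Correlated noises, and the log-ratio of the ensemble -/

section noise
variable {d N : ℕ} {π : Measure (Fin N → Vec d)}
  (hπ : ∀ l, π.map (fun ε => ε l) = stdGaussian (Vec d))
include hπ

theorem integrable_comp_eval {F : Type*} [NormedAddCommGroup F] {g : Vec d → F}
    (hg : Integrable g (stdGaussian (Vec d))) (l : Fin N) : Integrable (fun ε => g (ε l)) π := by
  rw [← hπ l] at hg
  exact hg.comp_measurable (measurable_pi_apply l)

theorem integral_comp_eval {F : Type*} [NormedAddCommGroup F] [NormedSpace ℝ F] {g : Vec d → F}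
    (hg : AEStronglyMeasurable g (stdGaussian (Vec d))) (l : Fin N) :
    ∫ ε, g (ε l) ∂π = ∫ e, g e ∂(stdGaussian (Vec d)) := by
  rw [← hπ l] at hg ⊢
  rw [integral_map (measurable_pi_apply l).aemeasurable hg]

/-- The joint law is arbitrary, so only marginal moments are available: the supremum norm is
attained at some coordinate, and the sum over coordinates dominates. The index i ensures that the
ensemble is nonempty. -/
theorem integrable_one_add_norm_pow_pi (i : Fin N) (n : ℕ) :
    Integrable (fun ε : Fin N → Vec d => (1 + ‖ε‖) ^ n) π := by
  have h1 : Integrable (fun ε : Fin N → Vec d => ∑ l, (1 + ‖ε l‖) ^ n) π :=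
    integrable_finsetSum _ fun l _ => integrable_comp_eval hπ (integrable_one_add_norm_pow n) l
  refine h1.mono' (by fun_prop) (Filter.Eventually.of_forall fun ε => ?_)
  have : Nonempty (Fin N) := ⟨i⟩
  obtain ⟨l, hl⟩ := Finite.exists_max fun l => ‖ε l‖
  have h2 : ‖ε‖ ≤ ‖ε l‖ := (pi_norm_le_iff_of_nonneg (norm_nonneg _)).2 hl
  rw [Real.norm_of_nonneg (by positivity)]
  calc (1 + ‖ε‖) ^ n ≤ (1 + ‖ε l‖) ^ n := by gcongr
    _ ≤ _ := Finset.single_le_sum (f := fun l => (1 + ‖ε l‖) ^ n) (fun _ _ => by positivity)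
      (Finset.mem_univ l)

end noise

theorem noisy_update {d N : ℕ} (β : ℝ → ℝ) (t : ℝ) (z ε : Fin N → Vec d) (i : Fin N) (ζ : Vec d) :
    noisy β t (Function.update z i ζ) ε
      = Function.update (noisy β t z ε) i (alpha β t • ζ + sigma β t • ε i) := by
  funext l
  by_cases hl : l = i
  · subst hl; simp [noisy]
  · simp [noisy, hl]

theorem continuous_noisy {d N : ℕ} (β : ℝ → ℝ) (t : ℝ) (z : Fin N → Vec d) :
    Continuous (noisy β t z) := by
  unfold noisy; fun_prop

theorem IsSchedule.norm_noisy_pi_le {d N : ℕ} {β : ℝ → ℝ} {T : ℝ} (h : IsSchedule β T) {t : ℝ}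
    (ht : t ∈ Set.Ioc 0 T) (z ε : Fin N → Vec d) :
    1 + ‖noisy β t z ε‖ ≤ (1 + ‖z‖) * (1 + ‖ε‖) := by
  have hb : 0 ≤ (1 + ‖z‖) * (1 + ‖ε‖) - 1 := by
    nlinarith [norm_nonneg z, norm_nonneg ε, mul_nonneg (norm_nonneg z) (norm_nonneg ε)]
  have := (pi_norm_le_iff_of_nonneg hb (x := noisy β t z ε)).2 fun l => by
    have h1 := h.norm_noisy_le ht (z l) (ε l)
    have h2 : (1 + ‖z l‖) * (1 + ‖ε l‖) ≤ (1 + ‖z‖) * (1 + ‖ε‖) := by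
      gcongr
      · exact norm_le_pi_norm z l
      · exact norm_le_pi_norm ε l
    change ‖alpha β t • z l + sigma β t • ε l‖ ≤ _
    linarith
  linarith

/-- Two centres are needed because a frozen Gaussian at z₀ is evaluated at samples of a moving
particle ζ. Changing the centre alters the log-density by a difference of quadratics in the noise.
-/
theorem integrable_log_ratio {d : ℕ} {β : ℝ → ℝ} {t : ℝ} (hs : 0 < sigma β t)
    (p₀ : Measure (Vec d)) [IsProbabilityMeasure p₀] (z₀ ζ : Vec d) :
    Integrable (fun e => Real.log (transitionDensity β t z₀ (alpha β t • ζ + sigma β t • e))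
      - Real.log (forwardDensity β t p₀ (alpha β t • ζ + sigma β t • e)))
      (stdGaussian (Vec d)) := by
  have h1 := integrable_log_transitionDensity_sub p₀ hs ζ
  have h2 : ∀ v : Vec d, Integrable (fun e : Vec d => ‖sigma β t • e + v‖ ^ 2 / (2 * sigma β t ^ 2))
      (stdGaussian (Vec d)) := fun v => by
    refine Integrable.div_const ?_ _
    refine integrable_stdGaussian_of_norm_le (by fun_prop) (C := (1 + ‖v‖) ^ 2) (n := 2)
      fun e => ?_
    rw [norm_pow, norm_norm, ← mul_pow]
    have h3 := norm_add_le (sigma β t • e) v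
    rw [norm_smul, Real.norm_of_nonneg hs.le] at h3
    have h4 := mul_le_mul_of_nonneg_right (sigma_le_one β t) (norm_nonneg e)
    have h5 := mul_nonneg (norm_nonneg v) (norm_nonneg e)
    gcongr
    nlinarith [norm_nonneg v]
  refine ((h1.add (h2 0)).sub (h2 (alpha β t • ζ - alpha β t • z₀))).congr
    (Filter.Eventually.of_forall fun e => ?_)
  simp only [Pi.add_apply, Pi.sub_apply]
  rw [log_transitionDensity hs, log_transitionDensity hs, add_sub_cancel_left, add_zero,
    show alpha β t • ζ + sigma β t • e - alpha β t • z₀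
      = sigma β t • e + (alpha β t • ζ - alpha β t • z₀) by abel]
  ring

section logRatio
variable {d N : ℕ} {k : Vec d → Vec d → ℝ} {c K C : ℝ} {a : ℕ} (hk : IsKernel k c K C a)
  {β : ℝ → ℝ} {t : ℝ} (hs : 0 < sigma β t) (p₀ : Measure (Vec d)) [IsProbabilityMeasure p₀]
  (γ : ℝ) (i : Fin N)
include hk hs

theorem IsKernel.logRatio_eq (zc z₀ z ε : Fin N → Vec d) :
    logRatio β p₀ (repulsiveDensity β k γ i zc z₀ t) t z ε
      = Real.log (coupling k γ i (noisy β t z ε) / normalizer β k γ i zc t)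
        + ∑ l, (Real.log (transitionDensity β t (z₀ l) (noisy β t z ε l))
          - Real.log (forwardDensity β t p₀ (noisy β t z ε l))) := by
  have h1 := hk.normalizer_pos hs γ i zc
  have h2 := hk.coupling_pos γ i (noisy β t z ε)
  have h3 : ∀ l, 0 < transitionDensity β t (z₀ l) (noisy β t z ε l) := fun l =>
    transitionDensity_pos hs _ _
  have h4 : ∀ l, 0 < forwardDensity β t p₀ (noisy β t z ε l) := fun l =>
    forwardDensity_pos p₀ hs _
  rw [logRatio, repulsiveDensity, repulsiveUnnormalized, ← mul_assoc, mul_div_assoc,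
    ← div_eq_inv_mul, ← Finset.prod_div_distrib, Real.log_mul (by positivity)
    (Finset.prod_pos fun l _ => div_pos (h3 l) (h4 l)).ne',
    Real.log_prod fun l _ => (div_pos (h3 l) (h4 l)).ne']
  congr 1
  exact Finset.sum_congr rfl fun l _ => Real.log_div (h3 l).ne' (h4 l).ne'

theorem IsKernel.abs_log_coupling_div_le {L : ℝ} (hL : ∀ w, |Real.log (coupling k γ i w)| ≤ L)
    (zc w : Fin N → Vec d) :
    |Real.log (coupling k γ i w / normalizer β k γ i zc t)| ≤ L + L := by
  have h1 := hk.normalizer_pos hs γ i zc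
  have h2 := hk.normalizer_mem hs γ i zc hL
  rw [Real.log_div (hk.coupling_pos γ i w).ne' h1.ne']
  refine (abs_sub _ _).trans (add_le_add (hL w) (abs_le.2 ⟨?_, ?_⟩))
  · exact (Real.le_log_iff_exp_le h1).2 h2.1
  · exact (Real.log_le_iff_le_exp h1).2 h2.2

variable {π : Measure (Fin N → Vec d)} [IsProbabilityMeasure π]

theorem IsKernel.integrable_log_coupling_div (zc z : Fin N → Vec d) :
    Integrable (fun ε => Real.log (coupling k γ i (noisy β t z ε) / normalizer β k γ i zc t)) π := by
  obtain ⟨L, -, hL⟩ := hk.exists_abs_log_coupling_le γ i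
  have hm : Measurable fun ε : Fin N → Vec d =>
      Real.log (coupling k γ i (noisy β t z ε) / normalizer β k γ i zc t) :=
    (((hk.continuous_coupling γ i).comp (continuous_noisy β t z)).measurable.div_const _).log
  exact Integrable.of_bound hm.aestronglyMeasurable (L + L)
    (Filter.Eventually.of_forall fun ε => hk.abs_log_coupling_div_le hs γ i hL zc _)

variable (hπ : ∀ l, π.map (fun ε => ε l) = stdGaussian (Vec d))
include hπ

theorem IsKernel.integrable_logRatio (zc z₀ z : Fin N → Vec d) :
    Integrable (logRatio β p₀ (repulsiveDensity β k γ i zc z₀ t) t z) π := by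
  rw [funext (hk.logRatio_eq hs p₀ γ i zc z₀ z)]
  exact (hk.integrable_log_coupling_div hs γ i zc z).add (integrable_finsetSum _ fun l _ =>
    integrable_comp_eval hπ (integrable_log_ratio hs p₀ (z₀ l) (z l)) l)

/-- Each summand of the log-ratio depends on one noise only, so its mean sees just a Gaussian
marginal and equals a KL divergence; correlations enter the coupling term alone. -/
theorem IsKernel.integral_logRatio (zc z : Fin N → Vec d) :
    ∫ ε, logRatio β p₀ (repulsiveDensity β k γ i zc z t) t z ε ∂π
      = (∑ l, klAt β p₀ (Measure.dirac (z l)) t)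
        + ∫ ε, Real.log (coupling k γ i (noisy β t z ε) / normalizer β k γ i zc t) ∂π := by
  simp_rw [hk.logRatio_eq hs p₀ γ i zc z z]
  have hl : ∀ l, Integrable (fun ε : Fin N → Vec d =>
      Real.log (transitionDensity β t (z l) (noisy β t z ε l))
        - Real.log (forwardDensity β t p₀ (noisy β t z ε l))) π := fun l =>
    integrable_comp_eval hπ (integrable_log_ratio hs p₀ (z l) (z l)) l
  rw [integral_add (hk.integrable_log_coupling_div hs γ i zc z)
    (integrable_finsetSum _ fun l _ => hl l), integral_finsetSum _ fun l _ => hl l, add_comm]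
  congr 1
  refine Finset.sum_congr rfl fun l _ => ?_
  rw [klAt_eq_integral p₀ hs]
  exact integral_comp_eval hπ (integrable_log_ratio hs p₀ (z l) (z l)).aestronglyMeasurable l

end logRatio

section reg
variable {d N : ℕ} {k : Vec d → Vec d → ℝ} {c K Ck : ℝ} {ak : ℕ} (hk : IsKernel k c K Ck ak)
  {β : ℝ → ℝ} {T : ℝ} (h : IsSchedule β T) {p₀ : Measure (Vec d)} [IsProbabilityMeasure p₀]
  {π : Measure (Fin N → Vec d)} [IsProbabilityMeasure π] (γ : ℝ) (i : Fin N)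
  {ω : ℝ → ℝ} (hω : ContDiff ℝ 1 ω)

theorem IsSchedule.aemeasurable_noisy (h : IsSchedule β T) (π : Measure (Fin N → Vec d))
    [SFinite π] (z : Fin N → Vec d) :
    AEMeasurable (fun p : ℝ × (Fin N → Vec d) => noisy β p.1 z p.2)
      ((volume.restrict (Set.Ioc 0 T)).prod π) := by
  refine aemeasurable_pi_lambda _ fun l => ?_
  have h1 : AEMeasurable (fun p : ℝ × (Fin N → Vec d) => alpha β p.1)
      ((volume.restrict (Set.Ioc 0 T)).prod π) := h.aemeasurable_alpha.comp_fst
  have h2 : AEMeasurable (fun p : ℝ × (Fin N → Vec d) => sigma β p.1)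
      ((volume.restrict (Set.Ioc 0 T)).prod π) := h.aemeasurable_sigma.comp_fst
  have h3 : AEMeasurable (fun p : ℝ × (Fin N → Vec d) => p.2 l)
      ((volume.restrict (Set.Ioc 0 T)).prod π) :=
    ((measurable_pi_apply l).comp measurable_snd).aemeasurable
  exact (h1.smul_const (z l)).add (h2.smul h3)

include hk h

theorem IsKernel.aestronglyMeasurable_integral_log_coupling (zc z : Fin N → Vec d) :
    AEStronglyMeasurable (fun t => ∫ ε, Real.log (coupling k γ i (noisy β t z ε) /
      normalizer β k γ i zc t) ∂π) (volume.restrict (Set.Ioc 0 T)) := by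
  have h1 : AEMeasurable (fun p : ℝ × (Fin N → Vec d) => coupling k γ i (noisy β p.1 z p.2))
      ((volume.restrict (Set.Ioc 0 T)).prod π) := by
    have := (hk.continuous_coupling γ i).measurable.comp_aemeasurable (h.aemeasurable_noisy π z)
    exact this
  have h2 : AEMeasurable (fun p : ℝ × (Fin N → Vec d) => normalizer β k γ i zc p.1)
      ((volume.restrict (Set.Ioc 0 T)).prod π) := (hk.aemeasurable_normalizer h γ i zc).comp_fst
  have h3 := (h1.div h2).log.aestronglyMeasurable
  exact h3.integral_prod_right'

include hω

theorem IsKernel.intervalIntegrable_log_coupling (zc z : Fin N → Vec d) :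
    IntervalIntegrable (fun t => deriv ω t * ∫ ε, Real.log (coupling k γ i (noisy β t z ε) /
      normalizer β k γ i zc t) ∂π) volume 0 T := by
  refine IntervalIntegrable.continuousOn_mul ?_ (hω.continuous_deriv le_rfl).continuousOn
  obtain ⟨L, -, hL⟩ := hk.exists_abs_log_coupling_le γ i
  rw [intervalIntegrable_iff_integrableOn_Ioc_of_le h.pos.le]
  refine Integrable.of_bound (hk.aestronglyMeasurable_integral_log_coupling h γ i zc z) (L + L) ?_
  filter_upwards [ae_restrict_mem measurableSet_Ioc] with t ht
  refine (norm_integral_le_of_norm_le_const (Filter.Eventually.of_forall fun ε =>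
    hk.abs_log_coupling_div_le (h.sigma_pos ht) γ i hL zc (noisy β t z ε))).trans ?_
  simp

variable (hπ : ∀ l, π.map (fun ε => ε l) = stdGaussian (Vec d)) {C : ℝ} {a : ℕ}
  (hp : ScoreGrowth β T p₀ C a)
include hπ hp

theorem IsKernel.intervalIntegrable_logRatio (zc z : Fin N → Vec d) :
    IntervalIntegrable (fun t => deriv ω t *
      ∫ ε, logRatio β p₀ (repulsiveDensity β k γ i zc z t) t z ε ∂π) volume 0 T ∧
    reg β ω T p₀ π (repulsiveDensity β k γ i zc) z =
      (∑ l, ∫ t in (0 : ℝ)..T, deriv ω t * klAt β p₀ (Measure.dirac (z l)) t)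
        + ∫ t in (0 : ℝ)..T, deriv ω t * ∫ ε, Real.log (coupling k γ i (noisy β t z ε) /
            normalizer β k γ i zc t) ∂π := by
  have i1 := hk.intervalIntegrable_log_coupling h (π := π) γ i hω zc z
  have i2 : ∀ l ∈ Finset.univ, IntervalIntegrable
      (fun t => deriv ω t * klAt β p₀ (Measure.dirac (z l)) t) volume 0 T := fun l _ =>
    hp.intervalIntegrable_deriv_mul_klAt h hω (z l)
  have i3 : IntervalIntegrable (fun t => ∑ l, deriv ω t * klAt β p₀ (Measure.dirac (z l)) t)
      volume 0 T := by
    have := IntervalIntegrable.sum Finset.univ i2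
    simpa only [Finset.sum_fn] using this
  have heq : ∀ t ∈ Set.uIoc 0 T, (∑ l, deriv ω t * klAt β p₀ (Measure.dirac (z l)) t)
      + deriv ω t * ∫ ε, Real.log (coupling k γ i (noisy β t z ε) /
            normalizer β k γ i zc t) ∂π
      = deriv ω t * ∫ ε, logRatio β p₀ (repulsiveDensity β k γ i zc z t) t z ε ∂π := by
    intro t ht
    rw [Set.uIoc_of_le h.pos.le] at ht
    rw [hk.integral_logRatio (h.sigma_pos ht) p₀ γ i hπ, mul_add, Finset.mul_sum]
  refine ⟨(i3.add i1).congr heq, ?_⟩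
  rw [← intervalIntegral.integral_finsetSum i2, ← intervalIntegral.integral_add i3 i1, reg]
  refine intervalIntegral.integral_congr_ae (Filter.Eventually.of_forall fun t ht => ?_)
  exact (heq t ht).symm

end reg

/-! ### Gradient of the coupling term -/

theorem hasGradientAt_comp_smul_add {d : ℕ} {Φ : Vec d → ℝ} {G : Vec d} {r : ℝ} {ζ v : Vec d}
    (hΦ : HasGradientAt Φ G (r • ζ + v)) :
    HasGradientAt (fun ζ => Φ (r • ζ + v)) (r • G) ζ := by
  have h2 : HasFDerivAt (fun ξ : Vec d => r • ξ + v)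
      (r • ContinuousLinearMap.id ℝ (Vec d)) ζ :=
    ((hasFDerivAt_id (𝕜 := ℝ) ζ).fun_const_smul r).add_const _
  rw [hasGradientAt_iff_hasFDerivAt]
  refine (hΦ.hasFDerivAt.comp ζ h2).congr_fderiv ?_
  ext w
  simp

theorem hasGradientAt_log_transitionDensity {d : ℕ} {β : ℝ → ℝ} {t : ℝ} (hs : 0 < sigma β t)
    (z₀ y : Vec d) :
    HasGradientAt (fun y => Real.log (transitionDensity β t z₀ y))
      (-((sigma β t ^ 2)⁻¹ • (y - alpha β t • z₀))) y := by
  have h1 : HasFDerivAt (fun y : Vec d => ‖y - alpha β t • z₀‖ ^ 2)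
      (2 • innerSL ℝ (y - alpha β t • z₀)) y := by
    have h2 : HasFDerivAt (fun y : Vec d => y - alpha β t • z₀)
        (ContinuousLinearMap.id ℝ (Vec d)) y := (hasFDerivAt_id y).sub_const _
    exact ((hasStrictFDerivAt_norm_sq (y - alpha β t • z₀)).hasFDerivAt.comp y h2)
  have h2 := (h1.mul_const (2 * sigma β t ^ 2)⁻¹).const_sub
    (Real.log ((2 * Real.pi * sigma β t ^ 2) ^ (-(d : ℝ) / 2)))
  rw [hasGradientAt_iff_hasFDerivAt]
  refine (h2.congr_fderiv ?_).congr_of_eventuallyEq (Filter.Eventually.of_forall fun y => ?_)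
  · ext w
    simp
    field_simp
  · simp only [log_transitionDensity hs, div_eq_mul_inv]

theorem norm_update_le {d N : ℕ} (z : Fin N → Vec d) (i : Fin N) {ζ ξ : Vec d}
    (hξ : ξ ∈ Metric.ball ζ 1) :
    ‖Function.update z i ξ‖ ≤ 1 + ‖Function.update z i ζ‖ := by
  refine (pi_norm_le_iff_of_nonneg (by positivity)).2 fun l => ?_
  by_cases hl : l = i
  · subst hl
    have h1 := norm_le_pi_norm (Function.update z l ζ) l
    have h2 := norm_sub_norm_le ξ ζ
    have h3 := mem_ball_iff_norm.1 hξ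
    rw [Function.update_self] at h1 ⊢
    linarith
  · have h1 := norm_le_pi_norm (Function.update z i ζ) l
    rw [Function.update_of_ne hl] at h1 ⊢
    linarith

section gradient
variable {d N : ℕ} {k : Vec d → Vec d → ℝ} {c K Ck : ℝ} {ak : ℕ} (hk : IsKernel k c K Ck ak)
  {β : ℝ → ℝ} {T : ℝ} (h : IsSchedule β T)
  {π : Measure (Fin N → Vec d)} (γ : ℝ) (i : Fin N)
include hk h

theorem IsKernel.norm_potentialGrad_noisy_le {t : ℝ} (ht : t ∈ Set.Ioc 0 T)
    (z ε : Fin N → Vec d) :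
    ‖potentialGrad k i (noisy β t z ε)‖ ≤ N * Ck / c * (1 + ‖z‖) ^ ak * (1 + ‖ε‖) ^ ak := by
  refine (hk.norm_potentialGrad_le i _).trans ?_
  have h0 := hk.const_nonneg
  have h1 := hk.pos
  rw [mul_assoc, ← mul_pow]
  gcongr
  exact h.norm_noisy_pi_le ht z ε

theorem IsKernel.hasGradientAt_log_coupling_div {t : ℝ} (ht : t ∈ Set.Ioc 0 T)
    (zc z ε : Fin N → Vec d) (ζ : Vec d) :
    HasGradientAt (fun ξ => Real.log (coupling k γ i (noisy β t (Function.update z i ξ) ε) /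
        normalizer β k γ i zc t))
      (-((alpha β t * γ) • potentialGrad k i (noisy β t (Function.update z i ζ) ε))) ζ := by
  have hs := h.sigma_pos ht
  -- Moving particle i moves only the i-th noisy coordinate, by α_t times the displacement; the
  -- normalizing constant is frozen and contributes nothing.
  have h1 := (hk.hasGradientAt_potential_update i (noisy β t z ε)
    (alpha β t • ζ + sigma β t • ε i))
  have h2 := ((hasGradientAt_comp_smul_add h1).hasFDerivAt.const_mul (-γ)).sub_const
    (Real.log (normalizer β k γ i zc t))
  rw [hasGradientAt_iff_hasFDerivAt]
  refine (h2.congr_fderiv ?_).congr_of_eventuallyEq (Filter.Eventually.of_forall fun ξ => ?_)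
  · rw [noisy_update]
    ext w
    simp
    ring
  · simp only [noisy_update]
    rw [Real.log_div (hk.coupling_pos γ i _).ne' (hk.normalizer_pos hs γ i zc).ne',
      hk.log_coupling]

theorem IsKernel.norm_smul_potentialGrad_le {t : ℝ} (ht : t ∈ Set.Ioc 0 T)
    (z ε : Fin N → Vec d) {ζ ξ : Vec d} (hξ : ξ ∈ Metric.ball ζ 1) :
    ‖-((alpha β t * γ) • potentialGrad k i (noisy β t (Function.update z i ξ) ε))‖
      ≤ |γ| * (N * Ck / c) * (1 + (1 + ‖Function.update z i ζ‖)) ^ ak * (1 + ‖ε‖) ^ ak := by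
  have h0 := hk.const_nonneg
  have hc := hk.pos
  have h1 := hk.norm_potentialGrad_noisy_le h i ht (Function.update z i ξ) ε
  have h2 := norm_update_le z i hξ
  have h3 := h.alpha_le_one ⟨ht.1.le, ht.2⟩
  rw [norm_neg, norm_smul, norm_mul, Real.norm_of_nonneg (alpha_pos β t).le, Real.norm_eq_abs]
  calc _ ≤ 1 * |γ| * (N * Ck / c * (1 + ‖Function.update z i ξ‖) ^ ak * (1 + ‖ε‖) ^ ak) := by
        gcongr
    _ ≤ 1 * |γ| * (N * Ck / c * (1 + (1 + ‖Function.update z i ζ‖)) ^ ak * (1 + ‖ε‖) ^ ak) := by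
        gcongr
    _ = _ := by ring

theorem IsKernel.aemeasurable_potentialGrad_noisy [SFinite π] (z : Fin N → Vec d) :
    AEMeasurable (fun p : ℝ × (Fin N → Vec d) => potentialGrad k i (noisy β p.1 z p.2))
      ((volume.restrict (Set.Ioc 0 T)).prod π) := by
  have := (hk.continuous_potentialGrad i).measurable.comp_aemeasurable (h.aemeasurable_noisy π z)
  exact this

theorem IsKernel.aestronglyMeasurable_integral_potentialGrad [SFinite π] (z : Fin N → Vec d) :
    AEStronglyMeasurable (fun t => ∫ ε, -((alpha β t * γ) •
      potentialGrad k i (noisy β t z ε)) ∂π) (volume.restrict (Set.Ioc 0 T)) := by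
  have h1 : AEMeasurable (fun p : ℝ × (Fin N → Vec d) => alpha β p.1)
      ((volume.restrict (Set.Ioc 0 T)).prod π) := h.aemeasurable_alpha.comp_fst
  have h2 := (((h1.mul_const γ).smul
    (hk.aemeasurable_potentialGrad_noisy h i z)).fun_neg).aestronglyMeasurable
  exact h2.integral_prod_right'

variable (hπ : ∀ l, π.map (fun ε => ε l) = stdGaussian (Vec d))
include hπ

theorem IsKernel.integrable_potentialGrad_noisy {t : ℝ} (ht : t ∈ Set.Ioc 0 T)
    (z : Fin N → Vec d) : Integrable (fun ε => potentialGrad k i (noisy β t z ε)) π :=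
  ((integrable_one_add_norm_pow_pi hπ i ak).const_mul _).mono'
    ((hk.continuous_potentialGrad i).comp (continuous_noisy β t z)).aestronglyMeasurable
    (Filter.Eventually.of_forall fun ε => hk.norm_potentialGrad_noisy_le h i ht z ε)

variable [IsProbabilityMeasure π]

theorem IsKernel.hasGradientAt_integral_log_coupling {t : ℝ} (ht : t ∈ Set.Ioc 0 T)
    (zc z : Fin N → Vec d) (ζ : Vec d) :
    HasGradientAt (fun ξ => ∫ ε, Real.log (coupling k γ i
        (noisy β t (Function.update z i ξ) ε) / normalizer β k γ i zc t) ∂π)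
      (∫ ε, -((alpha β t * γ) • potentialGrad k i (noisy β t (Function.update z i ζ) ε)) ∂π) ζ :=
  hasGradientAt_integral_of_dominated
    (F' := fun ξ ε => -((alpha β t * γ) •
      potentialGrad k i (noisy β t (Function.update z i ξ) ε)))
    (fun ξ => (hk.integrable_log_coupling_div (h.sigma_pos ht) γ i zc _).aestronglyMeasurable)
    (hk.integrable_log_coupling_div (h.sigma_pos ht) γ i zc _)
    ((hk.integrable_potentialGrad_noisy h i hπ ht _).smul (alpha β t * γ)).neg.aestronglyMeasurable
    (Filter.Eventually.of_forall fun ε _ hξ => hk.norm_smul_potentialGrad_le h γ i ht z ε hξ)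
    ((integrable_one_add_norm_pow_pi hπ i ak).const_mul _)
    (Filter.Eventually.of_forall fun ε _ _ => hk.hasGradientAt_log_coupling_div h γ i ht zc z ε _)

variable {ω : ℝ → ℝ} (hω : ContDiff ℝ 1 ω)
include hω

theorem IsKernel.hasGradientAt_time_integral_log_coupling (zc z : Fin N → Vec d) (ζ : Vec d) :
    HasGradientAt (fun ξ => ∫ t in (0 : ℝ)..T, deriv ω t * ∫ ε, Real.log (coupling k γ i
        (noisy β t (Function.update z i ξ) ε) / normalizer β k γ i zc t) ∂π)
      (∫ t in Set.Ioc 0 T, deriv ω t • ∫ ε, -((alpha β t * γ) •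
        potentialGrad k i (noisy β t (Function.update z i ζ) ε)) ∂π) ζ := by
  obtain ⟨B, hB⟩ := (isCompact_Icc (a := (0 : ℝ)) (b := T)).exists_bound_of_continuousOn
    (hω.continuous_deriv le_rfl).continuousOn
  simp_rw [intervalIntegral.integral_of_le h.pos.le]
  have hi := fun ξ => (intervalIntegrable_iff_integrableOn_Ioc_of_le h.pos.le).1
    (hk.intervalIntegrable_log_coupling h (π := π) γ i hω zc (Function.update z i ξ))
  refine hasGradientAt_integral_of_dominated
    (F' := fun ξ t => deriv ω t • ∫ ε, -((alpha β t * γ) •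
        potentialGrad k i (noisy β t (Function.update z i ξ) ε)) ∂π)
    (bound := fun _ => B * ∫ ε : Fin N → Vec d, |γ| * (N * Ck / c) *
      (1 + (1 + ‖Function.update z i ζ‖)) ^ ak * (1 + ‖ε‖) ^ ak ∂π)
    (fun ξ => (hi ξ).aestronglyMeasurable) (hi ζ)
    ((hω.continuous_deriv le_rfl).aestronglyMeasurable.smul
      (hk.aestronglyMeasurable_integral_potentialGrad h γ i _)) ?_ (integrable_const _) ?_
  · filter_upwards [ae_restrict_mem measurableSet_Ioc] with t ht ξ hξ
    rw [norm_smul]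
    have h0 := (norm_nonneg _).trans (hB t ⟨ht.1.le, ht.2⟩)
    refine mul_le_mul (hB t ⟨ht.1.le, ht.2⟩) ?_ (norm_nonneg _) h0
    exact norm_integral_le_of_norm_le ((integrable_one_add_norm_pow_pi hπ i ak).const_mul _)
      (Filter.Eventually.of_forall fun ε => hk.norm_smul_potentialGrad_le h γ i ht z ε hξ)
  · filter_upwards [ae_restrict_mem measurableSet_Ioc] with t ht ξ _
    have h1 := (hk.hasGradientAt_integral_log_coupling h γ i hπ ht zc z
      ξ).hasFDerivAt.const_mul (deriv ω t)
    rw [hasGradientAt_iff_hasFDerivAt]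
    refine h1.congr_fderiv ?_
    simp

end gradient

/-! ### Gradient with the variational density held fixed -/

section residual
variable {d N : ℕ} {k : Vec d → Vec d → ℝ} {c K Ck : ℝ} {ak : ℕ} (hk : IsKernel k c K Ck ak)
  {β : ℝ → ℝ} {T : ℝ} (h : IsSchedule β T) {p₀ : Measure (Vec d)}
  {C : ℝ} {a : ℕ} (hp : ScoreGrowth β T p₀ C a) {eps : Vec d → ℝ → Vec d}
  (heps : ∀ t ∈ Set.Ioc 0 T, ∀ z, eps z t = -(sigma β t • score β t p₀ z))
  {π : Measure (Fin N → Vec d)} (γ : ℝ) (i : Fin N)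
  (hπ : ∀ l, π.map (fun ε => ε l) = stdGaussian (Vec d))
include hk h heps

/-- At the current particle the sample minus its mean is σ_t times the noise, so the score of the
frozen Gaussian is the noise over -σ_t. This is the origin of the term -ε in the residual. -/
theorem IsKernel.smul_residual {t : ℝ} (ht : t ∈ Set.Ioc 0 T) (z ε : Fin N → Vec d) :
    (alpha β t / sigma β t) • residual β k γ eps i z t ε
      = -((alpha β t * γ) • potentialGrad k i (noisy β t z ε))
        + alpha β t • (-((sigma β t ^ 2)⁻¹ • (noisy β t z ε i - alpha β t • z i))
          - score β t p₀ (noisy β t z ε i)) := by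
  have hs := h.sigma_pos ht
  rw [residual, hk.repulsion_eq, heps t ht, noisy, add_sub_cancel_left, smul_smul, pow_two,
    mul_inv, inv_mul_cancel_right₀ hs.ne', smul_sub, smul_sub, smul_neg, smul_smul, smul_smul,
    smul_sub, smul_neg, smul_smul, div_mul_cancel₀ _ hs.ne', ← div_eq_mul_inv]
  rw [show alpha β t / sigma β t * (γ * sigma β t) = alpha β t * γ by field_simp]
  abel

variable [IsProbabilityMeasure p₀]
include hp hπ

theorem IsKernel.integrable_residual {t : ℝ} (ht : t ∈ Set.Ioc 0 T) (z : Fin N → Vec d) :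
    Integrable (residual β k γ eps i z t) π := by
  have h1 : Integrable (fun ε : Fin N → Vec d =>
      -(sigma β t • score β t p₀ (noisy β t z ε i))) π :=
    integrable_comp_eval hπ ((hp.integrable_score_noisy h ht (z i)).smul (sigma β t)).neg i
  have h2 : Integrable (fun ε : Fin N → Vec d => ε i) π :=
    integrable_comp_eval hπ IsGaussian.integrable_fun_id i
  have h3 := (hk.integrable_potentialGrad_noisy h i hπ ht z).smul (γ * sigma β t)
  refine ((h1.sub h2).sub h3).congr (Filter.Eventually.of_forall fun ε => ?_)
  simp only [residual, Pi.sub_apply, Pi.smul_apply, hk.repulsion_eq, heps t ht]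

variable [IsProbabilityMeasure π]

theorem IsKernel.hasGradientAt_integral_logRatio {t : ℝ} (ht : t ∈ Set.Ioc 0 T)
    (z : Fin N → Vec d) :
    HasGradientAt (fun ζ => ∫ ε, logRatio β p₀ (repulsiveDensity β k γ i z z t) t
        (Function.update z i ζ) ε ∂π)
      ((alpha β t / sigma β t) • ∫ ε, residual β k γ eps i z t ε ∂π) (z i) := by
  have hs := h.sigma_pos ht
  have hC := hp.nonneg h
  -- The gradient at every ζ near the particle, as required for domination; the Gaussian stays
  -- centred at the original `z i`.
  let F' : Vec d → (Fin N → Vec d) → Vec d := fun ζ ε =>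
    -((alpha β t * γ) • potentialGrad k i (noisy β t (Function.update z i ζ) ε))
      + alpha β t • (-((sigma β t ^ 2)⁻¹ •
          (alpha β t • ζ + sigma β t • ε i - alpha β t • z i))
          - score β t p₀ (alpha β t • ζ + sigma β t • ε i))
  have hF' : ∀ ε, F' (z i) ε = (alpha β t / sigma β t) • residual β k γ eps i z t ε := fun ε => by
    rw [hk.smul_residual h heps γ i ht]
    simp only [F', Function.update_eq_self]
    rfl
  rw [← integral_smul]
  simp_rw [← hF']
  have hint : ∀ ζ, Integrable (fun ε => logRatio β p₀ (repulsiveDensity β k γ i z z t) t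
      (Function.update z i ζ) ε) π := fun ζ => hk.integrable_logRatio hs p₀ γ i hπ z z _
  refine hasGradientAt_integral_of_dominated (F' := F')
    (bound := fun ε => |γ| * (N * Ck / c) * (1 + (1 + ‖Function.update z i (z i)‖)) ^ ak *
        (1 + ‖ε‖) ^ ak + ((sigma β t ^ 2)⁻¹ * (1 + ‖ε i‖) ^ 1
          + C * (1 + (1 + ‖z i‖)) ^ a * (1 + ‖ε i‖) ^ a))
    (fun ζ => (hint ζ).aestronglyMeasurable) (hint (z i)) ?_
    (Filter.Eventually.of_forall fun ε ξ hξ => ?_) ?_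
    (Filter.Eventually.of_forall fun ε ξ _ => ?_)
  · simp_rw [funext hF']
    exact ((hk.integrable_residual h hp heps γ i hπ ht z).smul
      (alpha β t / sigma β t)).aestronglyMeasurable
  · refine (norm_add_le _ _).trans (add_le_add
      (hk.norm_smul_potentialGrad_le h γ i ht z ε hξ) ?_)
    rw [norm_smul, Real.norm_of_nonneg (alpha_pos β t).le]
    have ha := h.alpha_le_one ⟨ht.1.le, ht.2⟩
    have ha0 := alpha_pos β t
    have h3 := mem_ball_iff_norm.1 hξ
    have h1 : ‖alpha β t • ξ + sigma β t • ε i - alpha β t • z i‖ ≤ (1 + ‖ε i‖) ^ 1 := by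
      rw [show alpha β t • ξ + sigma β t • ε i - alpha β t • z i
        = alpha β t • (ξ - z i) + sigma β t • ε i by rw [smul_sub]; abel]
      refine (norm_add_le _ _).trans ?_
      rw [norm_smul, norm_smul, Real.norm_of_nonneg ha0.le, Real.norm_of_nonneg hs.le, pow_one]
      have := mul_le_mul_of_nonneg_right (sigma_le_one β t) (norm_nonneg (ε i))
      have := mul_le_mul_of_nonneg_right ha (norm_nonneg (ξ - z i))
      linarith
    have h2 : ‖score β t p₀ (alpha β t • ξ + sigma β t • ε i)‖
        ≤ C * (1 + (1 + ‖z i‖)) ^ a * (1 + ‖ε i‖) ^ a := by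
      refine (hp.noisy_le h ht ξ (ε i)).trans ?_
      have : ‖ξ‖ ≤ 1 + ‖z i‖ := by
        have := norm_sub_norm_le ξ (z i)
        linarith
      gcongr
    refine (mul_le_of_le_one_left (norm_nonneg _) ha).trans ?_
    refine (norm_sub_le _ _).trans (add_le_add ?_ h2)
    rw [norm_neg, norm_smul, norm_inv, Real.norm_of_nonneg (by positivity)]
    gcongr
  · exact ((integrable_one_add_norm_pow_pi hπ i ak).const_mul _).add
      (integrable_comp_eval hπ (((integrable_one_add_norm_pow 1).const_mul _).add
        ((integrable_one_add_norm_pow a).const_mul _)) i)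
  · have h1 := (hk.hasGradientAt_log_coupling_div h γ i ht z z ε ξ).hasFDerivAt
    set y := alpha β t • ξ + sigma β t • ε i with hy
    have h2 := (hasGradientAt_log_transitionDensity hs (z i) y).hasFDerivAt.sub
      (hasGradientAt_score p₀ hs y).hasFDerivAt
    rw [← map_sub, ← hasGradientAt_iff_hasFDerivAt] at h2
    have h3 := (hasGradientAt_comp_smul_add h2).hasFDerivAt
    -- The samples of the other particles do not move, so their log-ratios are constants.
    have h4 := (h1.add h3).add_const (∑ l ∈ Finset.univ.erase i,
      (Real.log (transitionDensity β t (z l) (noisy β t z ε l))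
        - Real.log (forwardDensity β t p₀ (noisy β t z ε l))))
    rw [← map_add] at h4
    rw [hasGradientAt_iff_hasFDerivAt]
    refine h4.congr_of_eventuallyEq (Filter.Eventually.of_forall fun ξ' => ?_)
    dsimp only
    rw [hk.logRatio_eq hs, ← Finset.add_sum_erase _ _ (Finset.mem_univ i), ← add_assoc]
    congr 1
    · simp only [Pi.add_apply, Pi.sub_apply, noisy_update, Function.update_self]
    · refine Finset.sum_congr rfl fun l hl => ?_
      rw [noisy_update, Function.update_of_ne (Finset.ne_of_mem_erase hl)]

end residual

/-! ### The regularizer update as a time integral and as a gradient -/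

section update
variable {d N : ℕ} {k : Vec d → Vec d → ℝ} {c K Ck : ℝ} {ak : ℕ} (hk : IsKernel k c K Ck ak)
  {β : ℝ → ℝ} {T : ℝ} (h : IsSchedule β T)
  {ω : ℝ → ℝ} (hω : ContDiff ℝ 1 ω)
  {π : Measure (Fin N → Vec d)} [IsProbabilityMeasure π]
  (hπ : ∀ l, π.map (fun ε => ε l) = stdGaussian (Vec d)) (γ σv ρ : ℝ) (i : Fin N)

include hπ in
theorem measurePreserving_eval_noise (ν : Measure ℝ) [SFinite ν] :
    MeasurePreserving (fun p : ℝ × (Fin N → Vec d) => (p.1, p.2 i)) (ν.prod π)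
      (ν.prod (stdGaussian (Vec d))) :=
  (MeasurePreserving.id ν).prod ⟨measurable_pi_apply i, hπ i⟩

section repulsion
include hk h

/-- The σ_t in the repulsion cancels the 1/σ_t in the weight, so the repulsive part is not singular
at time zero. -/
theorem IsKernel.lam_smul_repulsion {t : ℝ} (ht : t ∈ Set.Ioc 0 T) (w : Fin N → Vec d) :
    lam β ω T σv ρ t • repulsion β k γ t i w
      = (4 * T * σv ^ 2 * ρ ^ 2 * deriv ω t) • ((alpha β t * γ) • potentialGrad k i w) := by
  have hs := h.sigma_pos ht
  rw [hk.repulsion_eq, smul_smul, smul_smul, lam]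
  congr 1
  field_simp

include hω hπ

theorem IsKernel.integrable_lam_repulsion (z : Fin N → Vec d) :
    Integrable (fun p : ℝ × (Fin N → Vec d) =>
      lam β ω T σv ρ p.1 • repulsion β k γ p.1 i (noisy β p.1 z p.2))
      ((volume.restrict (Set.Ioc 0 T)).prod π) := by
  obtain ⟨B, hB⟩ := (isCompact_Icc (a := (0 : ℝ)) (b := T)).exists_bound_of_continuousOn
    (hω.continuous_deriv le_rfl).continuousOn
  have hmem : ∀ᵐ p ∂((volume.restrict (Set.Ioc 0 T)).prod π), p.1 ∈ Set.Ioc 0 T :=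
    Measure.quasiMeasurePreserving_fst.ae (ae_restrict_mem measurableSet_Ioc)
  have hm : AEStronglyMeasurable (fun p : ℝ × (Fin N → Vec d) =>
      (4 * T * σv ^ 2 * ρ ^ 2 * deriv ω p.1) •
        ((alpha β p.1 * γ) • potentialGrad k i (noisy β p.1 z p.2)))
      ((volume.restrict (Set.Ioc 0 T)).prod π) := by
    have h1 : AEMeasurable (fun p : ℝ × (Fin N → Vec d) => alpha β p.1)
        ((volume.restrict (Set.Ioc 0 T)).prod π) := h.aemeasurable_alpha.comp_fst
    have h2 : AEMeasurable (fun p : ℝ × (Fin N → Vec d) => deriv ω p.1)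
        ((volume.restrict (Set.Ioc 0 T)).prod π) :=
      ((hω.continuous_deriv le_rfl).measurable.comp measurable_fst).aemeasurable
    exact ((h2.const_mul _).smul ((h1.mul_const γ).smul
      (hk.aemeasurable_potentialGrad_noisy h i z))).aestronglyMeasurable
  have hbi : Integrable (fun p : ℝ × (Fin N → Vec d) => |4 * T * σv ^ 2 * ρ ^ 2| * B *
      (|γ| * (N * Ck / c * (1 + ‖z‖) ^ ak) * (1 + ‖p.2‖) ^ ak))
      ((volume.restrict (Set.Ioc 0 T)).prod π) :=
    (((integrable_one_add_norm_pow_pi hπ i ak).const_mul _).const_mul _).comp_snd _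
  refine hbi.mono' (hm.congr ?_) ?_
  · filter_upwards [hmem] with p hpm
    exact (hk.lam_smul_repulsion h γ σv ρ i hpm _).symm
  · filter_upwards [hmem] with p hpm
    rw [hk.lam_smul_repulsion h γ σv ρ i hpm, norm_smul, norm_smul,
      norm_mul (alpha β p.1), norm_mul (4 * T * σv ^ 2 * ρ ^ 2),
      Real.norm_of_nonneg (alpha_pos β p.1).le, Real.norm_eq_abs γ,
      Real.norm_eq_abs (4 * T * σv ^ 2 * ρ ^ 2)]
    have h1 := hB p.1 ⟨hpm.1.le, hpm.2⟩
    have h2 := hk.norm_potentialGrad_noisy_le h i hpm z p.2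
    have h3 := h.alpha_le_one ⟨hpm.1.le, hpm.2⟩
    have hB0 : 0 ≤ B := (norm_nonneg _).trans h1
    have ha := alpha_pos β p.1
    have hc := hk.pos
    have h0 := hk.const_nonneg
    calc _ ≤ |4 * T * σv ^ 2 * ρ ^ 2| * B *
          (1 * |γ| * (N * Ck / c * (1 + ‖z‖) ^ ak * (1 + ‖p.2‖) ^ ak)) := by gcongr
      _ = _ := by ring

theorem IsKernel.integral_lam_repulsion (z : Fin N → Vec d) :
    ∫ p : ℝ × (Fin N → Vec d), lam β ω T σv ρ p.1 • repulsion β k γ p.1 i (noisy β p.1 z p.2)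
        ∂((uniformTime T).prod π)
      = -((4 * σv ^ 2 * ρ ^ 2) • ∫ t in Set.Ioc 0 T, deriv ω t • ∫ ε, -((alpha β t * γ) •
        potentialGrad k i (noisy β t z ε)) ∂π) := by
  rw [integral_uniformTime_prod h.pos,
    integral_prod _ (hk.integrable_lam_repulsion h hω hπ γ σv ρ i z),
    ← integral_smul, ← integral_smul, ← integral_neg]
  refine setIntegral_congr_fun measurableSet_Ioc fun t ht => ?_
  simp only [hk.lam_smul_repulsion h γ σv ρ i ht]
  rw [integral_smul, integral_neg, smul_neg, smul_neg, neg_neg, smul_smul, smul_smul]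
  congr 1
  have := h.pos
  field_simp

end repulsion

variable {p₀ : Measure (Vec d)} [IsProbabilityMeasure p₀] {C : ℝ} {a : ℕ}
  (hp : ScoreGrowth β T p₀ C a) {eps : Vec d → ℝ → Vec d}
  (heps : ∀ t ∈ Set.Ioc 0 T, ∀ z, eps z t = -(sigma β t • score β t p₀ z))
include hk h hω hπ hp heps

theorem IsKernel.integrable_lam_residual (z : Fin N → Vec d) :
    Integrable (fun p : ℝ × (Fin N → Vec d) =>
      lam β ω T σv ρ p.1 • residual β k γ eps i z p.1 p.2)
      ((volume.restrict (Set.Ioc 0 T)).prod π) := by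
  have h1 := (measurePreserving_eval_noise hπ i
    (volume.restrict (Set.Ioc 0 T))).integrable_comp_of_integrable (hp.integrable_denoise h hω heps σv ρ (z i))
  refine (h1.sub (hk.integrable_lam_repulsion h hω hπ γ σv ρ i z)).congr
    (Filter.Eventually.of_forall fun p => ?_)
  exact (smul_sub _ _ _).symm

/-- The denoising part depends on the noise of particle i only and reduces to the one-particle
integral by projecting the noise law; the repulsion keeps the full joint law. -/
theorem IsKernel.regUpdate_eq (z : Fin N → Vec d) :
    regUpdate β ω T σv ρ π k γ eps i z = (4 * σv ^ 2 * ρ ^ 2) •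
      ((∫ t in Set.Ioc 0 T, deriv ω t • ∫ e, -(alpha β t • score β t p₀
          (alpha β t • z i + sigma β t • e)) ∂(stdGaussian (Vec d)))
        + ∫ t in Set.Ioc 0 T, deriv ω t • ∫ ε, -((alpha β t * γ) •
          potentialGrad k i (noisy β t z ε)) ∂π) := by
  have hd := hp.integrable_denoise h hω heps σv ρ (z i)
  have : SFinite (uniformTime T) := by rw [uniformTime_eq]; infer_instance
  have hmp := measurePreserving_eval_noise hπ i (uniformTime T)
  have hd' := integrable_uniformTime_prod h.pos hd
  have h1 : Integrable (fun p : ℝ × (Fin N → Vec d) => lam β ω T σv ρ p.1 •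
      (eps (alpha β p.1 • z i + sigma β p.1 • p.2 i) p.1 - p.2 i)) ((uniformTime T).prod π) :=
    hmp.integrable_comp_of_integrable hd'
  have h2 := integrable_uniformTime_prod h.pos (hk.integrable_lam_repulsion h hω hπ γ σv ρ i z)
  have h3 : ∫ p : ℝ × (Fin N → Vec d), lam β ω T σv ρ p.1 •
      (eps (alpha β p.1 • z i + sigma β p.1 • p.2 i) p.1 - p.2 i) ∂((uniformTime T).prod π)
      = ∫ p : ℝ × Vec d, lam β ω T σv ρ p.1 •
        (eps (alpha β p.1 • z i + sigma β p.1 • p.2) p.1 - p.2)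
        ∂((uniformTime T).prod (stdGaussian (Vec d))) := by
    have hd2 := hd'.aestronglyMeasurable
    rw [← hmp.map_eq] at hd2 ⊢
    rw [integral_map hmp.measurable.aemeasurable hd2]
  rw [smul_add, ← hp.integral_denoise h hω heps σv ρ (z i), ← h3,
    ← sub_neg_eq_add, ← hk.integral_lam_repulsion h hω hπ γ σv ρ i z, ← integral_sub h1 h2]
  exact integral_congr_ae (Filter.Eventually.of_forall fun p => smul_sub _ _ _)

/-- The regularizer update is the weighted time integral of the gradients with the variational
density held fixed. -/
theorem IsKernel.integral_gradient_logRatio (z : Fin N → Vec d) :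
    (4 * σv ^ 2 * ρ ^ 2) • (∫ t in (0 : ℝ)..T, deriv ω t •
        gradient (fun ζ => ∫ ε, logRatio β p₀ (repulsiveDensity β k γ i z z t) t
          (Function.update z i ζ) ε ∂π) (z i))
      = regUpdate β ω T σv ρ π k γ eps i z := by
  rw [regUpdate, integral_uniformTime_prod h.pos,
    integral_prod _ (hk.integrable_lam_residual h hω hπ γ σv ρ i hp heps z),
    intervalIntegral.integral_of_le h.pos.le, ← integral_smul, ← integral_smul]
  refine setIntegral_congr_fun measurableSet_Ioc fun t ht => ?_
  have hg := (hk.hasGradientAt_integral_logRatio h hp heps γ i hπ ht z).gradient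
  simp only [hg]
  rw [integral_smul, smul_smul, smul_smul, smul_smul]
  congr 1
  rw [lam]
  have := h.pos
  field_simp

/-- The regularizer update is the gradient of the regularizer with moving marginals. -/
theorem IsKernel.hasGradientAt_reg (z : Fin N → Vec d) :
    HasGradientAt (fun ζ => 4 * σv ^ 2 * ρ ^ 2 *
        reg β ω T p₀ π (repulsiveDensity β k γ i z) (Function.update z i ζ))
      (regUpdate β ω T σv ρ π k γ eps i z) (z i) := by
  have h1 := hp.hasGradientAt_integral_klAt h hω (z i)
  have h2 := hk.hasGradientAt_time_integral_log_coupling h γ i hπ hω z z (z i)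
  rw [Function.update_eq_self] at h2
  -- The regularizer splits into KL integrals of single particles and the coupling integral; the KL
  -- integrals of the other particles are constant.
  have h3 := (h1.hasFDerivAt.add h2.hasFDerivAt).add_const (∑ l ∈ Finset.univ.erase i,
    ∫ t in (0 : ℝ)..T, deriv ω t * klAt β p₀ (Measure.dirac (z l)) t)
  have h4 := h3.const_mul (4 * σv ^ 2 * ρ ^ 2)
  rw [hk.regUpdate_eq h hω hπ γ σv ρ i hp heps, hasGradientAt_iff_hasFDerivAt]
  refine (h4.congr_fderiv ?_).congr_of_eventuallyEq (Filter.Eventually.of_forall fun ξ => ?_)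
  · simp
  · dsimp only [Pi.add_apply]
    rw [(hk.intervalIntegrable_logRatio h γ i hω hπ hp z _).2,
      ← Finset.add_sum_erase _ _ (Finset.mem_univ i), Function.update_self,
      Finset.sum_congr rfl fun l hl => by
        rw [Function.update_of_ne (Finset.ne_of_mem_erase hl)]]
    ring

end update

/-! ### Misfit of the ensemble and gradient of the full objective -/

section misfit
variable {m n d N : ℕ} (σv ρ : ℝ) (y : Vec n) (f : Vec m → Vec n) (D : Vec d → Vec m)

theorem misfit_ensemble (x : Fin N → Vec m) (z : Fin N → Vec d) :
    misfit σv ρ y f D (ensemble x z) = (1 / (N : ℝ)) *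
      ∑ l, (1 / (2 * σv ^ 2) * ‖y - f (x l)‖ ^ 2 + 1 / (2 * ρ ^ 2) * ‖x l - D (z l)‖ ^ 2) := by
  have key : ∀ g : Vec m × Vec d → ℝ, ∫ u, g u ∂(ensemble x z) = (1 / (N : ℝ)) *
      ∑ l, g (x l, z l) := fun g => by
    rw [ensemble, integral_smul_measure, integral_finsetSum_measure fun l _ =>
      integrable_dirac (by simp), smul_eq_mul, ENNReal.toReal_inv, ENNReal.toReal_natCast,
      one_div]
    simp only [integral_dirac]
  rw [misfit, key, key, Finset.sum_add_distrib, mul_add]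

variable {σv ρ} (hσv : 0 < σv) (hρ : 0 < ρ) {f D}
include hσv hρ

/-- Isolates the dependence on particle i. The factor 4σ_v²ρ² clears both denominators, and 1/N
comes from the empirical measure. -/
theorem mul_misfit_update (x : Fin N → Vec m) (z : Fin N → Vec d) (i : Fin N) (ξ : Vec m)
    (ζ : Vec d) :
    4 * σv ^ 2 * ρ ^ 2 * misfit σv ρ y f D
        (ensemble (Function.update x i ξ) (Function.update z i ζ))
      = (1 / (N : ℝ)) * (2 * ρ ^ 2 * ‖y - f ξ‖ ^ 2 + 2 * σv ^ 2 * ‖ξ - D ζ‖ ^ 2)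
        + 4 * σv ^ 2 * ρ ^ 2 * ((1 / (N : ℝ)) * ∑ l ∈ Finset.univ.erase i,
          (1 / (2 * σv ^ 2) * ‖y - f (x l)‖ ^ 2 + 1 / (2 * ρ ^ 2) * ‖x l - D (z l)‖ ^ 2)) := by
  rw [misfit_ensemble, ← Finset.add_sum_erase _ _ (Finset.mem_univ i), Function.update_self,
    Function.update_self, Finset.sum_congr rfl fun l hl => by
      rw [Function.update_of_ne (Finset.ne_of_mem_erase hl),
        Function.update_of_ne (Finset.ne_of_mem_erase hl)]]
  set S := ∑ l ∈ Finset.univ.erase i,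
    (1 / (2 * σv ^ 2) * ‖y - f (x l)‖ ^ 2 + 1 / (2 * ρ ^ 2) * ‖x l - D (z l)‖ ^ 2)
  field_simp
  ring

variable (hf : Differentiable ℝ f) (hD : Differentiable ℝ D)
include hf hD

/-- Gradient of the objective in one particle, given that of the regularizer. -/
theorem hasGradientAt_objective {β ω : ℝ → ℝ} {T : ℝ} {p₀ : Measure (Vec d)}
    {π : Measure (Fin N → Vec d)} {Q : (Fin N → Vec d) → ℝ → (Fin N → Vec d) → ℝ}
    (x : Fin N → Vec m) (z : Fin N → Vec d) (i : Fin N) {G : Vec d}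
    (hG : HasGradientAt (fun ζ => 4 * σv ^ 2 * ρ ^ 2 *
      reg β ω T p₀ π Q (Function.update z i ζ)) G (z i)) :
    HasGradientAt (fun u : WithLp 2 (Vec m × Vec d) => 4 * σv ^ 2 * ρ ^ 2 *
        objective β ω T σv ρ y f D p₀ π Q (Function.update x i u.fst) (Function.update z i u.snd))
      ((1 / (N : ℝ)) • gradient (fun u : WithLp 2 (Vec m × Vec d) =>
          2 * ρ ^ 2 * ‖y - f u.fst‖ ^ 2 + 2 * σv ^ 2 * ‖u.fst - D u.snd‖ ^ 2)
          (WithLp.toLp 2 (x i, z i)) + WithLp.toLp 2 (0, G))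
      (WithLp.toLp 2 (x i, z i)) := by
  set u₀ : WithLp 2 (Vec m × Vec d) := WithLp.toLp 2 (x i, z i) with hu₀
  have hfst : Differentiable ℝ fun u : WithLp 2 (Vec m × Vec d) => u.fst :=
    (WithLp.fstL 2 ℝ (Vec m) (Vec d)).differentiable
  have hsnd : HasFDerivAt (fun u : WithLp 2 (Vec m × Vec d) => u.snd)
      (WithLp.sndL 2 ℝ (Vec m) (Vec d)) u₀ := (WithLp.sndL 2 ℝ (Vec m) (Vec d)).hasFDerivAt
  have hsnd' : Differentiable ℝ fun u : WithLp 2 (Vec m × Vec d) => u.snd :=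
    (WithLp.sndL 2 ℝ (Vec m) (Vec d)).differentiable
  have hg : Differentiable ℝ (fun u : WithLp 2 (Vec m × Vec d) =>
      2 * ρ ^ 2 * ‖y - f u.fst‖ ^ 2 + 2 * σv ^ 2 * ‖u.fst - D u.snd‖ ^ 2) :=
    ((((differentiable_const y).sub (hf.comp hfst)).norm_sq ℝ).const_mul _).add
      (((hfst.sub (hD.comp hsnd')).norm_sq ℝ).const_mul _)
  have h1 := (hg u₀).hasGradientAt.hasFDerivAt.const_mul (1 / (N : ℝ))
  have h2 : HasFDerivAt (fun u : WithLp 2 (Vec m × Vec d) => 4 * σv ^ 2 * ρ ^ 2 *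
      reg β ω T p₀ π Q (Function.update z i u.snd))
      ((InnerProductSpace.toDual ℝ (Vec d) G).comp (WithLp.sndL 2 ℝ (Vec m) (Vec d))) u₀ :=
    HasFDerivAt.comp (g := fun ζ => 4 * σv ^ 2 * ρ ^ 2 *
      reg β ω T p₀ π Q (Function.update z i ζ)) u₀ hG.hasFDerivAt hsnd
  have h3 := (h1.add h2).add_const (4 * σv ^ 2 * ρ ^ 2 * ((1 / (N : ℝ)) *
    ∑ l ∈ Finset.univ.erase i,
      (1 / (2 * σv ^ 2) * ‖y - f (x l)‖ ^ 2 + 1 / (2 * ρ ^ 2) * ‖x l - D (z l)‖ ^ 2)))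
  rw [hasGradientAt_iff_hasFDerivAt]
  refine (h3.congr_fderiv ?_).congr_of_eventuallyEq (Filter.Eventually.of_forall fun u => ?_)
  · ext w
    simp [WithLp.prod_inner_apply]
  · dsimp only [Pi.add_apply]
    rw [objective, mul_add, mul_misfit_update y hσv hρ]
    ring

end misfit
end
end RSD

/-! ### Assembly of the main theorem -/

theorem proposition2 {m n d N : ℕ}
    -- diffusion horizon, variance-preserving schedule, weighting
    (T : ℝ) (hT : 0 < T) (β : ℝ → ℝ) (hβ : ContinuousOn β (Set.Icc 0 T))
    (hβpos : ∀ t ∈ Set.Icc 0 T, 0 < β t)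
    (ω : ℝ → ℝ) (hω : ContDiff ℝ 1 ω) (hω0 : ω 0 = 0)
    -- prior, with its exact score given by the noise predictor
    (p₀ : Measure (RSD.Vec d)) [IsProbabilityMeasure p₀]
    (hp : ∃ (C : ℝ) (a : ℕ), ∀ t ∈ Set.Ioc 0 T, ∀ z, ‖RSD.score β t p₀ z‖ ≤ C * (1 + ‖z‖) ^ a)
    (eps : RSD.Vec d → ℝ → RSD.Vec d)
    (heps : ∀ t ∈ Set.Ioc 0 T, ∀ z, eps z t = -(RSD.sigma β t • RSD.score β t p₀ z))
    -- measurement model and decoder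
    (σv ρ : ℝ) (hσv : 0 < σv) (hρ : 0 < ρ) (y : RSD.Vec n)
    (f : RSD.Vec m → RSD.Vec n) (hf : Differentiable ℝ f)
    (D : RSD.Vec d → RSD.Vec m) (hD : Differentiable ℝ D)
    -- pairwise kernel and repulsion strength
    (k : RSD.Vec d → RSD.Vec d → ℝ)
    (hk : ContDiff ℝ 1 fun p : RSD.Vec d × RSD.Vec d => k p.1 p.2)
    (hk_nonneg : ∀ v w, 0 ≤ k v w) (hk_bdd : ∃ K, ∀ v w, k v w ≤ K)
    (hk_diag : ∃ c > 0, ∀ v, c ≤ k v v)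
    (hk_grad : ∃ (C : ℝ) (a : ℕ), ∀ p : RSD.Vec d × RSD.Vec d,
      ‖fderiv ℝ (fun p : RSD.Vec d × RSD.Vec d => k p.1 p.2) p‖ ≤ C * (1 + ‖p‖) ^ a)
    (γ : ℝ)
    -- joint law of the noises, each of them standard Gaussian
    (π : Measure (Fin N → RSD.Vec d)) [IsProbabilityMeasure π]
    (hπ : ∀ l, π.map (fun ε => ε l) = stdGaussian (RSD.Vec d))
    -- the particles
    (x : Fin N → RSD.Vec m) (z : Fin N → RSD.Vec d) :
    -- the score-matching regularizer of one particle, as a time integral of the KL divergence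
    (∀ ζ : RSD.Vec d,
      (∀ t ∈ Set.Ioc 0 T,
        InformationTheory.klDiv (RSD.forwardLaw β t (Measure.dirac ζ))
            (RSD.forwardLaw β t p₀) ≠ ⊤ ∧
          Integrable (fun w => ‖RSD.score β t (Measure.dirac ζ) w - RSD.score β t p₀ w‖ ^ 2)
            (RSD.forwardLaw β t (Measure.dirac ζ))) ∧
      IntervalIntegrable (fun t => β t / 2 * ω t * RSD.fisherAt β p₀ (Measure.dirac ζ) t)
        volume 0 T ∧
      IntervalIntegrable (fun t => deriv ω t * RSD.klAt β p₀ (Measure.dirac ζ) t) volume 0 T ∧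
      RSD.scoreMatching β ω T p₀ (Measure.dirac ζ) =
        (∫ t in (0 : ℝ)..T, deriv ω t * RSD.klAt β p₀ (Measure.dirac ζ) t)
          - ω T * RSD.klAt β p₀ (Measure.dirac ζ) T) ∧
    -- without coupling, the update is the gradient of the score-matching regularizer itself
    -- (up to the terminal KL)
    (∀ ζ : RSD.Vec d,
      Integrable (fun p : ℝ × RSD.Vec d => RSD.lam β ω T σv ρ p.1 •
          (eps (RSD.alpha β p.1 • ζ + RSD.sigma β p.1 • p.2) p.1 - p.2))
        ((RSD.uniformTime T).prod (stdGaussian (RSD.Vec d))) ∧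
      HasGradientAt
        (fun ξ => 4 * σv ^ 2 * ρ ^ 2 * (RSD.scoreMatching β ω T p₀ (Measure.dirac ξ)
          + ω T * RSD.klAt β p₀ (Measure.dirac ξ) T))
        (∫ p : ℝ × RSD.Vec d, RSD.lam β ω T σv ρ p.1 •
            (eps (RSD.alpha β p.1 • ζ + RSD.sigma β p.1 • p.2) p.1 - p.2)
          ∂((RSD.uniformTime T).prod (stdGaussian (RSD.Vec d)))) ζ) ∧
    ∀ i : Fin N,
      -- the coupled variational density is a probability density
      (∀ t ∈ Set.Ioc 0 T, (∀ w, 0 < RSD.repulsiveDensity β k γ i z z t w) ∧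
        ∫ w, RSD.repulsiveDensity β k γ i z z t w = 1) ∧
      -- the regularizer with the coupled density is well defined, and it is the sum of the
      -- score-matching regularizers of the particles (up to the terminal KL) plus the coupling
      (∀ z' : Fin N → RSD.Vec d,
        (∀ t ∈ Set.Ioc 0 T,
          Integrable (RSD.logRatio β p₀ (RSD.repulsiveDensity β k γ i z z' t) t z') π) ∧
        IntervalIntegrable (fun t => deriv ω t *
          ∫ ε, RSD.logRatio β p₀ (RSD.repulsiveDensity β k γ i z z' t) t z' ε ∂π) volume 0 T ∧
        RSD.reg β ω T p₀ π (RSD.repulsiveDensity β k γ i z) z' =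
          (∑ l, (RSD.scoreMatching β ω T p₀ (Measure.dirac (z' l))
            + ω T * RSD.klAt β p₀ (Measure.dirac (z' l)) T))
          + ∫ t in (0 : ℝ)..T, deriv ω t *
              ∫ ε, Real.log (RSD.coupling k γ i (RSD.noisy β t z' ε) /
                RSD.normalizer β k γ i z t) ∂π) ∧
      -- at each time, the gradient in particle `i` with the coupled density held fixed
      (∀ t ∈ Set.Ioc 0 T,
        (∀ z' : Fin N → RSD.Vec d,
          Integrable (RSD.logRatio β p₀ (RSD.repulsiveDensity β k γ i z z t) t z') π) ∧
        Integrable (RSD.residual β k γ eps i z t) π ∧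
        HasGradientAt
          (fun ζ => ∫ ε, RSD.logRatio β p₀ (RSD.repulsiveDensity β k γ i z z t) t
            (Function.update z i ζ) ε ∂π)
          ((RSD.alpha β t / RSD.sigma β t) • ∫ ε, RSD.residual β k γ eps i z t ε ∂π) (z i)) ∧
      -- the `ω'`-weighted time integral of these gradients is the regularizer update
      Integrable (fun p : ℝ × (Fin N → RSD.Vec d) =>
          RSD.lam β ω T σv ρ p.1 • RSD.residual β k γ eps i z p.1 p.2)
        ((RSD.uniformTime T).prod π) ∧
      (4 * σv ^ 2 * ρ ^ 2) • (∫ t in (0 : ℝ)..T, deriv ω t •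
          gradient (fun ζ => ∫ ε, RSD.logRatio β p₀ (RSD.repulsiveDensity β k γ i z z t) t
            (Function.update z i ζ) ε ∂π) (z i)) =
        RSD.regUpdate β ω T σv ρ π k γ eps i z ∧
      -- it is also the gradient of the regularizer when the marginals move with the particle
      HasGradientAt
        (fun ζ => 4 * σv ^ 2 * ρ ^ 2 *
          RSD.reg β ω T p₀ π (RSD.repulsiveDensity β k γ i z) (Function.update z i ζ))
        (RSD.regUpdate β ω T σv ρ π k γ eps i z) (z i) ∧
      -- update direction of particle `i`: gradient of the objective in `u = (x i, z i)`
      HasGradientAt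
        (fun u : WithLp 2 (RSD.Vec m × RSD.Vec d) => 4 * σv ^ 2 * ρ ^ 2 *
          RSD.objective β ω T σv ρ y f D p₀ π (RSD.repulsiveDensity β k γ i z)
            (Function.update x i u.fst) (Function.update z i u.snd))
        ((1 / (N : ℝ)) • gradient
            (fun u : WithLp 2 (RSD.Vec m × RSD.Vec d) =>
              2 * ρ ^ 2 * ‖y - f u.fst‖ ^ 2 + 2 * σv ^ 2 * ‖u.fst - D u.snd‖ ^ 2)
            (WithLp.toLp 2 (x i, z i))
          + WithLp.toLp 2 (0, RSD.regUpdate β ω T σv ρ π k γ eps i z))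
        (WithLp.toLp 2 (x i, z i)) := by
  have h : RSD.IsSchedule β T := ⟨hT, hβ, hβpos⟩
  obtain ⟨C, a, hp⟩ := hp
  replace hp : RSD.ScoreGrowth β T p₀ C a := hp
  obtain ⟨K, hk_bdd⟩ := hk_bdd
  obtain ⟨c, hc, hk_diag⟩ := hk_diag
  obtain ⟨Ck, ak, hk_grad⟩ := hk_grad
  have hker : RSD.IsKernel k c K Ck ak := ⟨hk, hk_nonneg, hk_bdd, hc, hk_diag, hk_grad⟩
  -- Adding back the terminal KL leaves the pure time integral of KL, the form in which the
  -- gradients were computed.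
  have hsm : ∀ ζ, RSD.scoreMatching β ω T p₀ (Measure.dirac ζ)
      + ω T * RSD.klAt β p₀ (Measure.dirac ζ) T
      = ∫ t in (0 : ℝ)..T, deriv ω t * RSD.klAt β p₀ (Measure.dirac ζ) t := fun ζ => by
    rw [hp.scoreMatching_eq h hω hω0, sub_add_cancel]
  refine ⟨fun ζ => ⟨fun t ht => ⟨RSD.klDiv_ne_top p₀ (h.sigma_pos ht) ζ,
      RSD.integrable_score_sub_score p₀ (h.sigma_pos ht) ζ⟩,
    hp.intervalIntegrable_fisherAt h hω hω0 ζ, hp.intervalIntegrable_deriv_mul_klAt h hω ζ,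
    hp.scoreMatching_eq h hω hω0 ζ⟩, fun ζ => ⟨RSD.integrable_uniformTime_prod hT
      (hp.integrable_denoise h hω heps σv ρ ζ), ?_⟩, fun i => ?_⟩
  · simp_rw [hsm]
    rw [hp.integral_denoise h hω heps, hasGradientAt_iff_hasFDerivAt, map_smul]
    exact (hp.hasGradientAt_integral_klAt h hω ζ).hasFDerivAt.const_mul _
  · have hreg := hker.hasGradientAt_reg h hω hπ γ σv ρ i hp heps z
    refine ⟨fun t ht => ⟨hker.repulsiveDensity_pos (h.sigma_pos ht) γ i z z,
        hker.integral_repulsiveDensity (h.sigma_pos ht) γ i z⟩,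
      fun z' => ⟨fun t ht => hker.integrable_logRatio (h.sigma_pos ht) p₀ γ i hπ z z' z',
        (hker.intervalIntegrable_logRatio h γ i hω hπ hp z z').1, ?_⟩,
      fun t ht => ⟨fun z' => hker.integrable_logRatio (h.sigma_pos ht) p₀ γ i hπ z z z',
        hker.integrable_residual h hp heps γ i hπ ht z,
        hker.hasGradientAt_integral_logRatio h hp heps γ i hπ ht z⟩,
      RSD.integrable_uniformTime_prod hT
        (hker.integrable_lam_residual h hω hπ γ σv ρ i hp heps z),
      hker.integral_gradient_logRatio h hω hπ γ σv ρ i hp heps z, hreg,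
      RSD.hasGradientAt_objective y hσv hρ hf hD x z i hreg⟩
    simp_rw [hsm]
    exact (hker.intervalIntegrable_logRatio h γ i hω hπ hp z z').2
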